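/- **Setting.** Let $E$ be a Euclidean space, $\Phi\subset E$ an irreducible reduced (crystallographic) root system with Weyl group $W$, coroots $\alpha^\vee=2\alpha/\|\alpha\|^2$, base $\alpha_1,\dots,\alpha_r$, positive roots $\Phi^+$, simple reflections $s_i$, weight lattice $P$ and root lattice $Q$. Let $\mathbf Q:P\to\mathbb Q$ be a nonzero $W$-invariant quadratic form with integral values on $Q$, $\mathbf B(\lambda,\mu)=\mathbf Q(\lambda+\mu)-\mathbf Q(\lambda)-\mathbf Q(\mu)$, let $n\in\mathbb Z_{>0}$, and put $m(\alpha)=n/\gcd(n,\mathbf Q(\alpha))$, $\alpha^m=m(\alpha)\alpha$ for $\alpha\in\Phi$. Then $\Phi^m=\{\alpha^m\}$ is a root system; let $P^m\subseteq P$ be its weight lattice and $\rho^m=\frac12\sum_{\alpha\in\Phi^+}\alpha^m\in P^m$. Let $\mathrm{size}(\alpha^m)\in\{sh,lg\}$ tell whether $\alpha^m$ is short or long in $\Phi^m$ (all roots are long if they have the same length). Let $\mathbf k:\Phi\to\mathbb C^\times$ be $W$-invariant, $\mathbf k_i=\mathbf k_{\alpha_i}$, and let $g_j(y)\in\mathbb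 C^\times$ ($j\in\mathbb Z$, $y\in\{sh,lg\}$) satisfy: $g_j(y)=-1$ if $n\mid j$; $g_j(y)$ depends only on $j$ mod $n$; $g_j(y)g_{n-j}(y)=\mathbf k_\alpha^{-2}$ if $n\nmid j$ and $\mathrm{size}(\alpha^m)=y$. $\mathbb C[L]$ is the group algebra of a lattice $L$, with basis $x^\lambda$ ($\lambda\in L$), and $\mathbb C(L)$ is its quotient field; $W$ acts by $wx^\lambda=x^{w\lambda}$ if $L$ is $W$-stable. Let $\widetilde H^m(\mathbf k)$ be the extended affine Hecke algebra, generated by $T_1,\dots,T_r$ and $\mathbb C[P^m]$ with relations $(T_i-\mathbf k_i)(T_i+\mathbf k_i^{-1})=0$, the braid relations of $W$, and $T_ix^\nu-x^{s_i\nu}T_i=(\mathbf k_i-\mathbf k_i^{-1})\frac{x^\nu-x^{s_i\nu}}{1-x^{\alpha_i^m}}$ for $\nu\in P^m$. Let $\widetilde H^m_{loc}(\mathbf k)$ be its Ore localization at $\mathbb C[P^m]\setminus\{0\}$. Let $W\ltimes\mathbb C(P^m)$ be the semidirect product algebra, in which $wf=(wf)w$ for $f\in\mathbb C(P^m)$.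 Put $c_i=\frac{1-\mathbf k_i^2x^{\alpha_i^m}}{1-x^{\alpha_i^m}}$. For $t\in\mathbb Z$ let $\mathbf r_s(t)\in\{0,\dots,s-1\}$ be the remainder of $t$ modulo $s$, and for $\mu\in P$ put $q_i(\mu)=\frac{(\mu,\alpha_i^\vee)-\mathbf r_{m(\alpha_i)}((\mu,\alpha_i^\vee))}{m(\alpha_i)}$. **Statement.** (1) There is a unique algebra isomorphism $\varphi:W\ltimes\mathbb C(P^m)\to\widetilde H^m_{loc}(\mathbf k)$ with $\varphi(f)=f$ for $f\in\mathbb C(P^m)$ and $\varphi(s_i)=\frac{\mathbf k_i}{c_i}T_i+1-\frac{\mathbf k_i^2}{c_i}$ for all $i$. There is a unique algebra homomorphism $\sigma:W\ltimes\mathbb C(P^m)\to\mathrm{End}(\mathbb C(P))$ with $$\sigma(s_i)(fx^\lambda)=\frac{(1-\mathbf k_i^2)x^{q_i(-\lambda)\alpha_i^m}}{1-\mathbf k_i^2x^{\alpha_i^m}}(s_if)x^\lambda+\mathbf k_i^2\,g_{\mathbf Q(\alpha_i)-\mathbf B(\lambda,\alpha_i)}(\mathrm{size}(\alpha_i^m))\frac{1-x^{-\alpha_i^m}}{1-\mathbf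 k_i^2x^{\alpha_i^m}}(s_if)x^{\alpha_i+s_i\lambda}$$ and $\sigma(h)(fx^\lambda)=hfx^\lambda$ for $f,h\in\mathbb C(P^m)$, $\lambda\in P$. (2) The representation $\tau:=\sigma\circ\varphi^{-1}$ of $\widetilde H^m_{loc}(\mathbf k)$ on $\mathbb C(P)$ satisfies, for all $u\in\mathbb C(P)$, $h\in\mathbb C(P^m)$ and all $i$, $$\tau(T_i)u=\mathbf k_iu+\mathbf k_i^{-1}c_i(\sigma(s_i)u-u),\qquad\tau(h)u=hu.$$ (3) Let $\mathcal T_i:=-\mathbf k_i\,\tau(x^{\rho^m}T_i^{-1}x^{-\rho^m})\in\mathrm{End}(\mathbb C(P))$ be the metaplectic Demazure–Lusztig operators. Then $$\mathcal T_i(u)=(1-\mathbf k_i^2x^{\alpha_i^m})\frac{u-x^{\alpha_i^m}\sigma(s_i)u}{1-x^{\alpha_i^m}}-u\qquad(u\in\mathbb C(P)).$$ If $\mathbf k$ is constant and $g_j(y)=g_j$ does not depend on $y$, then with $v=\mathbf k^2$ the action $\sigma$ is the Chinta–Gunnells action $$\sigma(s_i)(fx^\lambda)=\frac{(s_if)x^{s_i\lambda}}{1-vx^{m(\alpha_i)\alpha_i}}\Bigl[x^{-\mathbf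 r_{m(\alpha_i)}\left(-\frac{\mathbf B(\lambda,\alpha_i)}{\mathbf Q(\alpha_i)}\right)\alpha_i}(1-v)-v\,g_{\mathbf Q(\alpha_i)-\mathbf B(\lambda,\alpha_i)}x^{(1-m(\alpha_i))\alpha_i}(1-x^{m(\alpha_i)\alpha_i})\Bigr]$$ for $f\in\mathbb C(P^m)$, $\lambda\in P$ (so that the $\mathcal T_i$ are then the Chinta–Gunnells–Puskás operators). (4) The $\mathcal T_i$ satisfy the braid relations $\mathcal T_i\mathcal T_j\mathcal T_i\cdots=\mathcal T_j\mathcal T_i\mathcal T_j\cdots$ ($i\ne j$, with $m_{ij}$ factors on each side, $m_{ij}$ the order of $s_is_j$) and $\mathcal T_i^2=(\mathbf k_i^2-1)\mathcal T_i+\mathbf k_i^2$. (5) Each $\mathcal T_i$ preserves $\mathbb C[P]$ and, for every lattice $\Lambda$ with $Q\subseteq\Lambda\subseteq P$, the subspaces $\mathbb C[\Lambda]$ and $\mathbb C(\Lambda)$ of $\mathbb C(P)$. -/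

import Mathlib

open scoped InnerProductSpace

noncomputable section

namespace Metaplectic

variable {ι E : Type*} [NormedAddCommGroup E] [InnerProductSpace ℝ E]

/-! ### Root systems in a Euclidean space and their lattices -/

/-- The root pairing `Φ` on the Euclidean space `E` is a root system in the classical sense:
coroots are the vectors `α^∨ = 2α/‖α‖²` of `E`, and `E` is paired with itself through the scalar
product (so reflections are the orthogonal reflections). -/
class IsEuclidean (Φ : RootPairing ι ℝ E E) : Prop where
  toLinearMap_eq : ∀ x y : E, Φ.toLinearMap x y = ⟪x, y⟫_ℝ
  coroot_eq : ∀ i, Φ.coroot i = (2 / ‖Φ.root i‖ ^ 2) • Φ.root i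

/-- The weight lattice `{λ ∈ E | (λ, β^∨) ∈ ℤ for all β ∈ S}` of a root system `S ⊆ E`,
where `β^∨ = 2β/‖β‖²`. -/
def weightLattice (S : Set E) : AddSubgroup E where
  carrier := {x | ∀ β ∈ S, ∃ z : ℤ, ⟪x, (2 / ‖β‖ ^ 2) • β⟫_ℝ = z}
  zero_mem' := fun β _ => ⟨0, by simp⟩
  add_mem' := by
    intro x y hx hy β hβ
    obtain ⟨a, ha⟩ := hx β hβ
    obtain ⟨c, hc⟩ := hy β hβ
    exact ⟨a + c, by rw [inner_add_left, ha, hc]; push_cast; ring⟩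
  neg_mem' := by
    intro x hx β hβ
    obtain ⟨a, ha⟩ := hx β hβ
    exact ⟨-a, by rw [inner_neg_left, ha]; push_cast; ring⟩

/-- The lattice `ℤS` generated by `S ⊆ E`. -/
def rootLattice (S : Set E) : AddSubgroup E := AddSubgroup.closure S

/-- The weight lattice `P` of `Φ`. -/
abbrev WeightLat (Φ : RootPairing ι ℝ E E) : AddSubgroup E := weightLattice (Set.range Φ.root)

/-- The root lattice `Q` of `Φ`. -/
abbrev RootLat (Φ : RootPairing ι ℝ E E) : AddSubgroup E := rootLattice (Set.range Φ.root)

section Basics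

variable {Φ : RootPairing ι ℝ E E}

lemma inner_coroot [IsEuclidean Φ] (x : E) (i : ι) :
    ⟪x, (2 / ‖Φ.root i‖ ^ 2) • Φ.root i⟫_ℝ = Φ.toLinearMap x (Φ.coroot i) := by
  rw [IsEuclidean.toLinearMap_eq, IsEuclidean.coroot_eq]

lemma mem_weightLat [IsEuclidean Φ] {x : E} :
    x ∈ WeightLat Φ ↔ ∀ i, ∃ z : ℤ, Φ.toLinearMap x (Φ.coroot i) = z := by
  constructor
  · intro h i
    obtain ⟨z, hz⟩ := h _ ⟨i, rfl⟩
    exact ⟨z, by rw [← hz, inner_coroot]⟩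
  · rintro h _ ⟨i, rfl⟩
    obtain ⟨z, hz⟩ := h i
    exact ⟨z, by rw [← hz, inner_coroot]⟩

lemma inner_reflection [IsEuclidean Φ] (i : ι) (x y : E) :
    ⟪Φ.reflection i x, Φ.reflection i y⟫_ℝ = ⟪x, y⟫_ℝ := by
  have h0 : ‖Φ.root i‖ ^ 2 ≠ 0 := by
    have := Φ.ne_zero i
    positivity
  have hs : ⟪Φ.root i, Φ.root i⟫_ℝ = ‖Φ.root i‖ ^ 2 := real_inner_self_eq_norm_sq _
  simp only [RootPairing.reflection_apply, LinearMap.flip_apply, IsEuclidean.toLinearMap_eq,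
    IsEuclidean.coroot_eq, inner_sub_left, inner_sub_right, inner_smul_left, inner_smul_right, hs,
    RCLike.conj_to_real, real_inner_comm (Φ.root i) y]
  generalize ‖Φ.root i‖ ^ 2 = N at h0 hs ⊢
  field_simp
  ring

lemma inner_weyl [IsEuclidean Φ] (w : Φ.weylGroup) (x y : E) : ⟪w • x, w • y⟫_ℝ = ⟪x, y⟫_ℝ := by
  obtain ⟨w, hw⟩ := w
  revert x y
  induction hw using RootPairing.weylGroup.induction with
  | mem i => exact inner_reflection i
  | one => intro x y; rfl
  | mul g₁ g₂ h₁ h₂ ih₁ ih₂ =>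
    intro x y
    rw [← Submonoid.mk_mul_mk _ _ _ h₁ h₂, mul_smul, mul_smul, ih₁, ih₂]

lemma weyl_smul_root (w : Φ.weylGroup) (i : ι) : w • Φ.root i = Φ.root (w • i) :=
  Φ.weylGroup_apply_root w i

/-- The Weyl group is finite: its elements are determined by their action on the roots. -/
instance finite_weylGroup [Finite ι] [Φ.IsRootSystem] : Finite Φ.weylGroup := by
  have : Function.Injective (fun w : Φ.weylGroup => (fun i : ι => w • i)) := by
    intro w w' h
    apply Subtype.ext
    apply RootPairing.Equiv.weightHom_injective Φ
    apply LinearEquiv.toLinearMap_injective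
    refine LinearMap.ext_on_range (v := Φ.root)
      (RootPairing.IsRootSystem.span_root_eq_top (P := Φ)) ?_
    intro i
    have h1 : w • Φ.root i = w' • Φ.root i := by
      rw [weyl_smul_root, weyl_smul_root]
      exact congrArg _ (congrFun h i)
    exact h1
  exact Finite.of_injective _ this

/-- The lattice `L` is stable under the Weyl group of `Φ`. -/
class WeylStable (Φ : RootPairing ι ℝ E E) (L : AddSubgroup E) : Prop where
  smul_mem : ∀ (w : Φ.weylGroup) {x : E}, x ∈ L → w • x ∈ L

lemma weylStable_weightLattice [IsEuclidean Φ] {S : Set E}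
    (hS : ∀ w : Φ.weylGroup, ∀ β ∈ S, w • β ∈ S) : WeylStable Φ (weightLattice S) where
  smul_mem := by
    intro w x hx β hβ
    obtain ⟨z, hz⟩ := hx _ (hS w⁻¹ β hβ)
    refine ⟨z, ?_⟩
    have hn : ‖w⁻¹ • β‖ ^ 2 = ‖β‖ ^ 2 := by
      rw [← real_inner_self_eq_norm_sq, ← real_inner_self_eq_norm_sq, inner_weyl]
    rw [inner_smul_right, hn, ← inner_weyl w, smul_inv_smul] at hz
    rw [inner_smul_right, hz]

instance [IsEuclidean Φ] : WeylStable Φ (WeightLat Φ) :=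
  weylStable_weightLattice (by
    rintro w _ ⟨i, rfl⟩
    exact ⟨w • i, (weyl_smul_root w i).symm⟩)

/-- The action of the Weyl group on a stable lattice. -/
instance (L : AddSubgroup E) [WeylStable Φ L] : DistribMulAction Φ.weylGroup L where
  smul w x := ⟨w • (x : E), WeylStable.smul_mem w x.2⟩
  one_smul x := Subtype.ext (one_smul _ (x : E))
  mul_smul w w' x := Subtype.ext (mul_smul w w' (x : E))
  smul_zero w := Subtype.ext (smul_zero w)
  smul_add w x y := Subtype.ext (smul_add w (x : E) y)

@[simp] lemma coe_weyl_smul (L : AddSubgroup E) [WeylStable Φ L] (w : Φ.weylGroup) (x : L) :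
    ((w • x : L) : E) = w • (x : E) := rfl

lemma root_mem_weightLat [IsEuclidean Φ] [Φ.IsCrystallographic] (i : ι) :
    Φ.root i ∈ WeightLat Φ :=
  mem_weightLat.2 fun j => ⟨Φ.pairingIn ℤ i j, by
    rw [RootPairing.root_coroot_eq_pairing, ← Φ.algebraMap_pairingIn ℤ]; simp⟩

end Basics

variable (Φ : RootPairing ι ℝ E E)

/-- The root `α` as an element of the weight lattice. -/
def rootW [IsEuclidean Φ] [Φ.IsCrystallographic] (i : ι) : WeightLat Φ :=
  ⟨Φ.root i, root_mem_weightLat i⟩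

/-- The integer `(λ, α^∨)`, for a weight `λ` and a root `α`. -/
def wpair (x : WeightLat Φ) (i : ι) : ℤ := (x.2 (Φ.root i) ⟨i, rfl⟩).choose

lemma wpair_cast (x : WeightLat Φ) (i : ι) :
    (wpair Φ x i : ℝ) = ⟪(x : E), (2 / ‖Φ.root i‖ ^ 2) • Φ.root i⟫_ℝ :=
  ((x.2 (Φ.root i) ⟨i, rfl⟩).choose_spec).symm

/-- The reflection `s_α` as an element of the Weyl group. -/
abbrev sRefl (i : ι) : Φ.weylGroup := RootPairing.weylGroup.ofIdx Φ i

lemma refl_smul_coe [IsEuclidean Φ] (x : WeightLat Φ) (i : ι) :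
    sRefl Φ i • (x : E) = (x : E) - (wpair Φ x i) • Φ.root i := by
  have : sRefl Φ i • (x : E) = Φ.reflection i (x : E) := rfl
  rw [this, RootPairing.reflection_apply, ← Int.cast_smul_eq_zsmul ℝ, wpair_cast, inner_coroot]
  rfl

lemma refl_smul_weight [IsEuclidean Φ] [Φ.IsCrystallographic] (x : WeightLat Φ) (i : ι) :
    sRefl Φ i • x = x - (wpair Φ x i) • rootW Φ i :=
  Subtype.ext (by simpa [rootW] using refl_smul_coe Φ x i)

/-! ### The metaplectic structure -/

/-- A metaplectic structure on `Φ`: a nonzero `W`-invariant quadratic form `Q : P → ℚ` taking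
integral values on the root lattice, and a positive integer `n`. -/
structure MetaplecticStructure [IsEuclidean Φ] where
  Q : QuadraticMap ℤ (WeightLat Φ) ℚ
  Q_ne_zero : Q ≠ 0
  Q_weyl : ∀ (w : Φ.weylGroup) (x : WeightLat Φ), Q (w • x) = Q x
  Q_int : ∀ x : WeightLat Φ, (x : E) ∈ RootLat Φ → ∃ z : ℤ, Q x = z
  n : ℕ
  n_pos : 0 < n

variable {Φ}

namespace MetaplecticStructure

variable [IsEuclidean Φ] (D : MetaplecticStructure Φ)

/-- The bilinear form `B(λ, μ) = Q(λ+μ) - Q(λ) - Q(μ)`. -/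
def B (x y : WeightLat Φ) : ℚ := D.Q (x + y) - D.Q x - D.Q y

variable [Φ.IsCrystallographic]

/-- The integer `Q(α)` of a root `α`. -/
def Qroot (i : ι) : ℤ := (D.Q (rootW Φ i)).num

lemma Qroot_cast (i : ι) : (D.Qroot i : ℚ) = D.Q (rootW Φ i) := by
  obtain ⟨z, hz⟩ := D.Q_int (rootW Φ i) (AddSubgroup.subset_closure ⟨i, rfl⟩)
  rw [Qroot, hz]; simp

lemma B_root (x : WeightLat Φ) (i : ι) : D.B x (rootW Φ i) = D.Qroot i * wpair Φ x i := by
  rw [Qroot_cast]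
  have key : ∀ y : WeightLat Φ, D.B y (rootW Φ i) = QuadraticMap.polarBilin D.Q y (rootW Φ i) := by
    intro y; simp [B, QuadraticMap.polarBilin_apply_apply, QuadraticMap.polar]
  have hinv : D.B (sRefl Φ i • x) (sRefl Φ i • rootW Φ i) = D.B x (rootW Φ i) := by
    simp only [B, ← smul_add, D.Q_weyl]
  have hr : sRefl Φ i • rootW Φ i = - rootW Φ i := by
    apply Subtype.ext
    have : sRefl Φ i • Φ.root i = Φ.reflection i (Φ.root i) := rfl
    simp [rootW, this]
  have hneg : ∀ y : WeightLat Φ, D.B y (-rootW Φ i) = - D.B y (rootW Φ i) := by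
    intro y
    have : D.B y (-rootW Φ i) = QuadraticMap.polarBilin D.Q y (-rootW Φ i) := by
      simp [B, QuadraticMap.polarBilin_apply_apply, QuadraticMap.polar]
    rw [this, key, map_neg]
  have hself : D.B (rootW Φ i) (rootW Φ i) = 2 * D.Q (rootW Φ i) := by
    have : D.Q (rootW Φ i + rootW Φ i) = 4 * D.Q (rootW Φ i) := by
      rw [← two_smul ℤ, QuadraticMap.map_smul]; norm_num
    rw [B, this]; ring
  rw [hr, hneg, refl_smul_weight, key, map_sub, map_zsmul] at hinv
  simp only [LinearMap.sub_apply, LinearMap.smul_apply, ← key, hself, zsmul_eq_mul] at hinv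
  linarith

/-- The integer `B(λ, α)`, for a weight `λ` and a root `α`. -/
def Broot (x : WeightLat Φ) (i : ι) : ℤ := (D.B x (rootW Φ i)).num

lemma Broot_cast (x : WeightLat Φ) (i : ι) : (D.Broot x i : ℚ) = D.B x (rootW Φ i) := by
  rw [Broot, B_root, ← Int.cast_mul, Rat.num_intCast]

/-- `m(α) = n / gcd(n, Q(α))`. -/
def m (i : ι) : ℕ := D.n / Int.gcd D.n (D.Qroot i)

/-- The root `α^m = m(α) α` of the root system `Φ^m`. -/
def metaRoot (i : ι) : E := (D.m i : ℝ) • Φ.root i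

/-- The weight lattice `P^m` of `Φ^m`. -/
abbrev MetaWeightLat : AddSubgroup E := weightLattice (Set.range D.metaRoot)

lemma m_pos (i : ι) : 0 < D.m i :=
  Nat.div_pos (Nat.le_of_dvd D.n_pos (Int.natCast_dvd_natCast.1 (Int.gcd_dvd_left _ _)))
    (Int.gcd_pos_of_ne_zero_left _ (by exact_mod_cast D.n_pos.ne'))

lemma Qroot_weyl (w : Φ.weylGroup) (i : ι) : D.Qroot (w • i) = D.Qroot i := by
  have : rootW Φ (w • i) = w • rootW Φ i := Subtype.ext (weyl_smul_root w i).symm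
  rw [Qroot, this, D.Q_weyl, Qroot]

lemma m_weyl (w : Φ.weylGroup) (i : ι) : D.m (w • i) = D.m i := by rw [m, m, Qroot_weyl]

lemma weyl_smul_metaRoot (w : Φ.weylGroup) (i : ι) : w • D.metaRoot i = D.metaRoot (w • i) := by
  have hc : ∀ (c : ℝ) (x : E), w • (c • x) = c • (w • x) := fun c x => smul_comm w.1 c x
  rw [metaRoot, metaRoot, m_weyl, hc, weyl_smul_root]

instance : WeylStable Φ D.MetaWeightLat :=
  weylStable_weightLattice (by
    rintro w _ ⟨i, rfl⟩
    exact ⟨w • i, (D.weyl_smul_metaRoot w i).symm⟩)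

lemma coroot_metaRoot (i : ι) : (2 / ‖D.metaRoot i‖ ^ 2) • D.metaRoot i =
    (D.m i : ℝ)⁻¹ • (2 / ‖Φ.root i‖ ^ 2) • Φ.root i := by
  have h0 : (D.m i : ℝ) ≠ 0 := by exact_mod_cast (D.m_pos i).ne'
  have h1 : ‖Φ.root i‖ ≠ 0 := norm_ne_zero_iff.2 (Φ.ne_zero i)
  rw [metaRoot, norm_smul, smul_smul, smul_smul]
  congr 1
  simp only [Real.norm_natCast]
  field_simp

/-- `λ ∈ P^m` iff `(λ, α^∨) ∈ m(α)ℤ` for all roots `α`. -/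
lemma mem_metaWeightLat {x : E} : x ∈ D.MetaWeightLat ↔
    ∀ i, ∃ z : ℤ, Φ.toLinearMap x (Φ.coroot i) = D.m i * z := by
  have h0 : ∀ i, (D.m i : ℝ) ≠ 0 := fun i => by exact_mod_cast (D.m_pos i).ne'
  have key : ∀ i, ⟪x, (2 / ‖D.metaRoot i‖ ^ 2) • D.metaRoot i⟫_ℝ =
      (D.m i : ℝ)⁻¹ * Φ.toLinearMap x (Φ.coroot i) := by
    intro i
    rw [coroot_metaRoot, inner_smul_right, inner_coroot]
  constructor
  · intro h i
    obtain ⟨z, hz⟩ := h _ ⟨i, rfl⟩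
    refine ⟨z, ?_⟩
    rw [key] at hz
    rw [← hz, mul_inv_cancel_left₀ (h0 i)]
  · rintro h _ ⟨i, rfl⟩
    obtain ⟨z, hz⟩ := h i
    exact ⟨z, by rw [key, hz, inv_mul_cancel_left₀ (h0 i)]⟩

lemma metaWeightLat_le : D.MetaWeightLat ≤ WeightLat Φ := by
  intro x hx
  refine mem_weightLat.2 fun i => ?_
  obtain ⟨z, hz⟩ := D.mem_metaWeightLat.1 hx i
  exact ⟨D.m i * z, by rw [hz]; push_cast; rfl⟩

/-- The inclusion `P^m ⊆ P`. -/
def toWeight : D.MetaWeightLat →+ WeightLat Φ := AddSubgroup.inclusion D.metaWeightLat_le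

lemma Qroot_mul_pairing (i j : ι) :
    D.Qroot i * wpair Φ (rootW Φ j) i = D.Qroot j * wpair Φ (rootW Φ i) j := by
  have h1 := D.B_root (rootW Φ j) i
  have h2 := D.B_root (rootW Φ i) j
  have h3 : D.B (rootW Φ j) (rootW Φ i) = D.B (rootW Φ i) (rootW Φ j) := by
    simp only [B]; rw [add_comm (rootW Φ j)]; ring
  rw [h1, h2] at h3
  exact_mod_cast h3

lemma dvd_of_n_dvd {i : ι} {c : ℤ} (h : (D.n : ℤ) ∣ D.Qroot i * c) : (D.m i : ℤ) ∣ c := by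
  have hg : 0 < Int.gcd D.n (D.Qroot i) :=
    Int.gcd_pos_of_ne_zero_left _ (by exact_mod_cast D.n_pos.ne')
  obtain ⟨q, hq⟩ := Int.gcd_dvd_right (D.n : ℤ) (D.Qroot i)
  have hn : (Int.gcd D.n (D.Qroot i) : ℤ) * D.m i = D.n := by
    have := Nat.mul_div_cancel' (Int.natCast_dvd_natCast.1 (Int.gcd_dvd_left (D.n : ℤ) (D.Qroot i)))
    exact_mod_cast this
  have hcop : IsCoprime (D.m i : ℤ) q := by
    have hb := Int.gcd_eq_gcd_ab (D.n : ℤ) (D.Qroot i)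
    refine ⟨Int.gcdA D.n (D.Qroot i), Int.gcdB D.n (D.Qroot i), ?_⟩
    have hgz : (Int.gcd D.n (D.Qroot i) : ℤ) ≠ 0 := by exact_mod_cast hg.ne'
    apply mul_left_cancel₀ hgz
    calc _ = (Int.gcd D.n (D.Qroot i) * D.m i : ℤ) * Int.gcdA D.n (D.Qroot i)
          + (Int.gcd D.n (D.Qroot i) * q : ℤ) * Int.gcdB D.n (D.Qroot i) := by ring
      _ = Int.gcd D.n (D.Qroot i) * 1 := by rw [hn, ← hq, ← hb, mul_one]
  refine hcop.dvd_of_dvd_mul_left ?_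
  have hgz : (Int.gcd D.n (D.Qroot i) : ℤ) ≠ 0 := by exact_mod_cast hg.ne'
  apply (mul_dvd_mul_iff_left hgz).1
  rw [hn, ← mul_assoc, ← hq]
  exact h

lemma n_dvd_m_mul (i : ι) : (D.n : ℤ) ∣ D.m i * D.Qroot i := by
  obtain ⟨q, hq⟩ := Int.gcd_dvd_right (D.n : ℤ) (D.Qroot i)
  have hn : (Int.gcd D.n (D.Qroot i) : ℤ) * D.m i = D.n := by
    have := Nat.mul_div_cancel' (Int.natCast_dvd_natCast.1 (Int.gcd_dvd_left (D.n : ℤ) (D.Qroot i)))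
    exact_mod_cast this
  exact ⟨q, by rw [← hn]; conv_lhs => rw [hq]
               ring⟩

lemma metaRoot_mem (j : ι) : D.metaRoot j ∈ D.MetaWeightLat := by
  refine D.mem_metaWeightLat.2 fun i => ?_
  have h : (D.m i : ℤ) ∣ D.m j * wpair Φ (rootW Φ j) i := by
    apply D.dvd_of_n_dvd
    have : D.Qroot i * (D.m j * wpair Φ (rootW Φ j) i) =
        (D.m j * D.Qroot j) * wpair Φ (rootW Φ i) j := by
      rw [mul_left_comm, Qroot_mul_pairing]; ring
    rw [this]
    exact Dvd.dvd.mul_right (D.n_dvd_m_mul j) _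
  obtain ⟨z, hz⟩ := h
  refine ⟨z, ?_⟩
  have h2 : (wpair Φ (rootW Φ j) i : ℝ) = Φ.toLinearMap (Φ.root j) (Φ.coroot i) := by
    rw [wpair_cast, inner_coroot]; rfl
  rw [metaRoot, map_smul, LinearMap.smul_apply, ← h2, smul_eq_mul]
  exact_mod_cast hz

/-- The root `α^m` as an element of `P^m`. -/
def metaRootW (i : ι) : D.MetaWeightLat := ⟨D.metaRoot i, D.metaRoot_mem i⟩

/-- `ρ^m`, half the sum of the positive roots of `Φ^m`. -/
def rhoVec (b : Φ.Base) : E :=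
  (1 / 2 : ℝ) • ∑ᶠ i ∈ {i : ι | b.IsPos i}, D.metaRoot i

section Rho

variable [Finite ι] [Φ.IsReduced] (b : Φ.Base)

lemma refl_smul_rhoVec {j : ι} (hj : j ∈ b.support) :
    sRefl Φ j • D.rhoVec b = D.rhoVec b - D.metaRoot j := by
  have hc : ∀ (w : Φ.weylGroup) (c : ℝ) (x : E), w • (c • x) = c • (w • x) :=
    fun w c x => smul_comm w.1 c x
  set A : Set ι := {i : ι | b.IsPos i} \ {j} with hA
  have hins : {i : ι | b.IsPos i} = insert j A := by
    rw [hA, Set.insert_sdiff_singleton, Set.insert_eq_of_mem]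
    exact b.isPos_of_mem_support hj
  have hsum : ∑ᶠ i ∈ {i : ι | b.IsPos i}, D.metaRoot i =
      D.metaRoot j + ∑ᶠ i ∈ A, D.metaRoot i := by
    rw [hins, finsum_mem_insert _ (by simp [hA]) (Set.toFinite _)]
  have hperm : ∀ i, sRefl Φ j • i = Φ.reflectionPerm j i := fun i => rfl
  have hmaps : ∀ i ∈ A, Φ.reflectionPerm j i ∈ A := by
    rintro i ⟨hi, hij⟩
    refine ⟨RootPairing.Base.IsPos.reflectionPerm hi hj hij, ?_⟩
    intro h
    have h1 : i = Φ.reflectionPerm j j := by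
      have h0 : Φ.reflectionPerm j i = j := Set.mem_singleton_iff.1 h
      have h00 := congrArg (Φ.reflectionPerm j) h0
      rwa [RootPairing.reflectionPerm_self] at h00
    have h2 : b.height (Φ.reflectionPerm j j) = - b.height j := b.height_reflectionPerm_self j
    have hi' : 0 < b.height i := hi
    have hj' : 0 < b.height j := b.isPos_of_mem_support hj
    rw [← h1] at h2
    omega
  have hbij : Set.BijOn (Φ.reflectionPerm j) A A := by
    refine ⟨hmaps, (Φ.reflectionPerm j).injective.injOn, fun i hi => ?_⟩
    exact ⟨_, hmaps i hi, RootPairing.reflectionPerm_self Φ j i⟩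
  have hA2 : sRefl Φ j • ∑ᶠ i ∈ A, D.metaRoot i = ∑ᶠ i ∈ A, D.metaRoot i := by
    have := (DistribSMul.toAddMonoidHom E (sRefl Φ j)).map_finsum_mem
      (f := D.metaRoot) (Set.toFinite A)
    rw [DistribSMul.toAddMonoidHom_apply] at this
    rw [this]
    refine finsum_mem_eq_of_bijOn _ hbij fun i _ => ?_
    rw [DistribSMul.toAddMonoidHom_apply, weyl_smul_metaRoot, hperm]
  have hneg : sRefl Φ j • D.metaRoot j = - D.metaRoot j := by
    have : sRefl Φ j • Φ.root j = Φ.reflection j (Φ.root j) := rfl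
    rw [metaRoot, hc, this, RootPairing.reflection_apply_self, smul_neg]
  rw [rhoVec, hc, hsum, smul_add, hneg, hA2]
  module

lemma rhoVec_mem : D.rhoVec b ∈ D.MetaWeightLat := by
  have hm : ∀ (w : Φ.weylGroup) (i : ι), D.m (w • i) = D.m i := D.m_weyl
  have hinner : ∀ (x : E) (i j : ι),
      ⟪x, (2 / ‖Φ.root (sRefl Φ j • i)‖ ^ 2) • Φ.root (sRefl Φ j • i)⟫_ℝ =
      ⟪sRefl Φ j • x, (2 / ‖Φ.root i‖ ^ 2) • Φ.root i⟫_ℝ := by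
    intro x i j
    have hinv : sRefl Φ j • sRefl Φ j • x = x := by
      have : sRefl Φ j • sRefl Φ j • x = Φ.reflection j (Φ.reflection j x) := rfl
      rw [this, RootPairing.reflection_same]
    have hn : ‖sRefl Φ j • Φ.root i‖ ^ 2 = ‖Φ.root i‖ ^ 2 := by
      rw [← real_inner_self_eq_norm_sq, ← real_inner_self_eq_norm_sq, inner_weyl]
    rw [← weyl_smul_root, hn, inner_smul_right, inner_smul_right]
    conv_lhs => rw [← hinv, inner_weyl]
  refine D.mem_metaWeightLat.2 fun i => ?_
  refine b.induction_reflect i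
    (p := fun i => ∃ z : ℤ, Φ.toLinearMap (D.rhoVec b) (Φ.coroot i) = D.m i * z) ?_ ?_ ?_
  · rintro i ⟨z, hz⟩
    refine ⟨-z, ?_⟩
    have h1 : Φ.coroot (Φ.reflectionPerm i i) = - Φ.coroot i := by
      rw [← RootPairing.reflectionPerm_coroot]
      rw [RootPairing.root_coroot_two]; module
    have h2 : D.m (Φ.reflectionPerm i i) = D.m i := hm (sRefl Φ i) i
    rw [h1, h2, map_neg, hz]; push_cast; ring
  · intro i hi
    refine ⟨1, ?_⟩
    have h := D.refl_smul_rhoVec b hi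
    have h1 : sRefl Φ i • D.rhoVec b = Φ.reflection i (D.rhoVec b) := rfl
    rw [h1, RootPairing.reflection_apply, sub_right_inj, metaRoot] at h
    have := smul_left_injective ℝ (Φ.ne_zero i) h
    simpa using this
  · rintro i j ⟨z, hz⟩ hj
    obtain ⟨y, hy⟩ := D.mem_metaWeightLat.1 (D.metaRoot_mem j) i
    refine ⟨z - y, ?_⟩
    have h2 : D.m (Φ.reflectionPerm j i) = D.m i := hm (sRefl Φ j) i
    have h3 := hinner (D.rhoVec b) i j
    rw [D.refl_smul_rhoVec b hj, inner_coroot, inner_coroot, map_sub, LinearMap.sub_apply, hz,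
      hy] at h3
    rw [h2]
    refine Eq.trans h3 ?_
    push_cast; ring

/-- `ρ^m` as an element of `P^m`. -/
def rho : D.MetaWeightLat := ⟨D.rhoVec b, D.rhoVec_mem b⟩

end Rho

end MetaplecticStructure

/-! ### Group algebras of lattices and their fraction fields -/

section GroupAlgebra

variable (L : AddSubgroup E)

set_option linter.unusedSectionVars false

instance : TwoUniqueSums L :=
  letI : Module ℚ E := Module.compHom E (algebraMap ℚ ℝ)
  TwoUniqueSums.of_injective_addHom (L.subtype : L →ₙ+ E) Subtype.val_injective inferInstance

instance : IsDomain (AddMonoidAlgebra ℂ L) := NoZeroDivisors.to_isDomain _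

/-- The group algebra `ℂ[L]` of a lattice `L`. -/
abbrev GrpAlg : Type _ := AddMonoidAlgebra ℂ L

/-- The quotient field `ℂ(L)` of `ℂ[L]`. -/
abbrev RatFun : Type _ := FractionRing (GrpAlg L)

variable {L}

/-- The monomial `x^λ` in `ℂ[L]`. -/
def monoP (a : L) : GrpAlg L := AddMonoidAlgebra.single a 1

/-- The monomial `x^λ` in `ℂ(L)`. -/
def mono (a : L) : RatFun L := algebraMap (GrpAlg L) (RatFun L) (monoP a)

lemma monoP_add (a c : L) : monoP (a + c) = monoP a * monoP c := by
  simp [monoP, AddMonoidAlgebra.single_mul_single]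

/-- The Weyl group acts on `ℂ[L]` by algebra automorphisms with `w x^λ = x^{wλ}`. -/
instance [WeylStable Φ L] : MulSemiringAction Φ.weylGroup (GrpAlg L) where
  smul w f := AddMonoidAlgebra.domCongr ℂ ℂ (DistribMulAction.toAddEquiv L w) f
  one_smul f := by
    change AddMonoidAlgebra.domCongr ℂ ℂ (DistribMulAction.toAddEquiv L (1 : Φ.weylGroup)) f = f
    induction f using AddMonoidAlgebra.induction_linear with
    | zero => simp
    | add f g hf hg => rw [map_add, hf, hg]
    | single a c => simp
  mul_smul w w' f := by
    change AddMonoidAlgebra.domCongr ℂ ℂ (DistribMulAction.toAddEquiv L (w * w')) f =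
      AddMonoidAlgebra.domCongr ℂ ℂ (DistribMulAction.toAddEquiv L w)
        (AddMonoidAlgebra.domCongr ℂ ℂ (DistribMulAction.toAddEquiv L w') f)
    induction f using AddMonoidAlgebra.induction_linear with
    | zero => simp
    | add f g hf hg => simp only [map_add, hf, hg]
    | single a c => simp [mul_smul]
  smul_zero w := map_zero (AddMonoidAlgebra.domCongr ℂ ℂ (DistribMulAction.toAddEquiv L w))
  smul_add w := map_add (AddMonoidAlgebra.domCongr ℂ ℂ (DistribMulAction.toAddEquiv L w))
  smul_one w := map_one (AddMonoidAlgebra.domCongr ℂ ℂ (DistribMulAction.toAddEquiv L w))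
  smul_mul w := map_mul (AddMonoidAlgebra.domCongr ℂ ℂ (DistribMulAction.toAddEquiv L w))

lemma weyl_smul_single [WeylStable Φ L] (w : Φ.weylGroup) (a : L) (c : ℂ) :
    w • (AddMonoidAlgebra.single a c : GrpAlg L) = AddMonoidAlgebra.single (w • a) c := by
  change AddMonoidAlgebra.domCongr ℂ ℂ (DistribMulAction.toAddEquiv L w) _ = _
  simp

instance [WeylStable Φ L] : SMulCommClass Φ.weylGroup ℂ (GrpAlg L) where
  smul_comm w c f := map_smul (AddMonoidAlgebra.domCongr ℂ ℂ (DistribMulAction.toAddEquiv L w)) c f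

/-- The Weyl group acts on `ℂ(L)` by field automorphisms, extending the action on `ℂ[L]`. -/
instance [WeylStable Φ L] : MulSemiringAction Φ.weylGroup (RatFun L) :=
  IsFractionRing.mulSemiringAction Φ.weylGroup (GrpAlg L) (RatFun L)

lemma weyl_smul_algebraMap [WeylStable Φ L] (w : Φ.weylGroup) (f : GrpAlg L) :
    w • (algebraMap (GrpAlg L) (RatFun L) f) = algebraMap (GrpAlg L) (RatFun L) (w • f) := by
  have := IsFractionRing.ringEquivOfRingEquiv_algebraMap (K := RatFun L) (L := RatFun L)
    (MulSemiringAction.toRingEquiv Φ.weylGroup (GrpAlg L) w) f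
  exact this

instance [WeylStable Φ L] : SMulCommClass Φ.weylGroup ℂ (RatFun L) where
  smul_comm w c f := by
    rw [Algebra.smul_def, Algebra.smul_def, smul_mul']
    congr 1
    rw [IsScalarTower.algebraMap_apply ℂ (GrpAlg L) (RatFun L), weyl_smul_algebraMap,
      Algebra.algebraMap_eq_smul_one c, smul_comm, smul_one]

end GroupAlgebra

/-- A skew group ring `A ⋊ G` over a `k`-algebra `A` on which `G` acts `k`-linearly is a
`k`-algebra. -/
instance skewAlgebra {k A G : Type*} [CommSemiring k] [Semiring A] [Algebra k A] [Monoid G]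
    [MulSemiringAction G A] [SMulCommClass G k A] : Algebra k (SkewMonoidAlgebra A G) :=
  Algebra.ofModule
    (by
      intro c x y
      induction x using SkewMonoidAlgebra.induction_on with
      | zero => simp
      | add f g hf hg => rw [smul_add, add_mul, add_mul, smul_add, hf, hg]
      | single a r =>
        induction y using SkewMonoidAlgebra.induction_on with
        | zero => simp
        | add f g hf hg => rw [mul_add, mul_add, smul_add, hf, hg]
        | single a' r' => simp [SkewMonoidAlgebra.smul_single, SkewMonoidAlgebra.single_mul_single])
    (by
      intro c x y
      induction x using SkewMonoidAlgebra.induction_on with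
      | zero => simp
      | add f g hf hg => rw [add_mul, add_mul, smul_add, hf, hg]
      | single a r =>
        induction y using SkewMonoidAlgebra.induction_on with
        | zero => simp
        | add f g hf hg => rw [smul_add, mul_add, mul_add, smul_add, hf, hg]
        | single a' r' =>
          simp [SkewMonoidAlgebra.smul_single, SkewMonoidAlgebra.single_mul_single,
            smul_comm a c r'])

/-- The alternating product `a * b * a * ⋯` with `n` factors. -/
def altProd {A : Type*} [Monoid A] (a b : A) : ℕ → A
  | 0 => 1
  | n + 1 => a * altProd b a n

variable (Φ) in
/-- A `W`-invariant multiplicity function `k : Φ → ℂ^×`. -/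
structure Multiplicity where
  val : ι → ℂˣ
  weyl : ∀ (w : Φ.weylGroup) (i : ι), val (w • i) = val i

namespace MetaplecticStructure

variable [IsEuclidean Φ] [Φ.IsCrystallographic] (D : MetaplecticStructure Φ)

/-! ### The extended affine Hecke algebra -/

lemma one_sub_ne_zero (i : ι) : (1 - monoP (D.metaRootW i) : GrpAlg D.MetaWeightLat) ≠ 0 := by
  rw [sub_ne_zero]
  intro h
  have h2 : (0 : D.MetaWeightLat) = D.metaRootW i := by
    have h1 := h
    rw [monoP, AddMonoidAlgebra.one_def] at h1
    exact (AddMonoidAlgebra.single_left_inj (one_ne_zero)).1 h1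
  have h3 : D.metaRoot i = 0 := (congrArg Subtype.val h2).symm
  rw [metaRoot, smul_eq_zero] at h3
  rcases h3 with h3 | h3
  · exact (D.m_pos i).ne' (by exact_mod_cast h3)
  · exact Φ.ne_zero i h3

lemma refl_smul_metaWeight (i : ι) (x : D.MetaWeightLat) :
    ∃ z : ℤ, sRefl Φ i • x = x - z • D.metaRootW i := by
  obtain ⟨z, hz⟩ := D.mem_metaWeightLat.1 x.2 i
  refine ⟨z, Subtype.ext ?_⟩
  have h : sRefl Φ i • (x : E) = Φ.reflection i (x : E) := rfl
  rw [coe_weyl_smul, h, RootPairing.reflection_apply]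
  simp only [metaRootW, metaRoot, AddSubgroup.coe_sub, AddSubgroup.coe_zsmul]
  rw [LinearMap.flip_apply, hz, ← Int.cast_smul_eq_zsmul ℝ, smul_smul, mul_comm]

/-- `f - s_α f` is divisible by `1 - x^{α^m}` in `ℂ[P^m]`. -/
lemma one_sub_dvd (i : ι) (f : GrpAlg D.MetaWeightLat) :
    (1 - monoP (D.metaRootW i)) ∣ f - sRefl Φ i • f := by
  have hpow : ∀ n : ℕ, (1 - monoP (D.metaRootW i)) ∣
      (1 - monoP (n • D.metaRootW i) : GrpAlg D.MetaWeightLat) := by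
    intro n
    have : monoP (n • D.metaRootW i) = (monoP (D.metaRootW i)) ^ n := by
      simp [monoP, AddMonoidAlgebra.single_pow]
    rw [this]
    simpa using sub_dvd_pow_sub_pow (1 : GrpAlg D.MetaWeightLat) (monoP (D.metaRootW i)) n
  have hz : ∀ z : ℤ, (1 - monoP (D.metaRootW i)) ∣
      (1 - monoP (z • D.metaRootW i) : GrpAlg D.MetaWeightLat) := by
    intro z
    obtain ⟨n, rfl | rfl⟩ := z.eq_nat_or_neg
    · simpa using hpow n
    · have h1 : (monoP (-(n : ℤ) • D.metaRootW i) * monoP (n • D.metaRootW i) :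
          GrpAlg D.MetaWeightLat) = 1 := by
        rw [← monoP_add]
        simp [monoP, AddMonoidAlgebra.one_def]
      have : (1 - monoP (-(n : ℤ) • D.metaRootW i) : GrpAlg D.MetaWeightLat) =
          - monoP (-(n : ℤ) • D.metaRootW i) * (1 - monoP (n • D.metaRootW i)) := by
        rw [neg_mul, mul_sub, h1]; ring
      rw [this]
      exact Dvd.dvd.mul_left (hpow n) _
  induction f using AddMonoidAlgebra.induction_linear with
  | zero => simp
  | add f g hf hg =>
    rw [smul_add, add_sub_add_comm]
    exact dvd_add hf hg
  | single a c =>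
    obtain ⟨z, h⟩ := D.refl_smul_metaWeight i a
    have h1 : (AddMonoidAlgebra.single a c : GrpAlg D.MetaWeightLat) -
        sRefl Φ i • AddMonoidAlgebra.single a c =
        AddMonoidAlgebra.single a c * (1 - monoP ((-z) • D.metaRootW i)) := by
      rw [weyl_smul_single, h, mul_sub, mul_one, monoP, AddMonoidAlgebra.single_mul_single, mul_one,
        neg_smul, ← sub_eq_add_neg]
    rw [h1]
    exact Dvd.dvd.mul_left (hz _) _

/-- The divided difference operator `∇_α^m f = (f - s_α f) / (1 - x^{α^m})` on `ℂ[P^m]`. -/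
def divDiff (i : ι) (f : GrpAlg D.MetaWeightLat) : GrpAlg D.MetaWeightLat :=
  (D.one_sub_dvd i f).choose

lemma mul_divDiff (i : ι) (f : GrpAlg D.MetaWeightLat) :
    (1 - monoP (D.metaRootW i)) * D.divDiff i f = f - sRefl Φ i • f :=
  ((D.one_sub_dvd i f).choose_spec).symm

variable (b : Φ.Base)

/-- The free algebra on symbols `T_i` (one for each simple root) and `x^ν` (`ν ∈ P^m`). -/
abbrev PreHecke : Type _ := FreeAlgebra ℂ (b.support ⊕ D.MetaWeightLat)

variable {b} in
/-- The generator `T_i`. -/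
def preT (i : b.support) : D.PreHecke b := FreeAlgebra.ι ℂ (Sum.inl i)

/-- The generator `x^ν`. -/
def preX (ν : D.MetaWeightLat) : D.PreHecke b := FreeAlgebra.ι ℂ (Sum.inr ν)

/-- The linear extension of `x^ν ↦ x^ν` to `ℂ[P^m]`. -/
def prePoly (f : GrpAlg D.MetaWeightLat) : D.PreHecke b :=
  f.coeff.sum fun ν c => c • D.preX b ν

end MetaplecticStructure

namespace MetaplecticStructure

variable [IsEuclidean Φ] [Φ.IsCrystallographic] (D : MetaplecticStructure Φ) (b : Φ.Base)
  (k : Multiplicity Φ)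

/-- The defining relations of the extended affine Hecke algebra: the quadratic and braid relations
of the finite Hecke algebra, the relations of the group algebra `ℂ[P^m]`, and the
Bernstein-Zelevinsky cross relations. -/
inductive HeckeRel : D.PreHecke b → D.PreHecke b → Prop
  | quadratic (i : b.support) : HeckeRel
      ((D.preT i - algebraMap ℂ _ (k.val i : ℂ)) * (D.preT i + algebraMap ℂ _ (k.val i : ℂ)⁻¹)) 0
  | braid (i j : b.support) (h : i ≠ j) : HeckeRel
      (altProd (D.preT i) (D.preT j) (orderOf (sRefl Φ i * sRefl Φ j)))
      (altProd (D.preT j) (D.preT i) (orderOf (sRefl Φ i * sRefl Φ j)))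
  | x_zero : HeckeRel (D.preX b 0) 1
  | x_add (μ ν : D.MetaWeightLat) : HeckeRel (D.preX b (μ + ν)) (D.preX b μ * D.preX b ν)
  | cross (i : b.support) (ν : D.MetaWeightLat) : HeckeRel
      (D.preT i * D.preX b ν - D.preX b (sRefl Φ (i : ι) • ν) * D.preT i)
      (((k.val i : ℂ) - (k.val i : ℂ)⁻¹) • D.prePoly b (D.divDiff i (monoP ν)))

/-- The extended affine Hecke algebra `H̃^m(k)`. -/
def AffHecke : Type _ := RingQuot (D.HeckeRel b k)

instance : Ring (D.AffHecke b k) := inferInstanceAs (Ring (RingQuot (D.HeckeRel b k)))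

instance : Algebra ℂ (D.AffHecke b k) := inferInstanceAs (Algebra ℂ (RingQuot (D.HeckeRel b k)))

/-- The quotient map from the free algebra. -/
def heckeMk : D.PreHecke b →ₐ[ℂ] D.AffHecke b k := RingQuot.mkAlgHom ℂ (D.HeckeRel b k)

variable {b k} in
lemma heckeMk_rel {x y : D.PreHecke b} (h : D.HeckeRel b k x y) :
    D.heckeMk b k x = D.heckeMk b k y :=
  RingQuot.mkAlgHom_rel ℂ h

variable {b} in
/-- The generator `T_i` of `H̃^m(k)`. -/
def heckeT (i : b.support) : D.AffHecke b k := D.heckeMk b k (D.preT i)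

/-- The canonical algebra map `ℂ[P^m] → H̃^m(k)`. -/
def heckeX : GrpAlg D.MetaWeightLat →ₐ[ℂ] D.AffHecke b k :=
  AddMonoidAlgebra.lift ℂ (D.AffHecke b k) D.MetaWeightLat
    { toFun := fun ν => D.heckeMk b k (D.preX b ν.toAdd)
      map_one' := by
        rw [← map_one (D.heckeMk b k)]
        exact D.heckeMk_rel (HeckeRel.x_zero)
      map_mul' := fun μ ν => by
        rw [← map_mul]
        exact D.heckeMk_rel (HeckeRel.x_add μ.toAdd ν.toAdd) }

lemma heckeX_single (ν : D.MetaWeightLat) (c : ℂ) : D.heckeX b k (AddMonoidAlgebra.single ν c) =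
    c • D.heckeMk b k (D.preX b ν) := by
  simp [heckeX, AddMonoidAlgebra.lift_single]

lemma mk_prePoly (f : GrpAlg D.MetaWeightLat) :
    D.heckeMk b k (D.prePoly b f) = D.heckeX b k f := by
  rw [prePoly, Finsupp.sum, map_sum]
  conv_rhs => rw [← AddMonoidAlgebra.sum_coeff_single f]
  rw [Finsupp.sum, map_sum]
  refine Finset.sum_congr rfl fun ν _ => ?_
  rw [map_smul, heckeX_single]

lemma divDiff_add (i : ι) (f g : GrpAlg D.MetaWeightLat) :
    D.divDiff i (f + g) = D.divDiff i f + D.divDiff i g := by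
  apply mul_left_cancel₀ (D.one_sub_ne_zero i)
  rw [mul_add, mul_divDiff, mul_divDiff, mul_divDiff, smul_add]; ring

lemma divDiff_smul (i : ι) (c : ℂ) (f : GrpAlg D.MetaWeightLat) :
    D.divDiff i (c • f) = c • D.divDiff i f := by
  apply mul_left_cancel₀ (D.one_sub_ne_zero i)
  rw [mul_smul_comm, mul_divDiff, mul_divDiff, smul_comm, smul_sub]

/-- The cross relation for an arbitrary `f ∈ ℂ[P^m]`. -/
lemma hecke_cross (i : b.support) (f : GrpAlg D.MetaWeightLat) :
    D.heckeT k i * D.heckeX b k f - D.heckeX b k (sRefl Φ (i : ι) • f) * D.heckeT k i =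
      ((k.val i : ℂ) - (k.val i : ℂ)⁻¹) • D.heckeX b k (D.divDiff i f) := by
  induction f using AddMonoidAlgebra.induction_linear with
  | zero =>
    have : D.divDiff (i : ι) 0 = 0 := by simpa using D.divDiff_smul i 0 0
    rw [this]; simp
  | add f g hf hg =>
    rw [divDiff_add, map_add, map_add, smul_add, smul_add, map_add, ← hf, ← hg]
    noncomm_ring
  | single a c =>
    have h1 : (AddMonoidAlgebra.single a c : GrpAlg D.MetaWeightLat) = c • monoP a := by
      simp [monoP]
    have h := D.heckeMk_rel (HeckeRel.cross (k := k) i a)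
    rw [map_sub, map_mul, map_mul, map_smul, mk_prePoly] at h
    have h2 : ∀ ν, D.heckeMk b k (D.preX b ν) = D.heckeX b k (monoP ν) := by
      intro ν; rw [monoP, heckeX_single, one_smul]
    have h3 : sRefl Φ (i : ι) • (monoP a : GrpAlg D.MetaWeightLat) = monoP (sRefl Φ (i : ι) • a) :=
      weyl_smul_single _ _ _
    rw [h2, h2] at h
    rw [h1, divDiff_smul, smul_comm, h3, map_smul, map_smul, map_smul, mul_smul_comm,
      smul_mul_assoc, ← smul_sub, smul_comm _ c]
    exact congrArg _ h

variable {b} in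
lemma hecke_quadratic (i : b.support) : D.heckeT k i *
    (D.heckeT k i - algebraMap ℂ _ ((k.val i : ℂ) - (k.val i : ℂ)⁻¹)) = 1 := by
  have h := D.heckeMk_rel (HeckeRel.quadratic (k := k) i)
  rw [map_zero, map_mul, map_sub, map_add, AlgHom.commutes, AlgHom.commutes] at h
  have h1 : (algebraMap ℂ (D.AffHecke b k) (k.val i : ℂ)) *
      (algebraMap ℂ (D.AffHecke b k) (k.val i : ℂ)⁻¹) = 1 := by
    rw [← map_mul, mul_inv_cancel₀ (Units.ne_zero _), map_one]
  have h2 := Algebra.commutes (k.val i : ℂ) (D.heckeT k i)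
  change (D.heckeT k i - _) * (D.heckeT k i + _) = 0 at h
  rw [sub_mul, mul_add, mul_add, h1] at h
  rw [map_sub, mul_sub, mul_sub, ← h2, ← sub_eq_zero, ← h]
  abel

variable {b} in
lemma hecke_quadratic' (i : b.support) :
    (D.heckeT k i - algebraMap ℂ _ ((k.val i : ℂ) - (k.val i : ℂ)⁻¹)) * D.heckeT k i = 1 := by
  rw [← D.hecke_quadratic k i, sub_mul, mul_sub, Algebra.commutes]

lemma hecke_induction {p : D.AffHecke b k → Prop}
    (hT : ∀ i, p (D.heckeT k i)) (hX : ∀ f, p (D.heckeX b k f))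
    (hadd : ∀ x y, p x → p y → p (x + y)) (hmul : ∀ x y, p x → p y → p (x * y)) (x) : p x := by
  obtain ⟨y, rfl⟩ := (RingQuot.mkAlgHom_surjective ℂ (D.HeckeRel b k) x : ∃ y, D.heckeMk b k y = x)
  induction y using FreeAlgebra.induction with
  | grade0 c =>
    have := hX (algebraMap ℂ _ c)
    rwa [AlgHom.commutes] at this ⊢
  | grade1 v =>
    cases v with
    | inl i => exact hT i
    | inr ν =>
      have := hX (monoP ν)
      rwa [monoP, heckeX_single, one_smul] at this
  | mul x y hx hy => rw [map_mul]; exact hmul _ _ hx hy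
  | add x y hx hy => rw [map_add]; exact hadd _ _ hx hy

/-- `W`-invariant elements of `ℂ[P^m]` are central in `H̃^m(k)`. -/
lemma heckeX_central {F : GrpAlg D.MetaWeightLat} (hF : ∀ w : Φ.weylGroup, w • F = F)
    (h : D.AffHecke b k) : D.heckeX b k F * h = h * D.heckeX b k F := by
  induction h using D.hecke_induction b k with
  | hT i =>
    have h0 : D.divDiff (i : ι) F = 0 := by
      apply mul_left_cancel₀ (D.one_sub_ne_zero i)
      rw [mul_divDiff, hF, sub_self, mul_zero]
    have := D.hecke_cross b k i F
    rw [h0, hF, map_zero, smul_zero, sub_eq_zero] at this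
    exact this.symm
  | hX f => rw [← map_mul, ← map_mul, mul_comm]
  | hadd x y hx hy => rw [mul_add, add_mul, hx, hy]
  | hmul x y hx hy => rw [← mul_assoc, hx, mul_assoc, hy, mul_assoc]

/-- The multiplicative subset `ℂ[P^m] ∖ {0}` of `H̃^m(k)`. -/
def heckeDenoms : Submonoid (D.AffHecke b k) :=
  (nonZeroDivisors (GrpAlg D.MetaWeightLat)).map (D.heckeX b k)

variable [Finite ι] [Φ.IsRootSystem]

lemma exists_central_multiple {f : GrpAlg D.MetaWeightLat} (hf : f ≠ 0) :
    ∃ g : GrpAlg D.MetaWeightLat, g * f ≠ 0 ∧ ∀ w : Φ.weylGroup, w • (g * f) = g * f := by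
  classical
  let := Fintype.ofFinite Φ.weylGroup
  refine ⟨∏ w ∈ (Finset.univ : Finset Φ.weylGroup).erase 1, w • f, ?_, ?_⟩
  all_goals
    have h : (∏ w ∈ (Finset.univ : Finset Φ.weylGroup).erase 1, w • f) * f =
        ∏ w : Φ.weylGroup, w • f := by
      rw [mul_comm, ← Finset.mul_prod_erase _ _ (Finset.mem_univ (1 : Φ.weylGroup)), one_smul]
    rw [h]
  · rw [Finset.prod_ne_zero_iff]
    intro w _ h0
    apply hf
    rw [← inv_smul_smul w f, h0, smul_zero]
  · intro w
    rw [Finset.smul_prod']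
    exact Fintype.prod_equiv (Equiv.mulLeft w) _ _ (fun v => by simp [mul_smul])

/-- `ℂ[P^m] ∖ {0}` satisfies the Ore condition in `H̃^m(k)`. -/
instance : OreLocalization.OreSet (D.heckeDenoms b k) :=
  Classical.choice (OreLocalization.nonempty_oreSet_iff.2 (by
    constructor
    · rintro r₁ r₂ ⟨_, f, hf, rfl⟩ h
      obtain ⟨g, h0, hg⟩ := D.exists_central_multiple (nonZeroDivisors.ne_zero hf)
      refine ⟨⟨_, g * f, mem_nonZeroDivisors_of_ne_zero h0, rfl⟩, ?_⟩
      change D.heckeX b k (g * f) * r₁ = D.heckeX b k (g * f) * r₂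
      rw [D.heckeX_central b k hg, D.heckeX_central b k hg, mul_comm g f, map_mul, ← mul_assoc,
        ← mul_assoc]
      exact congrArg (· * _) h
    · rintro r ⟨_, f, hf, rfl⟩
      obtain ⟨g, h0, hg⟩ := D.exists_central_multiple (nonZeroDivisors.ne_zero hf)
      refine ⟨r * D.heckeX b k g, ⟨_, g * f, mem_nonZeroDivisors_of_ne_zero h0, rfl⟩, ?_⟩
      change D.heckeX b k (g * f) * r = r * D.heckeX b k g * D.heckeX b k f
      rw [D.heckeX_central b k hg, map_mul, mul_assoc]))

/-- The localization `H̃^m_loc(k)` of `H̃^m(k)` at `ℂ[P^m] ∖ {0}`. -/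
abbrev LocHecke : Type _ := OreLocalization (D.heckeDenoms b k) (D.AffHecke b k)

variable {b} in
/-- The generator `T_i` of `H̃^m_loc(k)`, as a unit with inverse `T_i - k_i + k_i⁻¹`. -/
def locT (i : b.support) : (D.LocHecke b k)ˣ where
  val := OreLocalization.numeratorRingHom (D.heckeT k i)
  inv := OreLocalization.numeratorRingHom
    (D.heckeT k i - algebraMap ℂ _ ((k.val i : ℂ) - (k.val i : ℂ)⁻¹))
  val_inv := by
    rw [← map_mul, D.hecke_quadratic k i, map_one]
  inv_val := by
    rw [← map_mul, D.hecke_quadratic' k i, map_one]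

end MetaplecticStructure

/-- The two values of the function `size`. -/
inductive RootSize
  | sh
  | lg

namespace MetaplecticStructure

variable [IsEuclidean Φ] [Φ.IsCrystallographic] (D : MetaplecticStructure Φ)

open Classical in
/-- `size(α^m)`: whether the root `α^m` of `Φ^m` is long (of maximal length) or short. If all roots
of `Φ^m` have the same length, they are long. -/
def size (i : ι) : RootSize := if ∀ j, ‖D.metaRoot j‖ ≤ ‖D.metaRoot i‖ then .lg else .sh

/-- The representation parameters `g_j(y)`, where the value `k_y` of `k` on the roots of size `y`
enters as `k_α` for `α` with `size(α^m) = y`. -/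
structure RepParameter (k : Multiplicity Φ) where
  g : ℤ → RootSize → ℂˣ
  eq_neg_one : ∀ j y, (D.n : ℤ) ∣ j → g j y = -1
  periodic : ∀ j y, g j y = g (j % D.n) y
  mul_eq : ∀ j i, ¬ (D.n : ℤ) ∣ j →
    g j (D.size i) * g (D.n - j) (D.size i) = (k.val i ^ 2)⁻¹

/-! ### Localization -/

/-- The semidirect product algebra `W ⋉ ℂ(P^m)`, whose element `f w` is `single w f`. -/
abbrev Semidirect : Type _ := SkewMonoidAlgebra (RatFun D.MetaWeightLat) Φ.weylGroup

/-- `f ∈ ℂ(P^m)` as an element of `W ⋉ ℂ(P^m)`. -/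
def semiF (f : RatFun D.MetaWeightLat) : D.Semidirect := SkewMonoidAlgebra.single 1 f

/-- `w ∈ W` as an element of `W ⋉ ℂ(P^m)`. -/
def semiW (w : Φ.weylGroup) : D.Semidirect := SkewMonoidAlgebra.single w 1

/-- The `c`-function `c_α = (1 - k_α² x^{α^m}) / (1 - x^{α^m})`. -/
def cFun (k : Multiplicity Φ) (i : ι) : RatFun D.MetaWeightLat :=
  (1 - algebraMap ℂ _ ((k.val i : ℂ) ^ 2) * mono (D.metaRootW i)) / (1 - mono (D.metaRootW i))

/-- The inclusion `ℂ(P^m) ⊆ ℂ(P)`. -/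
def incl : RatFun D.MetaWeightLat →ₐ[ℂ] RatFun (WeightLat Φ) :=
  IsFractionRing.liftAlgHom (A := GrpAlg D.MetaWeightLat)
    (g := (IsScalarTower.toAlgHom ℂ (GrpAlg (WeightLat Φ)) (RatFun (WeightLat Φ))).comp
      (AddMonoidAlgebra.mapDomainAlgHom ℂ ℂ D.toWeight))
    ((IsFractionRing.injective (GrpAlg (WeightLat Φ)) (RatFun (WeightLat Φ))).comp
      (AddMonoidAlgebra.mapDomain_injective (AddSubgroup.inclusion_injective _)))

section Loc

variable (b : Φ.Base) (k : Multiplicity Φ) [Finite ι] [Φ.IsRootSystem]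

/-- Denominators become units in `H̃^m_loc(k)`. -/
def locUnits : D.heckeDenoms b k →* (D.LocHecke b k)ˣ where
  toFun := OreLocalization.numeratorUnit
  map_one' := Units.ext (map_one (OreLocalization.numeratorHom (S := D.heckeDenoms b k)))
  map_mul' x y := Units.ext (map_mul (OreLocalization.numeratorHom (S := D.heckeDenoms b k))
    (x : D.AffHecke b k) (y : D.AffHecke b k))

/-- The canonical algebra map `ℂ(P^m) → H̃^m_loc(k)`, extending `ℂ[P^m] → H̃^m(k)`. -/
def ratToLoc : RatFun D.MetaWeightLat →ₐ[ℂ] D.LocHecke b k where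
  toRingHom := OreLocalization.universalHom
    (OreLocalization.numeratorRingHom.comp (D.heckeX b k).toRingHom)
    ((locUnits D b k).comp ((D.heckeX b k : GrpAlg D.MetaWeightLat →* D.AffHecke b k).submonoidMap _))
    (fun _ => rfl)
  commutes' := by
    intro c
    have h := OreLocalization.universalHom_commutes
      (OreLocalization.numeratorRingHom.comp (D.heckeX b k).toRingHom)
      ((locUnits D b k).comp
        ((D.heckeX b k : GrpAlg D.MetaWeightLat →* D.AffHecke b k).submonoidMap _))
      (fun _ => rfl) (r := algebraMap ℂ (GrpAlg D.MetaWeightLat) c)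
    refine h.trans ?_
    change OreLocalization.numeratorRingHom (D.heckeX b k (algebraMap ℂ _ c)) = _
    rw [AlgHom.commutes]
    rfl

/-- `φ : W ⋉ ℂ(P^m) ≃ H̃^m_loc(k)` is the localization isomorphism: `φ(f) = f` and
`φ(s_i) = (k_i / c_i) T_i + 1 - k_i² / c_i`. -/
structure IsLocalizationIso (φ : D.Semidirect ≃ₐ[ℂ] D.LocHecke b k) : Prop where
  map_fun : ∀ f, φ (D.semiF f) = D.ratToLoc b k f
  map_refl : ∀ i : b.support, φ (D.semiW (sRefl Φ i)) =
    D.ratToLoc b k (algebraMap ℂ _ (k.val i : ℂ) / D.cFun k i) * D.locT k i + 1 -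
      D.ratToLoc b k (algebraMap ℂ _ ((k.val i : ℂ) ^ 2) / D.cFun k i)

end Loc

/-! ### The metaplectic Weyl group representation -/

/-- `(q(μ), α^{m∨}) = ((μ, α^∨) - r_{m(α)}((μ, α^∨))) / m(α)` for a simple root `α`. Here
`q(μ) = μ - r(μ)`, where `r(μ) = ∑_i r_{m(α_i)}((μ, α_i^∨)) ϖ_i` with fundamental weights `ϖ_i`,
and `r_s(t)` is the remainder of `t` modulo `s`. -/
def qPair (x : WeightLat Φ) (i : ι) : ℤ := (wpair Φ x i - wpair Φ x i % D.m i) / D.m i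

/-- The root `α^m` as an element of `P`. -/
def metaRootP (i : ι) : WeightLat Φ := D.toWeight (D.metaRootW i)

/-- The field `ℂ(P)`. -/
abbrev CP (_ : MetaplecticStructure Φ) : Type _ := RatFun (WeightLat Φ)

variable {k : Multiplicity Φ} (g : D.RepParameter k)

/-- The right hand side of the formula for `σ(s_α)(f x^λ)`:
`(1 - k²) x^{(q(-λ), α^{m∨}) α^m} / (1 - k² x^{α^m}) (s_α f) x^λ
  + k² g_{Q(α) - B(λ, α)}(size α^m) (1 - x^{-α^m}) / (1 - k² x^{α^m}) (s_α f) x^{α + s_α λ}`. -/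
def sigmaFormula (i : ι) (f : RatFun D.MetaWeightLat) (x : WeightLat Φ) : D.CP :=
  (1 - algebraMap ℂ D.CP ((k.val i : ℂ) ^ 2)) * mono (D.qPair (-x) i • D.metaRootP i) /
      (1 - algebraMap ℂ D.CP ((k.val i : ℂ) ^ 2) * mono (D.metaRootP i)) *
      D.incl (sRefl Φ i • f) * mono x +
    algebraMap ℂ D.CP ((k.val i : ℂ) ^ 2 * (g.g (D.Qroot i - D.Broot x i) (D.size i) : ℂ)) *
      ((1 - mono (-D.metaRootP i)) /
        (1 - algebraMap ℂ D.CP ((k.val i : ℂ) ^ 2) * mono (D.metaRootP i))) *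
      D.incl (sRefl Φ i • f) * mono (rootW Φ i + sRefl Φ i • x)

/-- `σ` is the metaplectic Weyl group representation of `W ⋉ ℂ(P^m)` on `ℂ(P)`. -/
structure IsMetaplecticRep (b : Φ.Base)
    (σ : D.Semidirect →ₐ[ℂ] Module.End ℂ D.CP) : Prop where
  refl_apply : ∀ (i : b.support) (f : RatFun D.MetaWeightLat) (x : WeightLat Φ),
    σ (D.semiW (sRefl Φ i)) (D.incl f * mono x) = D.sigmaFormula g i f x
  fun_apply : ∀ (h f : RatFun D.MetaWeightLat) (x : WeightLat Φ),
    σ (D.semiF h) (D.incl f * mono x) = D.incl h * D.incl f * mono x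

/-- The right hand side of the Chinta-Gunnells formula for the action of `s_α` on `f x^λ`, with
parameters `v` and `γ_j`:
`(s_α f) x^{s_α λ} / (1 - v x^{m(α) α}) · [ x^{-r_{m(α)}(-B(λ, α) / Q(α)) α} (1 - v)
  - v γ_{Q(α) - B(λ, α)} x^{(1 - m(α)) α} (1 - x^{m(α) α}) ]`. -/
def chintaGunnells (v : ℂ) (γ : ℤ → ℂ) (i : ι) (f : RatFun D.MetaWeightLat) (x : WeightLat Φ) :
    D.CP :=
  D.incl (sRefl Φ i • f) * mono (sRefl Φ i • x) /
      (1 - algebraMap ℂ D.CP v * mono ((D.m i : ℤ) • rootW Φ i)) *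
    (mono (-((-(D.Broot x i / D.Qroot i)) % (D.m i : ℤ)) • rootW Φ i) *
        (1 - algebraMap ℂ D.CP v) -
      algebraMap ℂ D.CP (v * γ (D.Qroot i - D.Broot x i)) *
        mono ((1 - (D.m i : ℤ)) • rootW Φ i) * (1 - mono ((D.m i : ℤ) • rootW Φ i)))

/-! ### Metaplectic Demazure-Lusztig operators -/

variable {b : Φ.Base} [Finite ι] [Φ.IsRootSystem] [Φ.IsReduced]

/-- The metaplectic Demazure-Lusztig operator `𝒯_i = -k_i τ(x^{ρ^m} T_i⁻¹ x^{-ρ^m})` attached to a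
representation `τ` of `H̃^m_loc(k)` on `ℂ(P)`. -/
def demazureLusztig (τ : D.LocHecke b k →ₐ[ℂ] Module.End ℂ D.CP) (i : b.support) :
    Module.End ℂ D.CP :=
  -((k.val i : ℂ) • τ (D.ratToLoc b k (mono (D.rho b)) * ↑(D.locT k i)⁻¹ *
    D.ratToLoc b k (mono (-D.rho b))))

end MetaplecticStructure

/-- The set of monomials `x^λ`, `λ ∈ Λ`, in `ℂ(P)`, for a lattice `Λ ⊆ P`. -/
def monomials (Φ : RootPairing ι ℝ E E) (Λ : AddSubgroup E) : Set (RatFun (WeightLat Φ)) :=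
  mono '' {x : WeightLat Φ | (x : E) ∈ Λ}

/-- The subspace `ℂ[Λ]` of `ℂ(P)`. -/
def polySub (Φ : RootPairing ι ℝ E E) (Λ : AddSubgroup E) : Submodule ℂ (RatFun (WeightLat Φ)) :=
  Submodule.span ℂ (monomials Φ Λ)

/-- The subfield `ℂ(Λ)` of `ℂ(P)`. -/
def ratSub (Φ : RootPairing ι ℝ E E) (Λ : AddSubgroup E) :
    IntermediateField ℂ (RatFun (WeightLat Φ)) :=
  IntermediateField.adjoin ℂ (monomials Φ Λ)

end Metaplectic

end

open Metaplectic

open scoped InnerProductSpace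

set_option linter.unusedSectionVars false

noncomputable section

namespace Metaplectic

/-! Write q_i = k_i². The common tool is the Demazure–Lusztig element. Suppose an algebra `A`
receives ℂ(P^m) and contains involutions S_i implementing the reflections s_i. Put M_i + 1 = (1 +
S_i) c_{-α_i}, that is, M_i = q_i - c_i + c_i S_i (`dlElt`); M_i stands for k_i T_i. Its quadratic
and cross relations are formal. For the braid relation there is a rank two computation
(`braidDefect_dlElt`): the difference of the two braid words in M_i, M_j is the difference of the
two braid words in S_i, S_j times the product of c_{-β} over the positive roots β of the rank two
subsystem. This product is a nonzero element of a field, so the M_i satisfy a braid relation if and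
only if the S_i do. No braid relation for the S_i is assumed in the computation.

The equivalence is used three times. In W ⋉ ℂ(P^m) the s_i satisfy the braid relations, so the M_i
do, and the Hecke algebra maps to the semidirect product (`exists_hecke_to_semidirect`). In the
localized Hecke algebra the T_i satisfy the braid relations; solving for S_i gives involutions
(`locS_implements`), which then satisfy the braid relations too. As W is the Coxeter group on the
simple reflections (`exists_weyl_lift`, by Matsumoto's theorem), this gives the map φ in the other
direction, and the two maps are inverse to each other.

The third use is on ℂ(P). The operator `metaS` is given by the formula for σ(s_i); that it is an
involution is a cocycle identity resting on q g_j g_{-j} = 1 (`metaS_sq_mono`). For the braid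
relations, take weights μ with |(μ, α^∨)| ≤ m(α) for all roots and the vectors e(μ) = x^{μ + ρ -
ρ^m}. If (μ, α_i^∨) ≥ 0, then M_i maps e(μ) to a nonzero multiple of e(s_i μ) (`metaT_shiftMono`).
For μ dominant with respect to i and j, the two braid words in the M's collect the same scalars in
opposite orders, so their difference L kills e(μ). The relation L M_i = U L (`braid_sub_mul`)
spreads this to all such μ. The two words in the S's are semilinear over the same Weyl group
element, so their difference kills every e(μ) as well, and the e(μ) span ℂ(P) over ℂ(P^m), because
every coset of P^m in P contains such a μ (`exists_inDomain`).

The remaining claims come from the single formula 𝒯_i = -x^{α_i^m} M_i (`demazureLusztig_apply`), a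
consequence of -k_i T_i⁻¹ = q_i - 1 - M_i and s_i ρ^m = ρ^m - α_i^m. On a monomial M_i is a divided
difference plus a monomial (`metaT_mono`), hence ℂ[Λ] is preserved. For ℂ(Λ) one uses that it is
spanned by products f x^λ with λ ∈ Λ and f a rational function in the monomials of Λ ∩ P^m
(`ratSub_induction`). The braid relations are those of the T_i⁻¹, rescaled and conjugated. -/

section

/-! ### Rank two Demazure-Lusztig identities -/

section RankTwo

variable {K F A : Type*} [Field K] [Field F] [Algebra K F] [Ring A] [Algebra K A]

/-- An involution `S` of the algebra `A` which implements the automorphism `s` of `F`. -/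
structure Implements (j : F →ₐ[K] A) (s : F →ₐ[K] F) (S : A) : Prop where
  comm : ∀ f, S * j f = j (s f) * S
  sq : S * S = 1

/-- The symmetriser `b = (1 + S) n`. -/
def symOp (j : F →ₐ[K] A) (S : A) (n : F) : A := (1 + S) * j n

variable {j : F →ₐ[K] A} {s s₁ s₂ : F →ₐ[K] F} {S S₁ S₂ : A}

lemma Implements.comm_assoc (h : Implements j s S) (f : F) (x : A) :
    S * (j f * x) = j (s f) * (S * x) := by
  rw [← mul_assoc, h.comm, mul_assoc]

lemma Implements.sq_assoc (h : Implements j s S) (x : A) : S * (S * x) = x := by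
  rw [← mul_assoc, h.sq, one_mul]

lemma Implements.one_add_mul (h : Implements j s S) (x : A) : (1 + S) * (S * x) = (1 + S) * x := by
  rw [add_mul, add_mul, one_mul, one_mul, h.sq_assoc, add_comm]

/-- Combines f S = S s(f) with (1 + S) S = 1 + S. This is the normalising rule of the section:
behind a factor `1 + S`, a letter `S` is absorbed at the price of twisting the coefficient on its
left. -/
lemma Implements.one_add_mul_comm (h : Implements j s S) (f : F) (x : A) :
    (1 + S) * (j f * (S * x)) = (1 + S) * (j (s f) * x) := by
  have : j f * (S * x) = S * (j (s f) * x) := by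
    rw [← h.sq_assoc (j f * (S * x)), h.comm_assoc, h.sq_assoc]
  rw [this, h.one_add_mul]

lemma Implements.mul_one_add (h : Implements j s S) : S * (1 + S) = 1 + S := by
  rw [mul_add, h.sq, mul_one, add_comm]

/-- Behind the left factor 1 + S the middle n(1 + S) collapses to n + s n, which is the scalar 1 +
q. For T = b - 1 this reads (T - q)(T + 1) = 0. -/
lemma Implements.symOp_sq (h : Implements j s S) {n : F} {q : K}
    (hn : s n = algebraMap K F (1 + q) - n) :
    symOp j S n * symOp j S n = (1 + q) • symOp j S n := by
  have h1 : symOp j S n * symOp j S n = (1 + S) * (j n * (1 * j n)) +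
      (1 + S) * (j n * (S * j n)) := by
    rw [symOp]; noncomm_ring
  rw [h1, h.one_add_mul_comm, ← mul_add, one_mul, ← add_mul, hn, map_sub, add_sub_cancel, symOp,
    AlgHom.commutes, Algebra.smul_def, ← mul_assoc, ← mul_assoc, Algebra.commutes (1 + q) (1 + S)]

/-- The coefficients of a product of two symmetrisers. -/
lemma symOp_mul_symOp_mul (h₁ : Implements j s₁ S₁) (h₂ : Implements j s₂ S₂) (n₁ n₂ z : F)
    (x : A) : symOp j S₁ n₁ * (symOp j S₂ n₂ * ((1 + S₁) * (j z * x))) =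
      (1 + S₁) * (j ((n₁ * n₂ + s₁ n₁ * s₁ n₂) * z) * x) +
      (1 + S₁) * (j (n₁ * s₂ n₂ * s₂ z) * (S₂ * x)) +
      (1 + S₁) * (j (n₁ * s₂ n₂ * s₂ (s₁ z)) * (S₂ * (S₁ * x))) := by
  have e1 : symOp j S₁ n₁ * (symOp j S₂ n₂ * ((1 + S₁) * (j z * x))) =
      (1 + S₁) * (j n₁ * (j n₂ * (j z * x))) + (1 + S₁) * (j n₁ * (j n₂ * (S₁ * (j z * x)))) +
      (1 + S₁) * (j n₁ * (S₂ * (j n₂ * (j z * x)))) +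
      (1 + S₁) * (j n₁ * (S₂ * (j n₂ * (S₁ * (j z * x))))) := by
    simp only [symOp]; noncomm_ring
  have e2 : (1 + S₁) * (j n₁ * (j n₂ * (S₁ * (j z * x)))) =
      (1 + S₁) * (j (s₁ n₁ * s₁ n₂) * (j z * x)) := by
    rw [← mul_assoc (j n₁), ← map_mul, h₁.one_add_mul_comm, map_mul]
  rw [e1, e2]
  simp only [h₁.comm_assoc, h₂.comm_assoc, map_mul, map_add, add_mul, mul_add, mul_assoc]

/-- `S₁` is absorbed by the factor `1 + S₁` on the left and `S₂` by `1 + S₂` on the right. Only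
coefficients at 1 and S₂S₁ survive, which represent the double cosets ⟨s₁⟩\W/⟨s₂⟩ of the dihedral
group of order 8. -/
lemma symOp_pow_two (h₁ : Implements j s₁ S₁) (h₂ : Implements j s₂ S₂) (n₁ n₂ : F) :
    symOp j S₁ n₁ * (symOp j S₂ n₂ * (symOp j S₁ n₁ * symOp j S₂ n₂)) =
      (1 + S₁) * ((j ((n₁ * n₂ + s₁ n₁ * s₁ n₂) * n₁ + n₁ * s₂ n₂ * s₂ n₁) +
        j (n₁ * s₂ n₂ * s₂ (s₁ n₁)) * (S₂ * S₁)) * ((1 + S₂) * j n₂)) := by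
  have e1 : symOp j S₁ n₁ * symOp j S₂ n₂ = (1 + S₁) * (j n₁ * ((1 + S₂) * j n₂)) := by
    simp only [symOp, mul_assoc]
  rw [e1, symOp_mul_symOp_mul h₁ h₂, ← mul_assoc S₂, h₂.mul_one_add]
  simp only [map_add, add_mul, mul_add, mul_assoc]
  abel

/-- One more pair of symmetrisers applied to the normal form of `symOp_pow_two`. The new word
(S₂S₁)² is the third double coset representative for order 12. Where S₂ meets S₂S₁, a leading S₁
remains and is absorbed, which produces the term twisted by s₁. -/
lemma symOp_pow_three (h₁ : Implements j s₁ S₁) (h₂ : Implements j s₂ S₂) (n₁ n₂ z₀ z₁ : F) :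
    symOp j S₁ n₁ * (symOp j S₂ n₂ * ((1 + S₁) * ((j z₀ + j z₁ * (S₂ * S₁)) *
      ((1 + S₂) * j n₂)))) =
      (1 + S₁) * ((j ((n₁ * n₂ + s₁ n₁ * s₁ n₂) * z₀ + n₁ * s₂ n₂ * s₂ z₀ +
        s₁ (n₁ * s₂ n₂ * s₂ z₁)) +
        j (n₁ * s₂ n₂ * s₂ (s₁ z₀) + (n₁ * n₂ + s₁ n₁ * s₁ n₂) * z₁) * (S₂ * S₁) +
        j (n₁ * s₂ n₂ * s₂ (s₁ z₁)) * (S₂ * (S₁ * (S₂ * S₁)))) * ((1 + S₂) * j n₂)) := by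
  have e1 : (1 + S₁) * ((j z₀ + j z₁ * (S₂ * S₁)) * ((1 + S₂) * j n₂)) =
      (1 + S₁) * (j z₀ * ((1 + S₂) * j n₂)) +
      (1 + S₁) * (j z₁ * (S₂ * (S₁ * ((1 + S₂) * j n₂)))) := by
    simp only [mul_add, add_mul, mul_assoc]
    abel
  have e2 : S₂ * ((1 + S₂) * j n₂) = (1 + S₂) * j n₂ := by rw [← mul_assoc, h₂.mul_one_add]
  rw [e1, mul_add, mul_add, symOp_mul_symOp_mul h₁ h₂, symOp_mul_symOp_mul h₁ h₂, e2,
    h₂.sq_assoc, h₁.one_add_mul_comm]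
  simp only [map_add, add_mul, mul_add, mul_assoc]
  abel

/-- `(1 + S₁)(1 + S₂S₁ + ⋯)(1 + S₂)` with coefficients. -/
lemma sandwich_two (h₁ : Implements j s₁ S₁) (h₂ : Implements j s₂ S₂) (n₂ N : F)
    (hN : s₂ N = N) :
    (1 + S₁) * ((j N + j (s₂ (s₁ N)) * (S₂ * S₁)) * ((1 + S₂) * j n₂)) =
      (1 + S₁) * ((1 + S₂ * S₁) * ((1 + S₂) * j (N * n₂))) := by
  have e : (1 + S₂) * j (N * n₂) = j N * ((1 + S₂) * j n₂) := by
    rw [map_mul, ← mul_assoc, ← mul_assoc, add_mul, h₂.comm, hN]; noncomm_ring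
  rw [e]
  congr 1
  simp only [add_mul, one_mul, mul_assoc, h₁.comm_assoc, h₂.comm_assoc]

/-- N commutes with `1 + S₂` because s₂ N = N; moving it leftwards through the words in S₂S₁ creates
exactly the twisted coefficients. -/
lemma sandwich_three (h₁ : Implements j s₁ S₁) (h₂ : Implements j s₂ S₂) (n₂ N : F)
    (hN : s₂ N = N) :
    (1 + S₁) * ((j N + j (s₂ (s₁ N)) * (S₂ * S₁) +
      j (s₂ (s₁ (s₂ (s₁ N)))) * (S₂ * (S₁ * (S₂ * S₁)))) * ((1 + S₂) * j n₂)) =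
      (1 + S₁) * ((1 + S₂ * S₁ + S₂ * (S₁ * (S₂ * S₁))) * ((1 + S₂) * j (N * n₂))) := by
  have e : (1 + S₂) * j (N * n₂) = j N * ((1 + S₂) * j n₂) := by
    rw [map_mul, ← mul_assoc, ← mul_assoc, add_mul, h₂.comm, hN]; noncomm_ring
  rw [e]
  congr 1
  simp only [add_mul, one_mul, mul_assoc, h₁.comm_assoc, h₂.comm_assoc]

/-- The right side expands to all eight alternating words of length at most four, each once, with
the longest spelled S₁S₂S₁S₂. The hypotheses `I₀` and `I₁` are the equality of the coefficients at 1
and at S₂S₁. -/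
lemma symOp_poly_four (h₁ : Implements j s₁ S₁) (h₂ : Implements j s₂ S₂) (n₁ n₂ N : F) (κ : K)
    (hN : s₂ N = N)
    (I₀ : (n₁ * n₂ + s₁ n₁ * s₁ n₂) * n₁ + n₁ * s₂ n₂ * s₂ n₁ - algebraMap K F κ * n₁ = N)
    (I₁ : n₁ * s₂ n₂ * s₂ (s₁ n₁) = s₂ (s₁ N)) :
    symOp j S₁ n₁ * (symOp j S₂ n₂ * (symOp j S₁ n₁ * symOp j S₂ n₂)) -
      κ • (symOp j S₁ n₁ * symOp j S₂ n₂) =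
      (1 + S₁) * ((1 + S₂ * S₁) * ((1 + S₂) * j (N * n₂))) := by
  have e1 : κ • (symOp j S₁ n₁ * symOp j S₂ n₂) =
      (1 + S₁) * (j (algebraMap K F κ * n₁) * ((1 + S₂) * j n₂)) := by
    rw [map_mul, AlgHom.commutes, Algebra.smul_def]
    simp only [symOp, ← mul_assoc, Algebra.commutes κ (1 + S₁)]
  rw [symOp_pow_two h₁ h₂, I₁, e1, ← sandwich_two h₁ h₂ _ _ hN, ← mul_sub, ← sub_mul, ← I₀,
    map_sub j]
  congr 2
  abel

/-- The analogue for order 12: the right side contains each of the twelve alternating words once,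
the longest spelled (S₁S₂)³, and there is one hypothesis for each of the double coset
representatives 1, S₂S₁, (S₂S₁)². -/
lemma symOp_poly_six (h₁ : Implements j s₁ S₁) (h₂ : Implements j s₂ S₂) (n₁ n₂ N z₀ z₁ : F)
    (κ κ' : K) (hN : s₂ N = N)
    (hz₀ : (n₁ * n₂ + s₁ n₁ * s₁ n₂) * n₁ + n₁ * s₂ n₂ * s₂ n₁ = z₀)
    (hz₁ : n₁ * s₂ n₂ * s₂ (s₁ n₁) = z₁)
    (I₀ : (n₁ * n₂ + s₁ n₁ * s₁ n₂) * z₀ + n₁ * s₂ n₂ * s₂ z₀ +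
        s₁ (n₁ * s₂ n₂ * s₂ z₁) - algebraMap K F κ * z₀ + algebraMap K F κ' * n₁ = N)
    (I₁ : n₁ * s₂ n₂ * s₂ (s₁ z₀) + (n₁ * n₂ + s₁ n₁ * s₁ n₂) * z₁ - algebraMap K F κ * z₁ =
      s₂ (s₁ N))
    (I₂ : n₁ * s₂ n₂ * s₂ (s₁ z₁) = s₂ (s₁ (s₂ (s₁ N)))) :
    symOp j S₁ n₁ * (symOp j S₂ n₂ * (symOp j S₁ n₁ * (symOp j S₂ n₂ *
      (symOp j S₁ n₁ * symOp j S₂ n₂)))) -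
      κ • (symOp j S₁ n₁ * (symOp j S₂ n₂ * (symOp j S₁ n₁ * symOp j S₂ n₂))) +
      κ' • (symOp j S₁ n₁ * symOp j S₂ n₂) =
      (1 + S₁) * ((1 + S₂ * S₁ + S₂ * (S₁ * (S₂ * S₁))) * ((1 + S₂) * j (N * n₂))) := by
  have e0 : ∀ (c : K) (x : A), c • ((1 + S₁) * (x * ((1 + S₂) * j n₂))) =
      (1 + S₁) * ((j (algebraMap K F c) * x) * ((1 + S₂) * j n₂)) := by
    intro c x
    rw [AlgHom.commutes, Algebra.smul_def]
    simp only [← mul_assoc, Algebra.commutes c (1 + S₁)]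
  have e1 : symOp j S₁ n₁ * symOp j S₂ n₂ = (1 + S₁) * (j n₁ * ((1 + S₂) * j n₂)) := by
    simp only [symOp, mul_assoc]
  rw [symOp_pow_two h₁ h₂, hz₀, hz₁, symOp_pow_three h₁ h₂, e1, e0, e0,
    ← sandwich_three h₁ h₂ _ _ hN, ← mul_sub, ← sub_mul, ← mul_add, ← add_mul, ← I₂, ← I₁]
  conv_rhs => rw [← I₀]
  congr 2
  simp only [map_add, map_sub, map_mul, mul_add, sub_mul, mul_assoc]
  abel

/-! #### Passing from `T` to `b = T + 1` -/

lemma altProd_three_sub {x y : A} {u : K} (hx : x * x = u • x) (hy : y * y = u • y) :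
    altProd (x - 1) (y - 1) 3 - altProd (y - 1) (x - 1) 3 =
      (x * (y * x) - (u - 1) • x) - (y * (x * y) - (u - 1) • y) := by
  simp only [altProd, mul_one, mul_sub, sub_mul, one_mul, hx, hy]
  module

lemma altProd_four_sub {x y : A} {u v : K} (hx : x * x = u • x) (hy : y * y = v • y) :
    altProd (x - 1) (y - 1) 4 - altProd (y - 1) (x - 1) 4 =
      (x * (y * (x * y)) - (u + v - 2) • (x * y)) -
        (y * (x * (y * x)) - (u + v - 2) • (y * x)) := by
  have hx' : ∀ a, x * (x * a) = u • (x * a) := fun a => by rw [← mul_assoc, hx, smul_mul_assoc]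
  have hy' : ∀ a, y * (y * a) = v • (y * a) := fun a => by rw [← mul_assoc, hy, smul_mul_assoc]
  simp only [altProd, mul_one, mul_sub, sub_mul, one_mul, mul_smul_comm, hx, hy, hx', hy']
  module

/-- With u = 1 + q and v = 1 + r the two coefficients are 2(q + r) and q² + qr + r², the constants
of the G₂ identities. -/
lemma altProd_six_sub {x y : A} {u v : K} (hx : x * x = u • x) (hy : y * y = v • y) :
    altProd (x - 1) (y - 1) 6 - altProd (y - 1) (x - 1) 6 =
      (x * (y * (x * (y * (x * y)))) - (2 * (u + v - 2)) • (x * (y * (x * y))) +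
        ((u + v - 2) ^ 2 - (u - 1) * (v - 1)) • (x * y)) -
      (y * (x * (y * (x * (y * x)))) - (2 * (u + v - 2)) • (y * (x * (y * x))) +
        ((u + v - 2) ^ 2 - (u - 1) * (v - 1)) • (y * x)) := by
  have hx' : ∀ a, x * (x * a) = u • (x * a) := fun a => by rw [← mul_assoc, hx, smul_mul_assoc]
  have hy' : ∀ a, y * (y * a) = v • (y * a) := fun a => by rw [← mul_assoc, hy, smul_mul_assoc]
  simp only [altProd, mul_one, mul_sub, sub_mul, one_mul, mul_smul_comm, hx, hy, hx', hy']
  module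

end RankTwo

end

/-! ### Rational function identities for the rank two c-functions. -/

section

section RankTwoIdentities

variable {F : Type*} [Field F]

/-- The function `c_{-α} = (q - x) / (1 - x)`, for `x = x^α`. -/
def cNeg (q x : F) : F := (q - x) / (1 - x)

lemma cNeg_inv {q x : F} (h0 : x ≠ 0) (h : 1 - x ≠ 0) : cNeg q x⁻¹ = 1 + q - cNeg q x := by
  have h' : x - 1 ≠ 0 := fun e => h (by linear_combination -e)
  have e : cNeg q x⁻¹ = (q * x - 1) / (x - 1) := by
    rw [cNeg, ← mul_div_mul_right _ _ h0, sub_mul, sub_mul, inv_mul_cancel₀ h0, one_mul]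
  rw [e, cNeg]
  field_simp
  ring

/-- X, Y, XY are the positive roots of A₂, and 1 + q - `cNeg q X` is the value at X⁻¹. This is the
coefficient at the identity in b₁b₂b₁ - q b₁, with a common factor removed. -/
lemma rank_two_A (q X Y : F) (h1 : 1 - X ≠ 0) (h2 : 1 - Y ≠ 0) (h3 : 1 - X * Y ≠ 0) :
    cNeg q X * cNeg q Y + (1 + q - cNeg q X) * cNeg q (X * Y) - q = cNeg q Y * cNeg q (X * Y) := by
  simp only [cNeg]; field_simp; ring

/-- X is the short and Y the long simple root of B₂. The expression is symmetric enough to serve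
both orders of the two reflections. -/
lemma rank_two_B (q r X Y : F) (h1 : 1 - X ≠ 0) (h2 : 1 - Y ≠ 0) (h3 : 1 - X * Y ≠ 0)
    (h4 : 1 - X ^ 2 * Y ≠ 0) :
    cNeg q X * cNeg r Y + (1 + q - cNeg q X) * cNeg r (X ^ 2 * Y) +
      (1 + r - cNeg r Y) * cNeg q (X * Y) - (q + r) = cNeg q (X * Y) * cNeg r (X ^ 2 * Y) := by
  have e1 : (1 + q - cNeg q X) = (1 - q * X) / (1 - X) := by rw [cNeg]; field_simp; ring
  have e2 : (1 + r - cNeg r Y) = (1 - r * Y) / (1 - Y) := by rw [cNeg]; field_simp; ring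
  rw [e1, e2]
  simp only [cNeg]
  rw [div_mul_div_comm, div_mul_div_comm, div_mul_div_comm, div_mul_div_comm,
    div_add_div _ _ (mul_ne_zero h1 h2) (mul_ne_zero h1 h4),
    div_add_div _ _ (mul_ne_zero (mul_ne_zero h1 h2) (mul_ne_zero h1 h4)) (mul_ne_zero h2 h3),
    sub_eq_iff_eq_add, div_add' _ _ _ (mul_ne_zero h3 h4), div_eq_div_iff
    (mul_ne_zero (mul_ne_zero (mul_ne_zero h1 h2) (mul_ne_zero h1 h4)) (mul_ne_zero h2 h3))
    (mul_ne_zero h3 h4)]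
  ring

/-- The coefficient at S₂S₁ in the G₂ computation that starts with the short reflection, after the
factor c_{-X} c_Y c_{XY} is cancelled. -/
lemma rank_two_G_short_one (q r X Y : F) (h1 : 1 - X ≠ 0) (h2 : 1 - Y ≠ 0) (h3 : 1 - X * Y ≠ 0)
    (h4 : 1 - X ^ 2 * Y ≠ 0) (h5 : 1 - X ^ 3 * Y ≠ 0) (h6 : 1 - X ^ 3 * Y ^ 2 ≠ 0) :
    (1 + q - cNeg q (X * Y)) * cNeg r (X ^ 3 * Y ^ 2) + cNeg q (X * Y) * (1 + r - cNeg r Y) +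
      (1 + r - cNeg r (X ^ 3 * Y ^ 2)) * cNeg q (X ^ 2 * Y) + cNeg q X * cNeg r Y +
      (1 + q - cNeg q X) * cNeg r (X ^ 3 * Y) - 2 * (q + r) =
      cNeg q (X ^ 2 * Y) * cNeg r (X ^ 3 * Y) := by
  simp only [cNeg]; field_simp; ring

lemma rank_two_G_long_one (q r X Y : F) (h1 : 1 - X ≠ 0) (h2 : 1 - Y ≠ 0) (h3 : 1 - X * Y ≠ 0)
    (h4 : 1 - X ^ 2 * Y ≠ 0) (h5 : 1 - X ^ 3 * Y ≠ 0) (h6 : 1 - X ^ 3 * Y ^ 2 ≠ 0) :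
    (1 + r - cNeg r (X ^ 3 * Y)) * cNeg q (X ^ 2 * Y) + cNeg r (X ^ 3 * Y) * (1 + q - cNeg q X) +
      (1 + q - cNeg q (X ^ 2 * Y)) * cNeg r (X ^ 3 * Y ^ 2) + cNeg r Y * cNeg q X +
      (1 + r - cNeg r Y) * cNeg q (X * Y) - 2 * (q + r) =
      cNeg r (X ^ 3 * Y ^ 2) * cNeg q (X * Y) := by
  simp only [cNeg]; field_simp; ring

-- The coefficient at the identity in the same computation, after the factor c_{-X} is cancelled.
-- The value variables keep the statement in the shape in which the generalised coefficients occur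
-- later.
set_option maxHeartbeats 4000000 in
lemma rank_two_G_short_zero (q r X Y a b c d e f : F) (h1 : 1 - X ≠ 0) (h2 : 1 - Y ≠ 0) (h3 : 1 - X * Y ≠ 0)
    (h4 : 1 - X ^ 2 * Y ≠ 0) (h5 : 1 - X ^ 3 * Y ≠ 0) (h6 : 1 - X ^ 3 * Y ^ 2 ≠ 0)
    (ha : a = cNeg q X) (hb : b = cNeg r Y) (hc : c = cNeg q (X * Y)) (hd : d = cNeg q (X ^ 2 * Y))
    (he : e = cNeg r (X ^ 3 * Y)) (hf : f = cNeg r (X ^ 3 * Y ^ 2)) :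
    (a * b + (1 + q - a) * e) ^ 2 + (a * b + (1 + q - a) * e) * (1 + r - b) * c 
     + (1 + r - b) * ((c * (1 + r - b) + (1 + q - c) * f) * c + c * b * a) + (1 + q - a) * (1 + r - e) * (d * e)
     - 2 * (q + r) * (a * b + (1 + q - a) * e + (1 + r - b) * c)
       + (q ^ 2 + q * r + r ^ 2) = c * d * e * f := by
  rw [ha, hb, hc, hd, he, hf]
  simp only [cNeg]; field_simp; ring
set_option maxHeartbeats 4000000 in
lemma rank_two_G_long_zero (q r X Y a b c d e f : F) (h1 : 1 - X ≠ 0) (h2 : 1 - Y ≠ 0) (h3 : 1 - X * Y ≠ 0)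
    (h4 : 1 - X ^ 2 * Y ≠ 0) (h5 : 1 - X ^ 3 * Y ≠ 0) (h6 : 1 - X ^ 3 * Y ^ 2 ≠ 0)
    (ha : a = cNeg q X) (hb : b = cNeg r Y) (hc : c = cNeg q (X * Y)) (hd : d = cNeg q (X ^ 2 * Y))
    (he : e = cNeg r (X ^ 3 * Y)) (hf : f = cNeg r (X ^ 3 * Y ^ 2)) :
    (a * b + (1 + r - b) * c) ^ 2 + (a * b + (1 + r - b) * c) * (1 + q - a) * e 
     + (1 + q - a) * ((e * (1 + q - a) + (1 + r - e) * d) * e + e * a * b) + (1 + r - b) * (1 + q - c) * (f * c)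
     - 2 * (q + r) * (a * b + (1 + r - b) * c + (1 + q - a) * e)
       + (q ^ 2 + q * r + r ^ 2) = c * d * e * f := by
  rw [ha, hb, hc, hd, he, hf]
  simp only [cNeg]; field_simp; ring

end RankTwoIdentities

end

/-! ### Braid defects in the types A₁ × A₁, A₂, B₂ and G₂. -/

section

section RankTwoBraid

variable {K F A : Type*} [Field K] [Field F] [Algebra K F] [Ring A] [Algebra K A]
variable {j : F →ₐ[K] A} {s s₁ s₂ : F →ₐ[K] F} {S S₁ S₂ : A}

lemma map_cNeg (s : F →ₐ[K] F) (q : K) (x : F) :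
    s (cNeg (algebraMap K F q) x) = cNeg (algebraMap K F q) (s x) := by
  simp [cNeg]

/-- The Demazure-Lusztig operator `(c - 1) + ⋯`: `T = b - 1` with `b = (1 + S) c_{-α}`. -/
def dlOp (j : F →ₐ[K] A) (S : A) (q : K) (x : F) : A :=
  symOp j S (cNeg (algebraMap K F q) x) - 1

/-- Elements `x` and `y` whose monomials with nonnegative exponents are not constant. -/
structure Generic (K : Type*) {F : Type*} [Field K] [Field F] [Algebra K F] (x y : F) : Prop where
  ne : ∀ (a b : ℕ) (c : K), a + b ≠ 0 → algebraMap K F c - x ^ a * y ^ b ≠ 0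

namespace Generic

variable {x y : F} (h : Generic K x y)
include h

lemma symm : Generic K y x := ⟨fun a b c hab => by rw [mul_comm]; exact h.ne b a c (by omega)⟩

lemma one_sub (a b : ℕ) (hab : a + b ≠ 0) : 1 - x ^ a * y ^ b ≠ 0 := by
  simpa using h.ne a b 1 hab

lemma cNeg_ne (q : K) (a b : ℕ) (hab : a + b ≠ 0) :
    cNeg (algebraMap K F q) (x ^ a * y ^ b) ≠ 0 :=
  div_ne_zero (h.ne a b q hab) (h.one_sub a b hab)

lemma cNeg_inv (q : K) (a b : ℕ) (hab : a + b ≠ 0) :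
    cNeg (algebraMap K F q) (x ^ a * y ^ b)⁻¹ =
      1 + algebraMap K F q - cNeg (algebraMap K F q) (x ^ a * y ^ b) :=
  Metaplectic.cNeg_inv (by simpa using h.ne a b 0 hab) (h.one_sub a b hab)

end Generic

/-- The braid defect of `T₁, T₂` is a multiple of the braid defect of `S₁, S₂`. -/
def BraidDefect (j : F →ₐ[K] A) (S₁ S₂ T₁ T₂ : A) (m : ℕ) : Prop :=
  ∃ N : F, N ≠ 0 ∧ altProd T₁ T₂ m - altProd T₂ T₁ m =
    (altProd S₁ S₂ m - altProd S₂ S₁ m) * j N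

lemma BraidDefect.symm {T₁ T₂ : A} {m : ℕ} (h : BraidDefect j S₁ S₂ T₁ T₂ m) :
    BraidDefect j S₂ S₁ T₂ T₁ m := by
  obtain ⟨N, h0, h⟩ := h
  exact ⟨N, h0, by rw [← neg_inj, neg_sub, h, ← neg_mul, neg_sub]⟩

variable {x y : F} {q r : K}

lemma Implements.dlOp_quad (h : Implements j s S)
    (hn : s (cNeg (algebraMap K F q) x) = algebraMap K F (1 + q) - cNeg (algebraMap K F q) x) :
    dlOp j S q x * dlOp j S q x = (q - 1) • dlOp j S q x + q • 1 := by
  have e := h.symOp_sq hn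
  rw [dlOp, sub_mul, mul_sub, mul_sub, e]
  simp only [mul_one, one_mul]
  module

/-- Each c-function is fixed by the other reflection, so both can be moved to the right end. -/
lemma braidDefect_two (h₁ : Implements j s₁ S₁) (h₂ : Implements j s₂ S₂) (hg : Generic K x y)
    (hx : s₂ x = x) (hy : s₁ y = y) :
    BraidDefect j S₁ S₂ (dlOp j S₁ q x) (dlOp j S₂ r y) 2 := by
  have hx0 := hg.cNeg_ne q 1 0 (by simp)
  have hy0 := hg.cNeg_ne r 0 1 (by simp)
  simp only [pow_one, pow_zero, one_mul, mul_one] at hx0 hy0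
  refine ⟨cNeg (algebraMap K F q) x * cNeg (algebraMap K F r) y, mul_ne_zero hx0 hy0, ?_⟩
  have e1 : S₂ * j (cNeg (algebraMap K F q) x) = j (cNeg (algebraMap K F q) x) * S₂ := by
    rw [h₂.comm, map_cNeg, hx]
  have e2 : S₁ * j (cNeg (algebraMap K F r) y) = j (cNeg (algebraMap K F r) y) * S₁ := by
    rw [h₁.comm, map_cNeg, hy]
  have e3 : j (cNeg (algebraMap K F q) x) * j (cNeg (algebraMap K F r) y) =
      j (cNeg (algebraMap K F r) y) * j (cNeg (algebraMap K F q) x) := by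
    rw [← map_mul, mul_comm, map_mul]
  have e4 : symOp j S₁ (cNeg (algebraMap K F q) x) * symOp j S₂ (cNeg (algebraMap K F r) y) =
      (1 + S₁) * (1 + S₂) * j (cNeg (algebraMap K F q) x * cNeg (algebraMap K F r) y) := by
    have : j (cNeg (algebraMap K F q) x) * (1 + S₂) = (1 + S₂) * j (cNeg (algebraMap K F q) x) := by
      rw [mul_add, add_mul, e1, mul_one, one_mul]
    rw [symOp, symOp, map_mul, mul_assoc, ← mul_assoc _ (1 + S₂), this]
    simp only [mul_assoc]
  have e5 : symOp j S₂ (cNeg (algebraMap K F r) y) * symOp j S₁ (cNeg (algebraMap K F q) x) =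
      (1 + S₂) * (1 + S₁) * j (cNeg (algebraMap K F q) x * cNeg (algebraMap K F r) y) := by
    have : j (cNeg (algebraMap K F r) y) * (1 + S₁) = (1 + S₁) * j (cNeg (algebraMap K F r) y) := by
      rw [mul_add, add_mul, e2, mul_one, one_mul]
    rw [symOp, symOp, map_mul, e3, mul_assoc, ← mul_assoc _ (1 + S₁), this]
    simp only [mul_assoc]
  have e6 : altProd (dlOp j S₁ q x) (dlOp j S₂ r y) 2 - altProd (dlOp j S₂ r y) (dlOp j S₁ q x) 2 =
      symOp j S₁ (cNeg (algebraMap K F q) x) * symOp j S₂ (cNeg (algebraMap K F r) y) -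
      symOp j S₂ (cNeg (algebraMap K F r) y) * symOp j S₁ (cNeg (algebraMap K F q) x) := by
    simp only [altProd, dlOp]; noncomm_ring
  rw [e6, e4, e5, ← sub_mul]
  congr 1
  simp only [altProd]; noncomm_ring

/-- Each of b₁b₂b₁ - q b₁ and b₂b₁b₂ - q b₂ is the sum of all six alternating words times the
product of the three c_{-β}. They differ only in how the longest word is spelled. -/
lemma braidDefect_three (h₁ : Implements j s₁ S₁) (h₂ : Implements j s₂ S₂) (hg : Generic K x y)
    (h1x : s₁ x = x⁻¹) (h1y : s₁ y = x * y) (h2x : s₂ x = x * y) (h2y : s₂ y = y⁻¹) :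
    BraidDefect j S₁ S₂ (dlOp j S₁ q x) (dlOp j S₂ q y) 3 := by
  have o1 := hg.one_sub 1 0 (by simp)
  have o2 := hg.one_sub 0 1 (by simp)
  have o3 := hg.one_sub 1 1 (by simp)
  have z1 := hg.cNeg_ne q 1 0 (by simp)
  have z2 := hg.cNeg_ne q 0 1 (by simp)
  have z3 := hg.cNeg_ne q 1 1 (by simp)
  have i1 := hg.cNeg_inv q 1 0 (by simp)
  have i2 := hg.cNeg_inv q 0 1 (by simp)
  simp only [pow_one, pow_zero, one_mul, mul_one] at *
  have hid := rank_two_A (algebraMap K F q) x y o1 o2 o3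
  have hid' := rank_two_A (algebraMap K F q) y x o2 o1 (by rwa [mul_comm])
  rw [mul_comm y x] at hid'
  set Q := algebraMap K F q with hQ
  have s1a : s₁ (cNeg Q x) = 1 + Q - cNeg Q x := by rw [map_cNeg, h1x, i1]
  have s1b : s₁ (cNeg Q y) = cNeg Q (x * y) := by rw [map_cNeg, h1y]
  have s2a : s₂ (cNeg Q x) = cNeg Q (x * y) := by rw [map_cNeg, h2x]
  have s2b : s₂ (cNeg Q y) = 1 + Q - cNeg Q y := by rw [map_cNeg, h2y, i2]
  have hx0 : x ≠ 0 := by simpa using hg.ne 1 0 0 (by simp)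
  have hy0 : y ≠ 0 := by simpa using hg.ne 0 1 0 (by simp)
  have s1c : s₁ (cNeg Q (x * y)) = cNeg Q y := by
    rw [map_cNeg, map_mul, h1x, h1y, inv_mul_cancel_left₀ hx0]
  have s2c : s₂ (cNeg Q (x * y)) = cNeg Q x := by
    rw [map_cNeg, map_mul, h2x, h2y, mul_inv_cancel_right₀ hy0]
  clear_value Q
  generalize ha : cNeg Q x = a at *
  generalize hb : cNeg Q y = b at *
  generalize hc : cNeg Q (x * y) = c at *
  have hs1 := h₁.symOp_sq (n := a) (q := q) (by rw [s1a, map_add, map_one, hQ])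
  have hs2 := h₂.symOp_sq (n := b) (q := q) (by rw [s2b, map_add, map_one, hQ])
  refine ⟨a * b * c, by simp [*], ?_⟩
  rw [dlOp, dlOp, ← hQ, ha, hb, altProd_three_sub hs1 hs2]
  -- Stated for an arbitrary pair so that it applies both to (S₁, S₂) and to (S₂, S₁).
  have key : ∀ {s₁ s₂ : F →ₐ[K] F} {S₁ S₂ : A} {a b : F} (h₁ : Implements j s₁ S₁)
      (h₂ : Implements j s₂ S₂) (s1a : s₁ a = 1 + Q - a) (s1b : s₁ b = c) (s1c : s₁ c = b)
      (s2a : s₂ a = c) (s2b : s₂ b = 1 + Q - b) (s2c : s₂ c = a)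
      (hid : a * b + (1 + Q - a) * c - Q = b * c),
      symOp j S₁ a * (symOp j S₂ b * symOp j S₁ a) - (1 + q - 1) • symOp j S₁ a =
        (1 + S₁) * ((1 + S₂ * (1 + S₁)) * j (a * b * c)) := by
    intro s₁ s₂ S₁ S₂ a b h₁ h₂ s1a s1b s1c s2a s2b s2c hid
    have e0 : symOp j S₁ a = (1 + S₁) * (j a * 1) := by rw [symOp, mul_one]
    have e2 : (1 + q - 1) • symOp j S₁ a = (1 + S₁) * j (Q * a) := by
      rw [hQ, map_mul, AlgHom.commutes, symOp, add_sub_cancel_left, Algebra.smul_def,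
        ← mul_assoc, ← mul_assoc, Algebra.commutes q (1 + S₁)]
    have e1 : symOp j S₁ a * (symOp j S₂ b * symOp j S₁ a) =
        (1 + S₁) * (j ((a * b + s₁ a * s₁ b) * a)) +
        (1 + S₁) * (j (a * s₂ b * s₂ a) * S₂) +
        (1 + S₁) * (j (a * s₂ b * s₂ (s₁ a)) * (S₂ * S₁)) := by
      have := symOp_mul_symOp_mul h₁ h₂ a b a 1
      rw [← e0] at this
      simpa only [mul_one] using this
    have e3 : S₂ * j (a * b * c) = j (a * (1 + Q - b) * c) * S₂ := by
      rw [h₂.comm, map_mul s₂, map_mul s₂, s2a, s2b, s2c]; congr 2; ring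
    have e4 : S₁ * j (a * b * c) = j ((1 + Q - a) * b * c) * S₁ := by
      rw [h₁.comm, map_mul s₁, map_mul s₁, s1a, s1b, s1c]; congr 2; ring
    have hq2 : s₂ Q = Q := by rw [hQ, AlgHom.commutes]
    have e5 : S₂ * (S₁ * j (a * b * c)) = j (a * (1 + Q - b) * (1 + Q - c)) * (S₂ * S₁) := by
      rw [e4, ← mul_assoc, h₂.comm, mul_assoc]
      have : s₂ ((1 + Q - a) * b * c) = a * (1 + Q - b) * (1 + Q - c) := by
        rw [map_mul, map_mul, map_sub, map_add, map_one, hq2, s2a, s2b, s2c]; ring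
      rw [this]
    have e6 : (a * b + s₁ a * s₁ b) * a = a * b * c + Q * a := by
      rw [s1a, s1b]; linear_combination a * hid
    rw [e1, e2, e6, s2b, s2a, s1a, map_sub s₂, map_add s₂, map_one s₂, hq2, s2a, map_add j]
    have e7 : j (a * (1 + Q - b) * c) * S₂ = S₂ * j (a * b * c) := e3.symm
    have e8 : j (a * (1 + Q - b) * (1 + Q - c)) * (S₂ * S₁) = S₂ * (S₁ * j (a * b * c)) := e5.symm
    rw [e7, e8]
    noncomm_ring
  rw [key h₁ h₂ s1a s1b s1c s2a s2b s2c hid, key h₂ h₁ s2b s2a s2c s1b s1a s1c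
    (by linear_combination hid'), mul_comm b a, ← mul_assoc, ← mul_assoc, ← sub_mul]
  congr 1
  simp only [altProd]
  noncomm_ring

/-- x is the short root. By `altProd_four_sub` the defect is a difference of two polynomials in b₁,
b₂. Each is the sum of eight words times the product of c_{-β} over x, y, xy, x²y, so all words
cancel except the two spellings of the longest. -/
lemma braidDefect_four (h₁ : Implements j s₁ S₁) (h₂ : Implements j s₂ S₂) (hg : Generic K x y)
    (h1x : s₁ x = x⁻¹) (h1y : s₁ y = x ^ 2 * y) (h2x : s₂ x = x * y) (h2y : s₂ y = y⁻¹) :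
    BraidDefect j S₁ S₂ (dlOp j S₁ q x) (dlOp j S₂ r y) 4 := by
  have o1 := hg.one_sub 1 0 (by simp)
  have o2 := hg.one_sub 0 1 (by simp)
  have o3 := hg.one_sub 1 1 (by simp)
  have o4 := hg.one_sub 2 1 (by simp)
  have z1 := hg.cNeg_ne q 1 0 (by simp)
  have z2 := hg.cNeg_ne r 0 1 (by simp)
  have z3 := hg.cNeg_ne q 1 1 (by simp)
  have z4 := hg.cNeg_ne r 2 1 (by simp)
  have i1 := hg.cNeg_inv q 1 0 (by simp)
  have i2 := hg.cNeg_inv r 0 1 (by simp)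
  simp only [pow_one, pow_zero, one_mul, mul_one] at *
  have hid := rank_two_B (algebraMap K F q) (algebraMap K F r) x y o1 o2 o3 o4
  set Q := algebraMap K F q with hQ
  set R := algebraMap K F r with hR
  have hx0 : x ≠ 0 := by simpa using hg.ne 1 0 0 (by simp)
  have hy0 : y ≠ 0 := by simpa using hg.ne 0 1 0 (by simp)
  have s1a : s₁ (cNeg Q x) = 1 + Q - cNeg Q x := by rw [map_cNeg, h1x, i1]
  have s1b : s₁ (cNeg R y) = cNeg R (x ^ 2 * y) := by rw [map_cNeg, h1y]
  have s2a : s₂ (cNeg Q x) = cNeg Q (x * y) := by rw [map_cNeg, h2x]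
  have s2b : s₂ (cNeg R y) = 1 + R - cNeg R y := by rw [map_cNeg, h2y, i2]
  have s1c : s₁ (cNeg Q (x * y)) = cNeg Q (x * y) := by
    rw [map_cNeg, map_mul, h1x, h1y]; congr 1; field_simp
  have s2c : s₂ (cNeg Q (x * y)) = cNeg Q x := by
    rw [map_cNeg, map_mul, h2x, h2y]; congr 1; field_simp
  have s1d : s₁ (cNeg R (x ^ 2 * y)) = cNeg R y := by
    rw [map_cNeg, map_mul, map_pow, h1x, h1y]; congr 1; field_simp
  have s2d : s₂ (cNeg R (x ^ 2 * y)) = cNeg R (x ^ 2 * y) := by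
    rw [map_cNeg, map_mul, map_pow, h2x, h2y]; congr 1; field_simp
  have s1Q : s₁ Q = Q := by rw [hQ, AlgHom.commutes]
  have s2Q : s₂ Q = Q := by rw [hQ, AlgHom.commutes]
  have s1R : s₁ R = R := by rw [hR, AlgHom.commutes]
  have s2R : s₂ R = R := by rw [hR, AlgHom.commutes]
  have hκ : algebraMap K F (1 + q + (1 + r) - 2) = Q + R := by
    rw [hQ, hR, ← map_add]; congr 1; ring
  clear_value Q R
  generalize ha : cNeg Q x = a at *
  generalize hb : cNeg R y = b at *
  generalize hc : cNeg Q (x * y) = c at *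
  generalize hd : cNeg R (x ^ 2 * y) = d at *
  have hs1 := h₁.symOp_sq (n := a) (q := q) (by rw [s1a, map_add, map_one, hQ])
  have hs2 := h₂.symOp_sq (n := b) (q := r) (by rw [s2b, map_add, map_one, hR])
  have k1 := symOp_poly_four h₁ h₂ a b (a * c * d) (1 + q + (1 + r) - 2)
    (by simp only [map_mul, s2a, s2c, s2d]; ring)
    (by rw [hκ]; simp only [map_mul, s1a, s1b, s2a, s2b]; linear_combination a * hid)
    (by simp only [map_mul, map_add, map_sub, map_one, s1a, s1b, s1c, s1d, s2a, s2b, s2c, s2d, s2Q]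
        ring)
  have k2 := symOp_poly_four h₂ h₁ b a (b * c * d) (1 + q + (1 + r) - 2)
    (by simp only [map_mul, s1b, s1c, s1d]; ring)
    (by rw [hκ]; simp only [map_mul, s1a, s1b, s2a, s2b]; linear_combination b * hid)
    (by simp only [map_mul, map_add, map_sub, map_one, s1a, s1b, s1c, s1d, s2a, s2b, s2c, s2d, s1R]
        ring)
  refine ⟨a * c * d * b, by simp [*], ?_⟩
  rw [dlOp, dlOp, ← hQ, ← hR, ha, hb, altProd_four_sub hs1 hs2, k1, k2,
    show b * c * d * a = a * c * d * b by ring]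
  simp only [← mul_assoc]
  rw [← sub_mul]
  congr 1
  simp only [altProd]
  noncomm_ring

-- Same mechanism as in type B₂, with x short, six positive roots, and twelve words on each side.
-- Only the two coefficients treated by the G₂ identities need more than `ring`.
set_option maxHeartbeats 1000000 in
lemma braidDefect_six (h₁ : Implements j s₁ S₁) (h₂ : Implements j s₂ S₂) (hg : Generic K x y)
    (h1x : s₁ x = x⁻¹) (h1y : s₁ y = x ^ 3 * y) (h2x : s₂ x = x * y) (h2y : s₂ y = y⁻¹) :
    BraidDefect j S₁ S₂ (dlOp j S₁ q x) (dlOp j S₂ r y) 6 := by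
  have o1 := hg.one_sub 1 0 (by simp)
  have o2 := hg.one_sub 0 1 (by simp)
  have o3 := hg.one_sub 1 1 (by simp)
  have o4 := hg.one_sub 2 1 (by simp)
  have o5 := hg.one_sub 3 1 (by simp)
  have o6 := hg.one_sub 3 2 (by simp)
  have z1 := hg.cNeg_ne q 1 0 (by simp)
  have z2 := hg.cNeg_ne r 0 1 (by simp)
  have z3 := hg.cNeg_ne q 1 1 (by simp)
  have z4 := hg.cNeg_ne q 2 1 (by simp)
  have z5 := hg.cNeg_ne r 3 1 (by simp)
  have z6 := hg.cNeg_ne r 3 2 (by simp)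
  have i1 := hg.cNeg_inv q 1 0 (by simp)
  have i2 := hg.cNeg_inv r 0 1 (by simp)
  simp only [pow_one, pow_zero, one_mul, mul_one] at *
  set Q := algebraMap K F q with hQ
  set R := algebraMap K F r with hR
  have hs0 := rank_two_G_short_zero Q R x y _ _ _ _ _ _ o1 o2 o3 o4 o5 o6 rfl rfl rfl rfl rfl rfl
  have hl0 := rank_two_G_long_zero Q R x y _ _ _ _ _ _ o1 o2 o3 o4 o5 o6 rfl rfl rfl rfl rfl rfl
  have hs1 := rank_two_G_short_one Q R x y o1 o2 o3 o4 o5 o6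
  have hl1 := rank_two_G_long_one Q R x y o1 o2 o3 o4 o5 o6
  have hx0 : x ≠ 0 := by simpa using hg.ne 1 0 0 (by simp)
  have hy0 : y ≠ 0 := by simpa using hg.ne 0 1 0 (by simp)
  have s1a : s₁ (cNeg Q x) = 1 + Q - cNeg Q x := by rw [map_cNeg, h1x, i1]
  have s1b : s₁ (cNeg R y) = cNeg R (x ^ 3 * y) := by rw [map_cNeg, h1y]
  have s1c : s₁ (cNeg Q (x * y)) = cNeg Q (x ^ 2 * y) := by
    rw [map_cNeg, map_mul, h1x, h1y]; congr 1; field_simp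
  have s1d : s₁ (cNeg Q (x ^ 2 * y)) = cNeg Q (x * y) := by
    rw [map_cNeg, map_mul, map_pow, h1x, h1y]; congr 1; field_simp
  have s1e : s₁ (cNeg R (x ^ 3 * y)) = cNeg R y := by
    rw [map_cNeg, map_mul, map_pow, h1x, h1y]; congr 1; field_simp
  have s1f : s₁ (cNeg R (x ^ 3 * y ^ 2)) = cNeg R (x ^ 3 * y ^ 2) := by
    rw [map_cNeg, map_mul, map_pow, map_pow, h1x, h1y]; congr 1; field_simp
  have s2a : s₂ (cNeg Q x) = cNeg Q (x * y) := by rw [map_cNeg, h2x]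
  have s2b : s₂ (cNeg R y) = 1 + R - cNeg R y := by rw [map_cNeg, h2y, i2]
  have s2c : s₂ (cNeg Q (x * y)) = cNeg Q x := by
    rw [map_cNeg, map_mul, h2x, h2y]; congr 1; field_simp
  have s2d : s₂ (cNeg Q (x ^ 2 * y)) = cNeg Q (x ^ 2 * y) := by
    rw [map_cNeg, map_mul, map_pow, h2x, h2y]; congr 1; field_simp
  have s2e : s₂ (cNeg R (x ^ 3 * y)) = cNeg R (x ^ 3 * y ^ 2) := by
    rw [map_cNeg, map_mul, map_pow, h2x, h2y]; congr 1; field_simp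
  have s2f : s₂ (cNeg R (x ^ 3 * y ^ 2)) = cNeg R (x ^ 3 * y) := by
    rw [map_cNeg, map_mul, map_pow, map_pow, h2x, h2y]; congr 1; field_simp
  have s1Q : s₁ Q = Q := by rw [hQ, AlgHom.commutes]
  have s2Q : s₂ Q = Q := by rw [hQ, AlgHom.commutes]
  have s1R : s₁ R = R := by rw [hR, AlgHom.commutes]
  have s2R : s₂ R = R := by rw [hR, AlgHom.commutes]
  have hκ : algebraMap K F (2 * (1 + q + (1 + r) - 2)) = 2 * (Q + R) := by
    rw [hQ, hR, ← map_add, ← map_ofNat (algebraMap K F) 2, ← map_mul]; congr 1; ring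
  have hκ' : algebraMap K F ((1 + q + (1 + r) - 2) ^ 2 - (1 + q - 1) * (1 + r - 1)) =
      Q ^ 2 + Q * R + R ^ 2 := by
    rw [hQ, hR, ← map_mul, ← map_pow, ← map_pow, ← map_add, ← map_add]; congr 1; ring
  clear_value Q R
  generalize ha : cNeg Q x = a at *
  generalize hb : cNeg R y = b at *
  generalize hc : cNeg Q (x * y) = c at *
  generalize hd : cNeg Q (x ^ 2 * y) = d at *
  generalize he : cNeg R (x ^ 3 * y) = e at *
  generalize hf : cNeg R (x ^ 3 * y ^ 2) = f at *
  have hsq1 := h₁.symOp_sq (n := a) (q := q) (by rw [s1a, map_add, map_one, hQ])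
  have hsq2 := h₂.symOp_sq (n := b) (q := r) (by rw [s2b, map_add, map_one, hR])
  have k1 := symOp_poly_six h₁ h₂ a b (a * c * d * e * f) _ _ (2 * (1 + q + (1 + r) - 2))
    ((1 + q + (1 + r) - 2) ^ 2 - (1 + q - 1) * (1 + r - 1))
    (by simp only [map_mul, s2a, s2c, s2d, s2e, s2f]; ring) rfl rfl
    (by
      rw [hκ, hκ']
      simp only [map_mul, map_add, map_sub, map_one, s1a, s1b, s1c, s1d, s1e, s1f,
        s2a, s2b, s2c, s2d, s2e, s2f, s1Q, s2Q, s1R, s2R]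
      linear_combination a * hs0)
    (by
      rw [hκ]
      simp only [map_mul, map_add, map_sub, map_one, s1a, s1b, s1c, s1d, s1e, s1f,
        s2a, s2b, s2c, s2d, s2e, s2f, s1Q, s2Q, s1R, s2R]
      linear_combination (a * (1 + R - b) * (1 + Q - c)) * hs1)
    (by
      simp only [map_mul, map_add, map_sub, map_one, s1a, s1b, s1c, s1d, s1e, s1f,
        s2a, s2b, s2c, s2d, s2e, s2f, s1Q, s2Q, s1R, s2R]
      ring)
  have k2 := symOp_poly_six h₂ h₁ b a (b * c * d * e * f) _ _ (2 * (1 + q + (1 + r) - 2))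
    ((1 + q + (1 + r) - 2) ^ 2 - (1 + q - 1) * (1 + r - 1))
    (by simp only [map_mul, s1b, s1c, s1d, s1e, s1f]; ring) rfl rfl
    (by
      rw [hκ, hκ']
      simp only [map_mul, map_add, map_sub, map_one, s1a, s1b, s1c, s1d, s1e, s1f,
        s2a, s2b, s2c, s2d, s2e, s2f, s1Q, s2Q, s1R, s2R]
      linear_combination b * hl0)
    (by
      rw [hκ]
      simp only [map_mul, map_add, map_sub, map_one, s1a, s1b, s1c, s1d, s1e, s1f,
        s2a, s2b, s2c, s2d, s2e, s2f, s1Q, s2Q, s1R, s2R]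
      linear_combination (b * (1 + Q - a) * (1 + R - e)) * hl1)
    (by
      simp only [map_mul, map_add, map_sub, map_one, s1a, s1b, s1c, s1d, s1e, s1f,
        s2a, s2b, s2c, s2d, s2e, s2f, s1Q, s2Q, s1R, s2R]
      ring)
  refine ⟨a * c * d * e * f * b, by simp [*], ?_⟩
  rw [dlOp, dlOp, ← hQ, ← hR, ha, hb, altProd_six_sub hsq1 hsq2, k1, k2,
    show b * c * d * e * f * a = a * c * d * e * f * b by ring]
  simp only [← mul_assoc]
  rw [← sub_mul]
  congr 1
  simp only [altProd, mul_add, add_mul, one_mul, mul_one, mul_assoc, h₁.sq_assoc, h₂.sq_assoc,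
    h₁.sq, h₂.sq]
  abel

end RankTwoBraid

end

/-! ### Orders of products of two simple reflections. -/

section

section WeylGroup

variable {ι E : Type*} [NormedAddCommGroup E] [InnerProductSpace ℝ E] {Φ : RootPairing ι ℝ E E}

lemma sRefl_smul (i : ι) (x : E) :
    sRefl Φ i • x = x - Φ.toLinearMap x (Φ.coroot i) • Φ.root i := by
  have : sRefl Φ i • x = Φ.reflection i x := rfl
  rw [this, RootPairing.reflection_apply]
  rfl

lemma weyl_smul_smul (w : Φ.weylGroup) (c : ℝ) (x : E) : w • (c • x) = c • (w • x) :=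
  smul_comm w.1 c x

lemma weyl_ext [Φ.IsRootSystem] {w w' : Φ.weylGroup} (h : ∀ x : E, w • x = w' • x) : w = w' := by
  apply Subtype.ext
  apply RootPairing.Equiv.weightHom_injective Φ
  apply LinearEquiv.toLinearMap_injective
  exact LinearMap.ext h

lemma sRefl_mul_self [Φ.IsRootSystem] (i : ι) : sRefl Φ i * sRefl Φ i = 1 := by
  refine weyl_ext fun x => ?_
  have : (sRefl Φ i * sRefl Φ i) • x = Φ.reflection i (Φ.reflection i x) := rfl
  rw [this, RootPairing.reflection_same, one_smul]

lemma sRefl_inv [Φ.IsRootSystem] (i : ι) : (sRefl Φ i)⁻¹ = sRefl Φ i :=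
  inv_eq_of_mul_eq_one_left (sRefl_mul_self i)

lemma sRefl_smul_index (i j : ι) : sRefl Φ i • j = Φ.reflectionPerm i j := rfl

lemma sRefl_conj [Φ.IsRootSystem] (i j : ι) :
    sRefl Φ (sRefl Φ j • i) = sRefl Φ j * sRefl Φ i * sRefl Φ j := by
  refine weyl_ext fun x => ?_
  have : (sRefl Φ j * sRefl Φ i * sRefl Φ j) • x =
    Φ.reflection j (Φ.reflection i (Φ.reflection j x)) := rfl
  rw [this]
  have h := congrArg (fun f => f x) (Φ.reflection_reflectionPerm (i := i) (j := j))
  exact h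

variable [Finite ι] [Φ.IsRootSystem] [Φ.IsCrystallographic] [Φ.IsReduced] (b : Φ.Base)

lemma toLinearMap_root_coroot (i j : ι) :
    Φ.toLinearMap (Φ.root i) (Φ.coroot j) = (Φ.pairingIn ℤ i j : ℝ) := by
  rw [RootPairing.root_coroot_eq_pairing, ← Φ.algebraMap_pairingIn ℤ]; simp

/-- The possible relative positions of two simple roots. -/
lemma base_pairing_cases {b : Φ.Base} {i j : b.support} (h : i ≠ j) :
    (Φ.pairingIn ℤ i j = 0 ∧ Φ.pairingIn ℤ j i = 0) ∨
    (Φ.pairingIn ℤ i j = -1 ∧ Φ.pairingIn ℤ j i = -1) ∨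
    (Φ.pairingIn ℤ i j = -1 ∧ Φ.pairingIn ℤ j i = -2) ∨
    (Φ.pairingIn ℤ i j = -2 ∧ Φ.pairingIn ℤ j i = -1) ∨
    (Φ.pairingIn ℤ i j = -1 ∧ Φ.pairingIn ℤ j i = -3) ∨
    (Φ.pairingIn ℤ i j = -3 ∧ Φ.pairingIn ℤ j i = -1) := by
  have h' : (i : ι) ≠ j := fun e => h (Subtype.ext e)
  have h1 := b.pairingIn_le_zero_of_ne h' i.2 j.2
  have h2 := b.pairingIn_le_zero_of_ne h'.symm j.2 i.2
  have h3 := Φ.pairingIn_pairingIn_mem_set_of_isCrystal_of_isRed' (i := i) (j := j)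
    (fun e => h' (Φ.root.injective e)) (b.root_ne_neg_of_ne i.2 j.2 h')
  simp only [Set.mem_insert_iff, Set.mem_singleton_iff, Prod.mk.injEq] at h3
  omega

lemma pair_eq_zero {b : Φ.Base} {i j : b.support} (h : i ≠ j) {p r : ℝ}
    (e : p • Φ.root i + r • Φ.root j = 0) : p = 0 ∧ r = 0 :=
  LinearIndependent.pair_iff.1 (b.linearIndependent_pair_of_ne h) p r e

/-- The affine plane x + ℝα_i + ℝα_j is stable under both reflections. In the coordinates (p, r),
questions about the dihedral group become arithmetic with Cartan integers. -/
lemma alt_smul_aux {b : Φ.Base} {i j : b.support} (x : E) (p r : ℝ) :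
    sRefl Φ i • (x + p • Φ.root i + r • Φ.root j) =
      x + (-(Φ.toLinearMap x (Φ.coroot i) + p + r * Φ.pairingIn ℤ j i)) • Φ.root i +
        r • Φ.root j := by
  rw [sRefl_smul]
  simp only [map_add, map_smul, LinearMap.add_apply, LinearMap.smul_apply,
    toLinearMap_root_coroot, smul_eq_mul, RootPairing.pairingIn_same]
  push_cast
  module

lemma alt_smul_aux' {b : Φ.Base} {i j : b.support} (x : E) (p r : ℝ) :
    sRefl Φ j • (x + p • Φ.root i + r • Φ.root j) =
      x + p • Φ.root i + (-(Φ.toLinearMap x (Φ.coroot j) + r + p * Φ.pairingIn ℤ i j)) •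
        Φ.root j := by
  rw [add_right_comm, alt_smul_aux, add_right_comm]

/-- The pairing numbers of two simple roots determine the order of the product of the
corresponding reflections. -/
lemma orderOf_cases {b : Φ.Base} {i j : b.support} (h : i ≠ j) :
    (Φ.pairingIn ℤ i j = 0 ∧ Φ.pairingIn ℤ j i = 0 ∧ orderOf (sRefl Φ i * sRefl Φ j) = 2) ∨
    (Φ.pairingIn ℤ i j = -1 ∧ Φ.pairingIn ℤ j i = -1 ∧ orderOf (sRefl Φ i * sRefl Φ j) = 3) ∨
    (Φ.pairingIn ℤ i j = -1 ∧ Φ.pairingIn ℤ j i = -2 ∧ orderOf (sRefl Φ i * sRefl Φ j) = 4) ∨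
    (Φ.pairingIn ℤ i j = -2 ∧ Φ.pairingIn ℤ j i = -1 ∧ orderOf (sRefl Φ i * sRefl Φ j) = 4) ∨
    (Φ.pairingIn ℤ i j = -1 ∧ Φ.pairingIn ℤ j i = -3 ∧ orderOf (sRefl Φ i * sRefl Φ j) = 6) ∨
    (Φ.pairingIn ℤ i j = -3 ∧ Φ.pairingIn ℤ j i = -1 ∧ orderOf (sRefl Φ i * sRefl Φ j) = 6) := by
  have hx : ∀ x : E, x = x + (0 : ℝ) • Φ.root i + (0 : ℝ) • Φ.root j := by intro x; simp
  have hstep : ∀ (x : E) (p r : ℝ), (sRefl Φ i * sRefl Φ j) •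
      (x + p • Φ.root i + r • Φ.root j) = x + (-(Φ.toLinearMap x (Φ.coroot i) + p +
        (-(Φ.toLinearMap x (Φ.coroot j) + r + p * Φ.pairingIn ℤ i j)) * Φ.pairingIn ℤ j i)) •
          Φ.root i + (-(Φ.toLinearMap x (Φ.coroot j) + r + p * Φ.pairingIn ℤ i j)) • Φ.root j := by
    intro x p r
    rw [mul_smul, alt_smul_aux', alt_smul_aux]
  have hone : ∀ (x : E) (p r : ℝ), p = 0 → r = 0 → x + p • Φ.root i + r • Φ.root j = x := by
    rintro x p r rfl rfl; exact (hx x).symm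
  -- Linear independence of the two simple roots turns a nonzero displacement of α_i into w ≠ 1.
  have hne : ∀ (w : Φ.weylGroup) (p r : ℝ), (p ≠ 0 ∨ r ≠ 0) →
      w • Φ.root i = Φ.root i + p • Φ.root i + r • Φ.root j → w ≠ 1 := by
    rintro w p r hpr hw rfl
    rw [one_smul, add_assoc, left_eq_add] at hw
    have := pair_eq_zero h hw
    tauto
  have hp : ∀ (g : Φ.weylGroup) (n : ℕ) (x : E), g ^ (n + 1) • x = g ^ n • (g • x) := by
    intro g n x; rw [pow_succ, mul_smul]
  rcases base_pairing_cases h with ⟨h1, h2⟩ | ⟨h1, h2⟩ | ⟨h1, h2⟩ | ⟨h1, h2⟩ | ⟨h1, h2⟩ | ⟨h1, h2⟩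
  all_goals simp only [h1, h2] at hstep
  · refine Or.inl ⟨h1, h2, ?_⟩
    refine orderOf_eq_prime (p := 2) ?_ ?_
    · refine weyl_ext fun x => ?_
      conv_lhs => rw [hx x]
      simp only [hp _ _ (_ + _), hstep, pow_zero, one_smul]
      apply hone <;> push_cast <;> ring
    · rw [← pow_one (_ * _)]
      -- The element acts as -1 on the plane, so α_i moves by -2α_i; the same displacement serves
      -- (s_i s_j)^{m/2} for m = 4 and m = 6 below.
      refine hne _ (-2) 0 (by norm_num) ?_
      conv_lhs => rw [hx (Φ.root i)]
      simp only [hp _ _ (_ + _), hstep, pow_zero, one_smul, toLinearMap_root_coroot, h1,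
        RootPairing.pairingIn_same]
      norm_num
  · refine Or.inr (Or.inl ⟨h1, h2, ?_⟩)
    refine orderOf_eq_prime (p := 3) ?_ ?_
    · refine weyl_ext fun x => ?_
      conv_lhs => rw [hx x]
      simp only [hp _ _ (_ + _), hstep, pow_zero, one_smul]
      apply hone <;> push_cast <;> ring
    · rw [← pow_one (_ * _)]
      -- Here s_i s_j maps α_i to α_j.
      refine hne _ (-1) 1 (by norm_num) ?_
      conv_lhs => rw [hx (Φ.root i)]
      simp only [hp _ _ (_ + _), hstep, pow_zero, one_smul, toLinearMap_root_coroot, h1,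
        RootPairing.pairingIn_same]
      norm_num
  · refine Or.inr (Or.inr (Or.inl ⟨h1, h2, ?_⟩))
    rw [show (4 : ℕ) = 2 ^ (1 + 1) by norm_num]
    refine orderOf_eq_prime_pow ?_ ?_
    · rw [pow_one]
      refine hne _ (-2) 0 (by norm_num) ?_
      conv_lhs => rw [hx (Φ.root i)]
      simp only [hp _ _ (_ + _), hstep, pow_zero, one_smul, toLinearMap_root_coroot, h1,
        RootPairing.pairingIn_same]
      norm_num
    · rw [show (2 : ℕ) ^ (1 + 1) = 4 by norm_num]
      refine weyl_ext fun x => ?_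
      conv_lhs => rw [hx x]
      simp only [hp _ _ (_ + _), hstep, pow_zero, one_smul]
      apply hone <;> push_cast <;> ring
  · refine Or.inr (Or.inr (Or.inr (Or.inl ⟨h1, h2, ?_⟩)))
    rw [show (4 : ℕ) = 2 ^ (1 + 1) by norm_num]
    refine orderOf_eq_prime_pow ?_ ?_
    · rw [pow_one]
      refine hne _ (-2) 0 (by norm_num) ?_
      conv_lhs => rw [hx (Φ.root i)]
      simp only [hp _ _ (_ + _), hstep, pow_zero, one_smul, toLinearMap_root_coroot, h1,
        RootPairing.pairingIn_same]
      norm_num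
    · rw [show (2 : ℕ) ^ (1 + 1) = 4 by norm_num]
      refine weyl_ext fun x => ?_
      conv_lhs => rw [hx x]
      simp only [hp _ _ (_ + _), hstep, pow_zero, one_smul]
      apply hone <;> push_cast <;> ring
  · refine Or.inr (Or.inr (Or.inr (Or.inr (Or.inl ⟨h1, h2, ?_⟩))))
    refine orderOf_eq_of_pow_and_pow_div_prime (by norm_num) ?_ ?_
    · refine weyl_ext fun x => ?_
      conv_lhs => rw [hx x]
      simp only [hp _ _ (_ + _), hstep, pow_zero, one_smul]
      apply hone <;> push_cast <;> ring
    · intro p hp0 hp1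
      have hp6 := Nat.le_of_dvd (by norm_num) hp1
      have hp23 : p = 2 ∨ p = 3 := by
        interval_cases p <;> revert hp0 hp1 <;> decide
      rcases hp23 with rfl | rfl
      · rw [show 6 / 2 = 3 by norm_num]
        refine hne _ (-2) 0 (by norm_num) ?_
        conv_lhs => rw [hx (Φ.root i)]
        simp only [hp _ _ (_ + _), hstep, pow_zero, one_smul, toLinearMap_root_coroot, h1,
          RootPairing.pairingIn_same]
        norm_num
      · rw [show 6 / 3 = 2 by norm_num]
        refine hne _ (0) 1 (by norm_num) ?_
        conv_lhs => rw [hx (Φ.root i)]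
        simp only [hp _ _ (_ + _), hstep, pow_zero, one_smul, toLinearMap_root_coroot, h1,
          RootPairing.pairingIn_same]
        norm_num
  · refine Or.inr (Or.inr (Or.inr (Or.inr (Or.inr (⟨h1, h2, ?_⟩)))))
    refine orderOf_eq_of_pow_and_pow_div_prime (by norm_num) ?_ ?_
    · refine weyl_ext fun x => ?_
      conv_lhs => rw [hx x]
      simp only [hp _ _ (_ + _), hstep, pow_zero, one_smul]
      apply hone <;> push_cast <;> ring
    · intro p hp0 hp1
      have hp6 := Nat.le_of_dvd (by norm_num) hp1
      have hp23 : p = 2 ∨ p = 3 := by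
        interval_cases p <;> revert hp0 hp1 <;> decide
      rcases hp23 with rfl | rfl
      · rw [show 6 / 2 = 3 by norm_num]
        refine hne _ (-2) 0 (by norm_num) ?_
        conv_lhs => rw [hx (Φ.root i)]
        simp only [hp _ _ (_ + _), hstep, pow_zero, one_smul, toLinearMap_root_coroot, h1,
          RootPairing.pairingIn_same]
        norm_num
      · rw [show 6 / 3 = 2 by norm_num]
        refine hne _ (0) 3 (by norm_num) ?_
        conv_lhs => rw [hx (Φ.root i)]
        simp only [hp _ _ (_ + _), hstep, pow_zero, one_smul, toLinearMap_root_coroot, h1,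
          RootPairing.pairingIn_same]
        norm_num

end WeylGroup

end

/-! ### The Weyl group as a Coxeter group: exchange property and Matsumoto's theorem. -/

section

/-- For involutions, (ab)ⁿ is exactly the discrepancy between the two alternating words of length n.
-/
lemma altProd_eq_pow_mul {G : Type*} [Group G] {a b : G} (ha : a * a = 1) (hb : b * b = 1)
    (n : ℕ) : altProd a b n = (a * b) ^ n * altProd b a n := by
  induction n with
  | zero => simp [altProd]
  | succ n ih =>
    have h1 : a * (a * b) ^ n = ((a * b) ^ n)⁻¹ * a := by
      have e : a * (a * b) * a⁻¹ = (a * b)⁻¹ := by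
        rw [mul_inv_rev, inv_eq_of_mul_eq_one_left ha, inv_eq_of_mul_eq_one_left hb, ← mul_assoc,
          ha, one_mul]
      have := conj_pow (i := n) (a := a) (b := a * b)
      rw [e, inv_pow] at this
      rw [this, inv_mul_cancel_right]
    have h2 : b * (b * altProd b a n) = altProd b a n := by rw [← mul_assoc, hb, one_mul]
    have e1 : altProd a b (n + 1) = a * altProd b a n := rfl
    have e2 : altProd b a (n + 1) = b * altProd a b n := rfl
    rw [e1, e2, pow_succ, mul_assoc, mul_assoc, ← mul_assoc b b, hb, one_mul, ih, ← mul_assoc a,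
      h1, mul_assoc, mul_inv_cancel_left]

lemma altProd_comm_of_pow {G : Type*} [Group G] {a b : G} (ha : a * a = 1) (hb : b * b = 1)
    {n : ℕ} (h : (a * b) ^ n = 1) : altProd a b n = altProd b a n := by
  rw [altProd_eq_pow_mul ha hb, h, one_mul]

/-- The alternating word `a, b, a, …` with `n` letters. -/
def altList {X : Type*} (a b : X) : ℕ → List X
  | 0 => []
  | n + 1 => a :: altList b a n

lemma length_altList {X : Type*} (a b : X) (n : ℕ) : (altList a b n).length = n := by
  induction n generalizing a b with
  | zero => rfl
  | succ n ih => simp [altList, ih]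

lemma prod_map_altList {X M : Type*} [Monoid M] (f : X → M) (a b : X) (n : ℕ) :
    ((altList a b n).map f).prod = altProd (f a) (f b) n := by
  induction n generalizing a b with
  | zero => rfl
  | succ n ih => simp [altList, altProd, ih]

lemma altList_succ' {X : Type*} (a b : X) (n : ℕ) :
    altList a b (n + 1) = altList a b n ++ [if Even n then a else b] := by
  induction n generalizing a b with
  | zero => rfl
  | succ n ih =>
    have e : altList a b (n + 1 + 1) = a :: altList b a (n + 1) := rfl
    rw [e, ih]
    simp only [altList, Nat.even_add_one, List.cons_append]
    by_cases h : Even n <;> simp [h]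

section WeylGroup

variable {ι E : Type*} [NormedAddCommGroup E] [InnerProductSpace ℝ E] {Φ : RootPairing ι ℝ E E}
variable [Finite ι] [Φ.IsRootSystem] [Φ.IsCrystallographic] [Φ.IsReduced] (b : Φ.Base)

/-- The height as a linear functional. -/
def heightLin : E →ₗ[ℝ] ℝ := b.toWeightBasis.constr ℝ fun _ => (1 : ℝ)

lemma heightLin_root (i : ι) : heightLin b (Φ.root i) = b.height i := by
  obtain ⟨f, -, -, hf⟩ := b.exists_root_eq_sum_int i
  rw [RootPairing.Base.height_eq_sum hf, hf, map_sum, Int.cast_sum]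
  refine Finset.sum_congr rfl fun j hj => ?_
  have h : heightLin b (Φ.root j) = 1 := by
    have := b.toWeightBasis.constr_basis ℝ (fun _ => (1 : ℝ)) ⟨j, hj⟩
    rwa [RootPairing.Base.toWeightBasis_apply] at this
  rw [map_zsmul, h]
  simp

lemma isPos_iff_heightLin (i : ι) : b.IsPos i ↔ 0 < heightLin b (Φ.root i) := by
  rw [heightLin_root]; exact_mod_cast Iff.rfl

lemma not_isPos_iff_heightLin (i : ι) : ¬ b.IsPos i ↔ heightLin b (Φ.root i) < 0 := by
  rw [isPos_iff_heightLin, heightLin_root]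
  have := b.height_ne_zero i
  norm_cast
  omega

-- The geometric form of the fact that an alternating word shorter than the longest one gets longer
-- when its next letter is appended. It is read off case by case from the Cartan integers.
variable {b} in
lemma alt_smul_root {i j : b.support} (h : i ≠ j) {k : ℕ}
    (hk : k < orderOf (sRefl Φ i * sRefl Φ j)) : ∃ p r : ℝ, 0 ≤ p ∧ 0 ≤ r ∧
      altProd (sRefl Φ i) (sRefl Φ j) k • Φ.root ((if Even k then i else j : b.support) : ι) =
        p • Φ.root i + r • Φ.root j := by
  have e1 : ∀ p r : ℝ, sRefl Φ i • (p • Φ.root i + r • Φ.root j) =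
      (-p - r * Φ.pairingIn ℤ j i) • Φ.root i + r • Φ.root j := by
    intro p r
    have := alt_smul_aux (i := i) (j := j) 0 p r
    simp only [zero_add, map_zero, LinearMap.zero_apply] at this
    rw [this]; congr 2; ring
  have e2 : ∀ p r : ℝ, sRefl Φ j • (p • Φ.root i + r • Φ.root j) =
      p • Φ.root i + (-r - p * Φ.pairingIn ℤ i j) • Φ.root j := by
    intro p r
    have := alt_smul_aux' (i := i) (j := j) 0 p r
    simp only [zero_add, map_zero, LinearMap.zero_apply] at this
    rw [this]; congr 2; ring
  have r1 : Φ.root i = (1 : ℝ) • Φ.root i + (0 : ℝ) • Φ.root j := by simp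
  have r2 : Φ.root j = (0 : ℝ) • Φ.root i + (1 : ℝ) • Φ.root j := by simp
  suffices hs : ∃ p r : ℝ, 0 ≤ p ∧ 0 ≤ r ∧
      altProd (sRefl Φ i) (sRefl Φ j) k • ((if Even k then 1 else 0 : ℝ) • Φ.root i +
        (if Even k then 0 else 1 : ℝ) • Φ.root j) = p • Φ.root i + r • Φ.root j by
    convert hs using 7
    by_cases hk : Even k
    · simp [hk]
    · simp [hk]
  rcases orderOf_cases h with ⟨h1, h2, h3⟩ | ⟨h1, h2, h3⟩ | ⟨h1, h2, h3⟩ | ⟨h1, h2, h3⟩ |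
    ⟨h1, h2, h3⟩ | ⟨h1, h2, h3⟩
  all_goals
    rw [h3] at hk
    simp only [h1, h2] at e1 e2
    interval_cases k
  all_goals
    refine ⟨_, _, ?_, ?_, by
      simp only [altProd, mul_smul, one_smul, e1, e2]; rfl⟩ <;> norm_num

/-- The product in the Weyl group of a word in the simple reflections. -/
abbrev wordProd (ω : List b.support) : Φ.weylGroup := (ω.map fun i : b.support => sRefl Φ (i : ι)).prod

variable {b} in
lemma sRefl_braid {i j : b.support} :
    altProd (sRefl Φ i) (sRefl Φ j) (orderOf (sRefl Φ i * sRefl Φ j)) =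
      altProd (sRefl Φ j) (sRefl Φ i) (orderOf (sRefl Φ i * sRefl Φ j)) :=
  altProd_comm_of_pow (sRefl_mul_self _) (sRefl_mul_self _) (pow_orderOf_eq_one _)

/-- The exchange property. -/
lemma exists_shorter_word (ω : List b.support) (β : ι) (hβ : b.IsPos β)
    (hn : ¬ b.IsPos ((wordProd b ω)⁻¹ • β)) :
    ∃ ω' : List b.support, ω'.length + 1 = ω.length ∧
      wordProd b ω' = sRefl Φ β * wordProd b ω := by
  induction ω generalizing β with
  | nil => exact absurd (by simpa [wordProd] using hβ) hn
  | cons i ω ih =>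
    have hw : wordProd b (i :: ω) = sRefl Φ i * wordProd b ω := by simp [wordProd]
    -- s_i permutes the positive roots other than α_i. Either β = α_i and the first letter cancels,
    -- or s_i β is positive and the letter to delete lies in the tail.
    by_cases hi : β = i
    · subst hi
      refine ⟨ω, by simp, ?_⟩
      rw [hw, ← mul_assoc, sRefl_mul_self, one_mul]
    · have h1 : b.IsPos (sRefl Φ i • β) := RootPairing.Base.IsPos.reflectionPerm hβ i.2 hi
      obtain ⟨ω', hl, hv⟩ := ih (sRefl Φ i • β) h1 (by
        rw [hw, mul_inv_rev, sRefl_inv, mul_smul] at hn; exact hn)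
      refine ⟨i :: ω', by simp [hl], ?_⟩
      have hw' : wordProd b (i :: ω') = sRefl Φ i * wordProd b ω' := by simp [wordProd]
      rw [hw', hv, hw, sRefl_conj]
      simp only [← mul_assoc, sRefl_mul_self, one_mul]

/-- Every root is obtained from a simple one by simple reflections, and s_{s_j β} = s_j s_β s_j, so
every reflection is a product of simple ones. -/
lemma weylGroup_closure : Submonoid.closure (Set.range fun i : b.support => sRefl Φ i) = ⊤ := by
  set C := Submonoid.closure (Set.range fun i : b.support => sRefl Φ i) with hC
  have h1 : ∀ i : ι, sRefl Φ i ∈ C := by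
    intro i
    refine b.induction_reflect i (p := fun i => sRefl Φ i ∈ C) ?_ ?_ ?_
    · intro i hi
      have := sRefl_conj (Φ := Φ) i i
      rw [sRefl_mul_self, one_mul] at this
      rw [← sRefl_smul_index, this]; exact hi
    · intro i hi
      exact Submonoid.subset_closure ⟨⟨i, hi⟩, rfl⟩
    · intro i j hi hj
      have hj' : sRefl Φ j ∈ C := Submonoid.subset_closure ⟨⟨j, hj⟩, rfl⟩
      rw [← sRefl_smul_index, sRefl_conj]
      exact C.mul_mem (C.mul_mem hj' hi) hj'
  rw [eq_top_iff]
  rintro ⟨w, hw⟩ -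
  induction hw using RootPairing.weylGroup.induction with
  | mem i => exact h1 i
  | one => exact C.one_mem
  | mul x y hx hy ihx ihy => exact C.mul_mem ihx ihy

lemma exists_word (w : Φ.weylGroup) : ∃ ω : List b.support, wordProd b ω = w := by
  have hw : w ∈ Submonoid.closure (Set.range fun i : b.support => sRefl Φ i) := by
    rw [weylGroup_closure]; trivial
  induction hw using Submonoid.closure_induction with
  | mem x hx => obtain ⟨i, rfl⟩ := hx; exact ⟨[i], by simp [wordProd]⟩
  | one => exact ⟨[], rfl⟩
  | mul x y _ _ hx hy =>
    obtain ⟨ω, rfl⟩ := hx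
    obtain ⟨ω', rfl⟩ := hy
    exact ⟨ω ++ ω', by simp [wordProd]⟩

/-- A word of minimal length among the words with the same product. -/
def IsReducedWord (ω : List b.support) : Prop :=
  ∀ ω' : List b.support, wordProd b ω' = wordProd b ω → ω.length ≤ ω'.length

variable {b}

lemma IsReducedWord.tail {i : b.support} {ω : List b.support} (h : IsReducedWord b (i :: ω)) :
    IsReducedWord b ω := by
  intro ω' hω'
  have := h (i :: ω') (by simp only [wordProd, List.map_cons, List.prod_cons] at hω' ⊢; rw [hω'])
  simpa using this

/-- Otherwise the inverse of the tail would make α_i negative, and the exchange property would give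
a word for the same element that is shorter by two. -/
lemma IsReducedWord.descent {i : b.support} {ω : List b.support} (h : IsReducedWord b (i :: ω)) :
    ¬ b.IsPos ((wordProd b (i :: ω))⁻¹ • (i : ι)) := by
  intro hp
  have hw : wordProd b (i :: ω) = sRefl Φ i * wordProd b ω := by simp [wordProd]
  have hn : ¬ b.IsPos ((wordProd b ω)⁻¹ • (i : ι)) := by
    rw [isPos_iff_heightLin, ← weyl_smul_root, hw, mul_inv_rev, sRefl_inv, mul_smul, sRefl_smul,
      toLinearMap_root_coroot, RootPairing.pairingIn_same] at hp
    rw [not_isPos_iff_heightLin, ← weyl_smul_root]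
    have e : Φ.root (i : ι) - ((2 : ℤ) : ℝ) • Φ.root i = (-1 : ℝ) • Φ.root i := by
      push_cast; module
    rw [e, weyl_smul_smul, LinearMap.map_smul] at hp
    simp only [smul_eq_mul] at hp
    linarith
  obtain ⟨ω', hl, hv⟩ := exists_shorter_word b ω i (b.isPos_of_mem_support i.2) hn
  have := h ω' (by rw [hv, hw])
  simp at this
  omega

/-- If `i` and `j` are descents of `w`, then `w` has reduced words which start with the longest
word in `i`, `j`. -/
lemma exists_alt_word {i j : b.support} (hij : i ≠ j) {ω : List b.support}
    (hi : ¬ b.IsPos ((wordProd b ω)⁻¹ • (i : ι))) (hj : ¬ b.IsPos ((wordProd b ω)⁻¹ • (j : ι)))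
    (k : ℕ) (hk : k ≤ orderOf (sRefl Φ i * sRefl Φ j)) :
    ∃ ω' : List b.support, wordProd b (altList i j k ++ ω') = wordProd b ω ∧
      ω'.length + k = ω.length := by
  induction k with
  | zero => exact ⟨ω, by simp [altList], rfl⟩
  | succ k ih =>
    obtain ⟨ω', hv, hl⟩ := ih (by omega)
    obtain ⟨p, r, hp, hr, hpr⟩ := alt_smul_root hij (k := k) (by omega)
    have hv' : altProd (sRefl Φ i) (sRefl Φ j) k * wordProd b ω' = wordProd b ω := by
      rw [← hv, wordProd, wordProd, List.map_append, List.prod_append,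
        prod_map_altList (fun i : b.support => sRefl Φ (i : ι))]
    set l : b.support := if Even k then i else j with hl'
    have hneg : ¬ b.IsPos ((wordProd b ω')⁻¹ • (l : ι)) := by
      have e : (wordProd b ω')⁻¹ = (wordProd b ω)⁻¹ * altProd (sRefl Φ i) (sRefl Φ j) k := by
        rw [← hv']; group
      rw [not_isPos_iff_heightLin] at hi hj
      rw [← weyl_smul_root] at hi hj
      -- The next letter is again a descent of what remains: its root is pulled back to w⁻¹ of a
      -- nonnegative combination of α_i and α_j, and w⁻¹ makes both of these negative.
      have hle : heightLin b (Φ.root ((wordProd b ω')⁻¹ • (l : ι))) ≤ 0 := by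
        rw [← weyl_smul_root, e, mul_smul, hpr, smul_add, weyl_smul_smul, weyl_smul_smul, map_add,
          LinearMap.map_smul, LinearMap.map_smul]
        simp only [smul_eq_mul]
        nlinarith
      rw [isPos_iff_heightLin]
      exact not_lt.2 hle
    obtain ⟨ω'', hl2, hv2⟩ := exists_shorter_word b ω' l (b.isPos_of_mem_support l.2) hneg
    refine ⟨ω'', ?_, by omega⟩
    rw [altList_succ', ← hl', List.append_assoc, List.singleton_append, ← hv]
    have e : wordProd b (l :: ω'') = wordProd b ω' := by
      have : wordProd b (l :: ω'') = sRefl Φ l * wordProd b ω'' := by simp [wordProd]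
      rw [this, hv2, ← mul_assoc, sRefl_mul_self, one_mul]
    simp only [wordProd, List.map_append, List.prod_append] at e ⊢
    rw [e]

variable {M : Type*} [Monoid M] {S : b.support → M}

/-- Matsumoto's theorem. -/
lemma prod_eq_of_reduced (hbraid : ∀ i j : b.support, i ≠ j →
      altProd (S i) (S j) (orderOf (sRefl Φ i * sRefl Φ j)) =
        altProd (S j) (S i) (orderOf (sRefl Φ i * sRefl Φ j)))
    (n : ℕ) (ω ω' : List b.support) (hn : ω.length = n) (h : IsReducedWord b ω)
    (h' : IsReducedWord b ω') (e : wordProd b ω = wordProd b ω') :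
    (ω.map S).prod = (ω'.map S).prod := by
  have hlen : ω.length = ω'.length := le_antisymm (h ω' e.symm) (h' ω e)
  induction n generalizing ω ω' with
  | zero =>
    rw [hn] at hlen
    rw [List.length_eq_zero_iff.1 hn, List.length_eq_zero_iff.1 hlen.symm]
  | succ n ih =>
    obtain ⟨i, u, rfl⟩ : ∃ i u, ω = i :: u := List.exists_cons_of_length_eq_add_one hn
    obtain ⟨j, u', rfl⟩ : ∃ i u, ω' = i :: u :=
      List.exists_cons_of_length_eq_add_one (hlen ▸ hn)
    -- Two reduced words with the same first letter are compared through their tails, by induction.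
    have same : ∀ (i : b.support) (u v : List b.support), u.length = n →
        IsReducedWord b (i :: u) → IsReducedWord b (i :: v) →
        wordProd b (i :: u) = wordProd b (i :: v) →
        ((i :: u).map S).prod = ((i :: v).map S).prod := by
      intro i u v hu h1 h2 e
      have e' : wordProd b u = wordProd b v := by
        simpa only [wordProd, List.map_cons, List.prod_cons, mul_right_inj] using e
      have hl : u.length = v.length := le_antisymm (h1.tail v e'.symm) (h2.tail u e')
      rw [List.map_cons, List.map_cons, List.prod_cons, List.prod_cons,
        ih u v hu h1.tail h2.tail e' hl]
    have hu : u.length = n := by simpa using hn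
    have hu' : u'.length = n := by simpa using hlen.symm.trans hn
    by_cases hij : i = j
    · subst hij
      exact same i u u' hu h h' e
    · set m := orderOf (sRefl Φ i * sRefl Φ j) with hm
      -- Both i and j are descents, so the element has reduced words starting with either spelling
      -- of the longest word in i, j, followed by the same `z`. These two words form the bridge:
      -- each shares its first letter with one of the given words, and they differ by one braid
      -- relation.
      obtain ⟨z, hz, hzl⟩ := exists_alt_word hij h.descent (e ▸ h'.descent) m le_rfl
      have hm0 : m ≠ 0 := by
        rcases orderOf_cases hij with ⟨-, -, h3⟩ | ⟨-, -, h3⟩ | ⟨-, -, h3⟩ | ⟨-, -, h3⟩ |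
          ⟨-, -, h3⟩ | ⟨-, -, h3⟩ <;> omega
      obtain ⟨k, hk⟩ := Nat.exists_eq_succ_of_ne_zero hm0
      have hz' : wordProd b (altList j i m ++ z) = wordProd b (i :: u) := by
        rw [← hz]
        simp only [wordProd, List.map_append, List.prod_append,
          prod_map_altList (fun i : b.support => sRefl Φ (i : ι))]
        rw [hm, sRefl_braid]
      have red : ∀ v : List b.support, wordProd b v = wordProd b (i :: u) →
          v.length = (i :: u).length → IsReducedWord b v := by
        intro v hv hl t ht
        rw [hl]; exact h t (ht.trans hv)
      have l1 : (altList i j m ++ z).length = (i :: u).length := by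
        rw [List.length_append, length_altList]; omega
      have l2 : (altList j i m ++ z).length = (i :: u).length := by
        rw [List.length_append, length_altList]; omega
      have c1 : altList i j m ++ z = i :: (altList j i k ++ z) := by rw [hk]; rfl
      have c2 : altList j i m ++ z = j :: (altList i j k ++ z) := by rw [hk]; rfl
      have p1 : ((i :: u).map S).prod = ((altList i j m ++ z).map S).prod := by
        have := red _ hz l1
        rw [c1] at this hz ⊢
        exact same i _ _ hu h this hz.symm
      have p2 : ((j :: u').map S).prod = ((altList j i m ++ z).map S).prod := by
        have := red _ hz' l2
        rw [c2] at this hz' ⊢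
        exact same j _ _ hu' h' this (e.symm.trans hz'.symm)
      rw [p1, p2, List.map_append, List.map_append, List.prod_append, List.prod_append,
        prod_map_altList, prod_map_altList, hm, hbraid i j hij]

/-- The Weyl group is the Coxeter group on the simple reflections. -/
theorem exists_weyl_lift (hsq : ∀ i, S i * S i = 1) (hbraid : ∀ i j : b.support, i ≠ j →
      altProd (S i) (S j) (orderOf (sRefl Φ i * sRefl Φ j)) =
        altProd (S j) (S i) (orderOf (sRefl Φ i * sRefl Φ j))) :
    ∃ f : Φ.weylGroup →* M, ∀ i : b.support, f (sRefl Φ i) = S i := by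
  classical
  have hex : ∀ w : Φ.weylGroup, ∃ ω : List b.support, IsReducedWord b ω ∧ wordProd b ω = w := by
    intro w
    have hne : ∃ n, ∃ ω : List b.support, wordProd b ω = w ∧ ω.length = n := by
      obtain ⟨ω, hω⟩ := exists_word b w
      exact ⟨_, ω, hω, rfl⟩
    obtain ⟨ω, h1, h2⟩ := Nat.find_spec hne
    refine ⟨ω, fun ω' h' => ?_, h1⟩
    rw [h2]
    exact Nat.find_min' hne ⟨ω', h'.trans h1, rfl⟩
  choose red hred hval using hex
  set F : Φ.weylGroup → M := fun w => ((red w).map S).prod with hF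
  have hFω : ∀ ω : List b.support, IsReducedWord b ω → F (wordProd b ω) = (ω.map S).prod :=
    fun ω h => prod_eq_of_reduced hbraid _ _ _ rfl (hred _) h (hval _)
  have hone : F 1 = 1 := hFω [] (fun _ _ => Nat.zero_le _)
  -- If i is not a descent of w, then prepending i to a reduced word of w stays reduced: from a
  -- shorter word for s_i w, the exchange property would extract a word for w shorter than the
  -- reduced one.
  have hup : ∀ (i : b.support) (w : Φ.weylGroup), b.IsPos (w⁻¹ • (i : ι)) →
      F (sRefl Φ i * w) = S i * F w := by
    intro i w hw
    have hv : wordProd b (i :: red w) = sRefl Φ i * w := by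
      rw [wordProd, List.map_cons, List.prod_cons]
      exact congrArg _ (hval w)
    have hr : IsReducedWord b (i :: red w) := by
      by_contra hnr
      simp only [IsReducedWord, not_forall, not_le] at hnr
      obtain ⟨ω', h1, h2⟩ := hnr
      have hneg : ¬ b.IsPos ((wordProd b ω')⁻¹ • (i : ι)) := by
        rw [isPos_iff_heightLin, ← weyl_smul_root] at hw
        rw [not_isPos_iff_heightLin, ← weyl_smul_root, h1, hv, mul_inv_rev, sRefl_inv, mul_smul,
          sRefl_smul, toLinearMap_root_coroot, RootPairing.pairingIn_same]
        have e : Φ.root (i : ι) - ((2 : ℤ) : ℝ) • Φ.root i = (-1 : ℝ) • Φ.root i := by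
          push_cast; module
        rw [e, weyl_smul_smul, LinearMap.map_smul]
        simp only [smul_eq_mul]
        linarith
      obtain ⟨ω'', h3, h4⟩ := exists_shorter_word b ω' i (b.isPos_of_mem_support i.2) hneg
      have h5 := hred w ω'' (by
        rw [h4, h1, hv, ← mul_assoc, sRefl_mul_self, one_mul, hval])
      simp at h2
      omega
    rw [← hv, hFω _ hr, List.map_cons, List.prod_cons]
  have hmul : ∀ (i : b.support) (w : Φ.weylGroup), F (sRefl Φ i * w) = S i * F w := by
    intro i w
    by_cases hw : b.IsPos (w⁻¹ • (i : ι))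
    · exact hup i w hw
    -- If i is a descent of w, it is not one of s_i w; the previous case applies there, and S_i² = 1
    -- returns to w.
    · have h1 : b.IsPos ((sRefl Φ i * w)⁻¹ • (i : ι)) := by
        rw [not_isPos_iff_heightLin, ← weyl_smul_root] at hw
        rw [isPos_iff_heightLin, ← weyl_smul_root, mul_inv_rev, sRefl_inv, mul_smul,
          sRefl_smul, toLinearMap_root_coroot, RootPairing.pairingIn_same]
        have e : Φ.root (i : ι) - ((2 : ℤ) : ℝ) • Φ.root i = (-1 : ℝ) • Φ.root i := by
          push_cast; module
        rw [e, weyl_smul_smul, LinearMap.map_smul]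
        simp only [smul_eq_mul]
        linarith
      have h2 := hup i _ h1
      rw [← mul_assoc, sRefl_mul_self, one_mul] at h2
      rw [h2, ← mul_assoc, hsq, one_mul]
  refine ⟨⟨⟨F, hone⟩, ?_⟩, ?_⟩
  · intro x y
    obtain ⟨ω, rfl⟩ := exists_word b x
    change F (wordProd b ω * y) = F (wordProd b ω) * F y
    induction ω with
    | nil => simp [wordProd, hone]
    | cons i ω ih =>
      have : wordProd b (i :: ω) = sRefl Φ i * wordProd b ω := by simp [wordProd]
      rw [this, mul_assoc, hmul, hmul, ih, mul_assoc]
  · intro i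
    have := hmul i 1
    rw [mul_one, hone, mul_one] at this
    exact this

end WeylGroup

end

/-! ### Monomials, the simple roots of Φ^m, and the universal property of W ⋉ ℂ(P^m). -/

section

variable {ι E : Type*} [NormedAddCommGroup E] [InnerProductSpace ℝ E]

section Mono

variable {L : AddSubgroup E}

@[simp] lemma mono_zero : mono (0 : L) = 1 := by
  rw [mono, monoP, ← AddMonoidAlgebra.one_def, map_one]

lemma mono_add (x y : L) : mono (x + y) = mono x * mono y := by
  rw [mono, monoP_add, map_mul]; rfl

lemma mono_ne_zero (x : L) : mono x ≠ 0 := by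
  intro h
  have := mono_add x (-x)
  rw [h, zero_mul, add_neg_cancel, mono_zero] at this
  exact one_ne_zero this

lemma mono_neg (x : L) : mono (-x) = (mono x)⁻¹ :=
  eq_inv_of_mul_eq_one_left (by rw [← mono_add, neg_add_cancel, mono_zero])

lemma mono_sub (x y : L) : mono (x - y) = mono x / mono y := by
  rw [sub_eq_add_neg, mono_add, mono_neg, div_eq_mul_inv]

lemma mono_nsmul (n : ℕ) (x : L) : mono (n • x) = mono x ^ n := by
  induction n with
  | zero => simp
  | succ n ih => rw [succ_nsmul, mono_add, ih, pow_succ]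

lemma mono_zsmul (n : ℤ) (x : L) : mono (n • x) = mono x ^ n := by
  obtain ⟨k, rfl | rfl⟩ := n.eq_nat_or_neg
  · rw [natCast_zsmul, mono_nsmul, zpow_natCast]
  · rw [neg_smul, mono_neg, natCast_zsmul, mono_nsmul, zpow_neg, zpow_natCast]

lemma algebraMap_sub_mono_ne_zero (c : ℂ) {x : L} (hx : x ≠ 0) :
    algebraMap ℂ (RatFun L) c - mono x ≠ 0 := by
  intro h
  rw [sub_eq_zero, IsScalarTower.algebraMap_apply ℂ (GrpAlg L) (RatFun L)] at h
  have h1 := IsFractionRing.injective (GrpAlg L) (RatFun L) h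
  rw [monoP, Algebra.algebraMap_eq_smul_one, AddMonoidAlgebra.one_def,
    AddMonoidAlgebra.smul_single] at h1
  have h2 := congrArg (fun f : GrpAlg L => f.coeff x) h1
  simp [hx.symm] at h2

lemma one_sub_mono_ne_zero {x : L} (hx : x ≠ 0) : 1 - mono x ≠ 0 := by
  simpa using algebraMap_sub_mono_ne_zero 1 hx

lemma one_sub_mul_mono_ne_zero (c : ℂ) {x : L} (hx : x ≠ 0) :
    1 - algebraMap ℂ (RatFun L) c * mono x ≠ 0 := by
  by_cases hc : c = 0
  · simp [hc]
  · intro h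
    apply algebraMap_sub_mono_ne_zero c⁻¹ hx
    have hc' : algebraMap ℂ (RatFun L) c ≠ 0 := by simpa using hc
    apply mul_left_cancel₀ hc'
    rw [mul_zero, ← h, mul_sub, ← map_mul, mul_inv_cancel₀ hc, map_one]

variable {Φ : RootPairing ι ℝ E E} [WeylStable Φ L]

lemma weyl_smul_mono (w : Φ.weylGroup) (x : L) : w • mono x = mono (w • x) := by
  rw [mono, weyl_smul_algebraMap, monoP, weyl_smul_single]; rfl

/-- The automorphism of `ℂ(L)` given by an element of the Weyl group. -/
abbrev weylHom (L : AddSubgroup E) [WeylStable Φ L] (w : Φ.weylGroup) : RatFun L →ₐ[ℂ] RatFun L :=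
  MulSemiringAction.toAlgHom ℂ (RatFun L) w

lemma weylHom_apply (w : Φ.weylGroup) (f : RatFun L) : weylHom L w f = w • f := rfl

end Mono

variable {Φ : RootPairing ι ℝ E E}

lemma altProd_smul {R A : Type*} [CommRing R] [Ring A] [Algebra R A] (c d : R) (x y : A) (m : ℕ) :
    altProd (c • x) (d • y) m = altProd c d m • altProd x y m := by
  induction m generalizing c d x y with
  | zero => simp [altProd]
  | succ m ih => simp only [altProd, ih, smul_mul_smul_comm]

section Braid

variable {K F A : Type*} [Field K] [Field F] [Algebra K F] [Ring A] [Algebra K A]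
variable {j : F →ₐ[K] A} {s : F →ₐ[K] F} {S S₁ S₂ T₁ T₂ : A} {m : ℕ}

/-- N is nonzero in a field, so `j N` is invertible and cancels on the right. -/
lemma BraidDefect.braid_iff (h : BraidDefect j S₁ S₂ T₁ T₂ m) :
    altProd T₁ T₂ m = altProd T₂ T₁ m ↔ altProd S₁ S₂ m = altProd S₂ S₁ m := by
  obtain ⟨N, h0, h⟩ := h
  rw [← sub_eq_zero, h, ← sub_eq_zero (a := altProd S₁ S₂ m)]
  constructor
  · intro h1
    have : (altProd S₁ S₂ m - altProd S₂ S₁ m) * j N * j N⁻¹ = 0 := by rw [h1, zero_mul]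
    rwa [mul_assoc, ← map_mul, mul_inv_cancel₀ h0, map_one, mul_one] at this
  · intro h1; rw [h1, zero_mul]

/-- Moving S to the right turns c_{-α} into c_α, and c_α + c_{-α} = 1 + q. This is the form q - c +
cS in which the element is compared with the generators of the Hecke algebra. -/
lemma Implements.dlOp_eq (h : Implements j s S) {q : K} {x : F} (hs : s x = x⁻¹) (h0 : x ≠ 0)
    (h1 : 1 - x ≠ 0) : dlOp j S q x = algebraMap K A q -
      j ((1 - algebraMap K F q * x) / (1 - x)) +
      j ((1 - algebraMap K F q * x) / (1 - x)) * S := by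
  have h1' : x - 1 ≠ 0 := by rwa [← neg_ne_zero, neg_sub]
  have e : s (cNeg (algebraMap K F q) x) = (1 - algebraMap K F q * x) / (1 - x) := by
    rw [map_cNeg, hs, Metaplectic.cNeg_inv h0 h1, cNeg]; field_simp; ring
  have e2 : cNeg (algebraMap K F q) x = algebraMap K F q + 1 -
      (1 - algebraMap K F q * x) / (1 - x) := by rw [cNeg]; field_simp; ring
  rw [dlOp, symOp, add_mul, one_mul, h.comm, e, e2]
  simp only [map_sub, map_add, map_one, AlgHom.commutes]
  abel

end Braid

section MetaRoots

variable [IsEuclidean Φ] [Φ.IsCrystallographic] (D : MetaplecticStructure Φ)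

lemma metaRoot_ne_zero (i : ι) : D.metaRoot i ≠ 0 :=
  smul_ne_zero (by exact_mod_cast (D.m_pos i).ne') (Φ.ne_zero i)

lemma metaRootW_ne_zero (i : ι) : D.metaRootW i ≠ 0 := fun h =>
  metaRoot_ne_zero D i (congrArg Subtype.val h)

lemma coe_metaRootW (i : ι) : ((D.metaRootW i : D.MetaWeightLat) : E) = (D.m i : ℝ) • Φ.root i :=
  rfl

/-- The integer `(λ, α^{m∨})` for `λ ∈ P^m`. -/
def mpair (x : D.MetaWeightLat) (i : ι) : ℤ := (D.mem_metaWeightLat.1 x.2 i).choose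

lemma mpair_spec (x : D.MetaWeightLat) (i : ι) :
    Φ.toLinearMap (x : E) (Φ.coroot i) = D.m i * mpair D x i :=
  (D.mem_metaWeightLat.1 x.2 i).choose_spec

lemma sRefl_smul_metaWeight (x : D.MetaWeightLat) (i : ι) :
    sRefl Φ i • x = x - mpair D x i • D.metaRootW i := by
  apply Subtype.ext
  rw [coe_weyl_smul, sRefl_smul, mpair_spec, AddSubgroup.coe_sub, AddSubgroup.coe_zsmul,
    coe_metaRootW, ← Int.cast_smul_eq_zsmul ℝ, smul_smul, mul_comm]

variable [Finite ι] [Φ.IsRootSystem] [Φ.IsReduced]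

lemma mpair_metaRootW (i j : ι) :
    (D.m j : ℤ) * Φ.pairingIn ℤ j i = D.m i * mpair D (D.metaRootW j) i := by
  have := mpair_spec D (D.metaRootW j) i
  rw [coe_metaRootW, map_smul, LinearMap.smul_apply, toLinearMap_root_coroot, smul_eq_mul] at this
  exact_mod_cast this

lemma mpair_self (i : ι) : mpair D (D.metaRootW i) i = 2 := by
  have := mpair_metaRootW D i i
  rw [RootPairing.pairingIn_same] at this
  exact (mul_left_cancel₀ (by exact_mod_cast (D.m_pos i).ne') this).symm

lemma sRefl_smul_mono_self (i : ι) :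
    sRefl Φ i • mono (D.metaRootW i) = (mono (D.metaRootW i))⁻¹ := by
  rw [weyl_smul_mono, sRefl_smul_metaWeight, mpair_self, ← mono_neg]
  congr 1; module

lemma sRefl_smul_mono (x : D.MetaWeightLat) (i : ι) :
    sRefl Φ i • mono x = mono (D.metaRootW i) ^ (- mpair D x i) * mono x := by
  rw [weyl_smul_mono, sRefl_smul_metaWeight, ← mono_zsmul, ← mono_add]
  congr 1; module

variable {b : Φ.Base} {i j : b.support}

/-- The possible relative positions of two simple roots of `Φ^m`. -/
lemma meta_orderOf_cases (h : i ≠ j) :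
    let p := mpair D (D.metaRootW i) j
    let r := mpair D (D.metaRootW j) i
    let o := orderOf (sRefl Φ i * sRefl Φ j)
    (p = 0 ∧ r = 0 ∧ o = 2) ∨ (p = -1 ∧ r = -1 ∧ o = 3) ∨ (p = -1 ∧ r = -2 ∧ o = 4) ∨
    (p = -2 ∧ r = -1 ∧ o = 4) ∨ (p = -1 ∧ r = -3 ∧ o = 6) ∨ (p = -3 ∧ r = -1 ∧ o = 6) := by
  intro p r o
  have e1 := mpair_metaRootW D j i
  have e2 := mpair_metaRootW D i j
  change _ = _ * p at e1
  change _ = _ * r at e2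
  have m1 : (0 : ℤ) < D.m i := by exact_mod_cast D.m_pos i
  have m2 : (0 : ℤ) < D.m j := by exact_mod_cast D.m_pos j
  -- Rescaling by m(α) may exchange long and short roots, but it preserves the product of the two
  -- Cartan integers. This product together with the signs leaves only the listed pairs, and it also
  -- fixes the order.
  have hp : Φ.pairingIn ℤ i j * Φ.pairingIn ℤ j i = p * r := by
    apply mul_left_cancel₀ (mul_pos m1 m2).ne'
    linear_combination (D.m j * Φ.pairingIn ℤ j i) * e1 + (D.m j * p) * e2
  have neg : ∀ {m₁ m₂ x y : ℤ}, 0 < m₁ → 0 < m₂ → x ≤ 0 → m₁ * x = m₂ * y → y ≤ 0 := by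
    intro m₁ m₂ x y h1 h2 hx hxy
    by_contra hy
    nlinarith
  have hp0 : p ≤ 0 ∧ r ≤ 0 := by
    constructor
    · refine neg m1 m2 ?_ e1
      rcases base_pairing_cases h with h | h | h | h | h | h <;> omega
    · refine neg m2 m1 ?_ e2
      rcases base_pairing_cases h with h | h | h | h | h | h <;> omega
  clear_value p r
  obtain ⟨hp0, hr0⟩ := hp0
  rcases orderOf_cases h with ⟨h1, h2, h3⟩ | ⟨h1, h2, h3⟩ | ⟨h1, h2, h3⟩ | ⟨h1, h2, h3⟩ |
    ⟨h1, h2, h3⟩ | ⟨h1, h2, h3⟩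
  all_goals
    rw [h1, h2] at hp
    rw [h1] at e1
    rw [h2] at e2
  · left
    have z1 : p = 0 := by
      have : (D.m j : ℤ) * p = 0 := by rw [← e1]; ring
      exact (mul_eq_zero.1 this).resolve_left m2.ne'
    have z2 : r = 0 := by
      have : (D.m i : ℤ) * r = 0 := by rw [← e2]; ring
      exact (mul_eq_zero.1 this).resolve_left m1.ne'
    exact ⟨z1, z2, h3⟩
  all_goals
    have hp1 : p ≤ -1 := by
      by_contra hc
      have : p = 0 := by omega
      subst this
      norm_num at hp
    have hr1 : r ≤ -1 := by
      by_contra hc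
      have : r = 0 := by omega
      subst this
      norm_num at hp
    have hp3 : -3 ≤ p := by nlinarith
    have hr3 : -3 ≤ r := by nlinarith
    clear e1 e2
    interval_cases p <;> interval_cases r <;> first | (exfalso; omega) | (simp only [o, h3]; decide)

/-- Simple roots joined by a simple edge are conjugate. -/
lemma exists_weyl_smul_eq (h : i ≠ j) (ho : orderOf (sRefl Φ i * sRefl Φ j) = 3) :
    (sRefl Φ j * sRefl Φ i) • (j : ι) = (i : ι) := by
  have hc : Φ.pairingIn ℤ i j = -1 ∧ Φ.pairingIn ℤ j i = -1 := by
    rcases orderOf_cases h with h | h | h | h | h | h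
    · omega
    · exact ⟨h.1, h.2.1⟩
    all_goals omega
  apply Φ.root.injective
  rw [← weyl_smul_root, mul_smul, sRefl_smul, sRefl_smul]
  simp only [hc.2, map_sub, map_smul, LinearMap.sub_apply, LinearMap.smul_apply, toLinearMap_root_coroot,
    hc.1, RootPairing.pairingIn_same, smul_eq_mul]
  push_cast
  module

lemma val_eq_of_orderOf (k : Multiplicity Φ) (h : i ≠ j)
    (ho : orderOf (sRefl Φ i * sRefl Φ j) = 3) : k.val i = k.val j := by
  rw [← exists_weyl_smul_eq h ho, k.weyl]

lemma metaRootW_generic (h : i ≠ j) :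
    Generic ℂ (mono (D.metaRootW i)) (mono (D.metaRootW j)) := by
  refine ⟨fun a c z hac => ?_⟩
  rw [← mono_nsmul, ← mono_nsmul, ← mono_add]
  refine algebraMap_sub_mono_ne_zero z fun h0 => ?_
  have h1 := congrArg Subtype.val h0
  simp only [AddSubgroup.coe_add, AddSubgroup.coe_nsmul, coe_metaRootW, AddSubgroup.coe_zero] at h1
  have h2 : ((a : ℝ) * D.m i) • Φ.root i + ((c : ℝ) * D.m j) • Φ.root j = 0 := by
    rw [← h1, ← Nat.cast_smul_eq_nsmul ℝ, ← Nat.cast_smul_eq_nsmul ℝ, smul_smul, smul_smul]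
  obtain ⟨h3, h4⟩ := pair_eq_zero h h2
  have m1 := (D.m_pos i).ne'
  have m2 := (D.m_pos j).ne'
  norm_cast at h3 h4
  simp only [mul_eq_zero, m1, m2, or_false] at h3 h4
  omega

/-- `T_i = k_i`-normalised Demazure-Lusztig element attached to an implementation of `s_i`. -/
abbrev dlElt {A : Type*} [Ring A] [Algebra ℂ A] (k : Multiplicity Φ)
    (J : RatFun D.MetaWeightLat →ₐ[ℂ] A) (S : b.support → A) (i : b.support) : A :=
  dlOp J (S i) ((k.val i : ℂ) ^ 2) (mono (D.metaRootW i))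

variable {A : Type*} [Ring A] [Algebra ℂ A] (k : Multiplicity Φ)
  {J : RatFun D.MetaWeightLat →ₐ[ℂ] A} {S : b.support → A}

lemma dlElt_eq (hS : ∀ i : b.support, Implements J (weylHom D.MetaWeightLat (sRefl Φ i)) (S i))
    (i : b.support) : dlElt D k J S i =
      algebraMap ℂ A ((k.val i : ℂ) ^ 2) - J (D.cFun k i) + J (D.cFun k i) * S i :=
  (hS i).dlOp_eq (sRefl_smul_mono_self D i) (mono_ne_zero _)
    (one_sub_mono_ne_zero (metaRootW_ne_zero D i))

lemma dlElt_quad (hS : ∀ i : b.support, Implements J (weylHom D.MetaWeightLat (sRefl Φ i)) (S i))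
    (i : b.support) : dlElt D k J S i * dlElt D k J S i =
      ((k.val i : ℂ) ^ 2 - 1) • dlElt D k J S i + ((k.val i : ℂ) ^ 2) • 1 := by
  refine (hS i).dlOp_quad ?_
  rw [map_cNeg, weylHom_apply, sRefl_smul_mono_self, cNeg_inv (mono_ne_zero _)
    (one_sub_mono_ne_zero (metaRootW_ne_zero D i)), map_add, map_one]

/-- The Demazure-Lusztig elements satisfy the braid relation iff the `S_i` do. -/
theorem braidDefect_dlElt
    (hS : ∀ i : b.support, Implements J (weylHom D.MetaWeightLat (sRefl Φ i)) (S i)) (h : i ≠ j) :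
    BraidDefect J (S i) (S j) (dlElt D k J S i) (dlElt D k J S j)
      (orderOf (sRefl Φ i * sRefl Φ j)) := by
  have hg := metaRootW_generic D h
  have key : ∀ i j : b.support, weylHom D.MetaWeightLat (sRefl Φ i) (mono (D.metaRootW j)) =
    mono (D.metaRootW i) ^ (- mpair D (D.metaRootW j) i) * mono (D.metaRootW j) :=
      fun i j => sRefl_smul_mono D _ _
  have key' : ∀ i : b.support, weylHom D.MetaWeightLat (sRefl Φ i) (mono (D.metaRootW i)) =
    (mono (D.metaRootW i))⁻¹ := fun i => sRefl_smul_mono_self D _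
  rcases meta_orderOf_cases D h with ⟨h1, h2, h3⟩ | ⟨h1, h2, h3⟩ | ⟨h1, h2, h3⟩ | ⟨h1, h2, h3⟩ |
    ⟨h1, h2, h3⟩ | ⟨h1, h2, h3⟩
  · rw [h3]
    exact braidDefect_two (hS i) (hS j) hg (by rw [key, h1]; simp) (by rw [key, h2]; simp)
  · rw [h3, dlElt, dlElt, val_eq_of_orderOf k h h3]
    exact braidDefect_three (hS i) (hS j) hg (key' i) (by rw [key, h2]; simp)
      (by rw [key, h1]; simp [mul_comm]) (key' j)
  · rw [h3]
    exact braidDefect_four (hS i) (hS j) hg (key' i) (by rw [key, h2]; simp)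
      (by rw [key, h1]; simp [mul_comm]) (key' j)
  · rw [h3]
    exact (braidDefect_four (hS j) (hS i) hg.symm (key' j) (by rw [key, h1]; simp)
      (by rw [key, h2]; simp [mul_comm]) (key' i)).symm
  · rw [h3]
    exact braidDefect_six (hS i) (hS j) hg (key' i) (by rw [key, h2]; simp)
      (by rw [key, h1]; simp [mul_comm]) (key' j)
  · rw [h3]
    exact (braidDefect_six (hS j) (hS i) hg.symm (key' j) (by rw [key, h1]; simp)
      (by rw [key, h2]; simp [mul_comm]) (key' i)).symm

lemma semiF_mul (f f' : RatFun D.MetaWeightLat) : D.semiF (f * f') = D.semiF f * D.semiF f' := by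
  simp [MetaplecticStructure.semiF, SkewMonoidAlgebra.single_mul_single]

lemma semiW_mul (w w' : Φ.weylGroup) : D.semiW (w * w') = D.semiW w * D.semiW w' := by
  simp [MetaplecticStructure.semiW, SkewMonoidAlgebra.single_mul_single]

lemma semiW_one : D.semiW (1 : Φ.weylGroup) = 1 := rfl

lemma single_eq_semi (w : Φ.weylGroup) (f : RatFun D.MetaWeightLat) :
    (SkewMonoidAlgebra.single w f : D.Semidirect) = D.semiF f * D.semiW w := by
  simp [MetaplecticStructure.semiW, MetaplecticStructure.semiF,
    SkewMonoidAlgebra.single_mul_single]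

lemma semiW_mul_semiF (w : Φ.weylGroup) (f : RatFun D.MetaWeightLat) :
    D.semiW w * D.semiF f = D.semiF (w • f) * D.semiW w := by
  simp [MetaplecticStructure.semiW, MetaplecticStructure.semiF,
    SkewMonoidAlgebra.single_mul_single]

/-- `ℂ(P^m) ⊆ W ⋉ ℂ(P^m)` as an algebra map. -/
def semiFHom : RatFun D.MetaWeightLat →ₐ[ℂ] D.Semidirect where
  toFun := D.semiF
  map_one' := rfl
  map_mul' := semiF_mul D
  map_zero' := SkewMonoidAlgebra.single_zero _
  map_add' f f' := SkewMonoidAlgebra.single_add _ _ _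
  commutes' c := by
    change _ = c • (1 : D.Semidirect)
    rw [SkewMonoidAlgebra.one_def, SkewMonoidAlgebra.smul_single, Algebra.algebraMap_eq_smul_one]
    rfl

lemma semi_implements (w : Φ.weylGroup) (hw : w * w = 1) :
    Implements (semiFHom D) (weylHom D.MetaWeightLat w) (D.semiW w) where
  comm f := semiW_mul_semiF D w f
  sq := by rw [← semiW_mul, hw]; rfl

/-- Algebra maps on `W ⋉ ℂ(P^m)` are determined by their values on `ℂ(P^m)` and the `s_i`. -/
lemma semidirect_hom_ext (b : Φ.Base) {f f' : D.Semidirect →ₐ[ℂ] A}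
    (h : ∀ x, f (D.semiF x) = f' (D.semiF x))
    (h' : ∀ i : b.support, f (D.semiW (sRefl Φ i)) = f' (D.semiW (sRefl Φ i))) : f = f' := by
  have hw : ∀ w : Φ.weylGroup, f (D.semiW w) = f' (D.semiW w) := by
    intro w
    obtain ⟨ω, rfl⟩ := exists_word b w
    induction ω with
    | nil => rw [wordProd, List.map_nil, List.prod_nil, semiW_one, map_one, map_one]
    | cons i ω ih =>
      have : wordProd b (i :: ω) = sRefl Φ i * wordProd b ω := by simp [wordProd]
      rw [this, semiW_mul, map_mul, map_mul, ih, h']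
  ext x
  induction x using SkewMonoidAlgebra.induction_on with
  | zero => simp
  | add x y hx hy => rw [map_add, map_add, hx, hy]
  | single w x => rw [single_eq_semi, map_mul, map_mul, h, hw]

/-- The universal property of `W ⋉ ℂ(P^m)`. -/
theorem exists_semidirect_lift
    (hS : ∀ i : b.support, Implements J (weylHom D.MetaWeightLat (sRefl Φ i)) (S i))
    (hbraid : ∀ i j : b.support, i ≠ j →
      altProd (S i) (S j) (orderOf (sRefl Φ i * sRefl Φ j)) =
        altProd (S j) (S i) (orderOf (sRefl Φ i * sRefl Φ j))) :
    ∃ f : D.Semidirect →ₐ[ℂ] A, (∀ x, f (D.semiF x) = J x) ∧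
      ∀ i : b.support, f (D.semiW (sRefl Φ i)) = S i := by
  obtain ⟨F, hF⟩ := exists_weyl_lift (fun i => (hS i).sq) hbraid
  have hcomm : ∀ (w : Φ.weylGroup) (f : RatFun D.MetaWeightLat), J (w • f) * F w = F w * J f := by
    intro w
    obtain ⟨ω, rfl⟩ := exists_word b w
    induction ω with
    | nil => intro f; simp [wordProd]
    | cons i ω ih =>
      intro f
      have : wordProd b (i :: ω) = sRefl Φ i * wordProd b ω := by simp [wordProd]
      rw [this, mul_smul, map_mul, hF, ← weylHom_apply, ← mul_assoc, ← (hS i).comm, mul_assoc, ih,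
        mul_assoc]
  let f := SkewMonoidAlgebra.liftNCRingHom J.toRingHom F fun {x y} => hcomm y x
  have hs : ∀ w x, f (SkewMonoidAlgebra.single w x) = J x * F w := by
    intro w x
    exact SkewMonoidAlgebra.liftNC_single _ _ _ _
  refine ⟨{ f with commutes' := ?_ }, ?_, ?_⟩
  · intro c
    have : algebraMap ℂ D.Semidirect c = D.semiF (algebraMap ℂ _ c) :=
      ((semiFHom D).commutes c).symm
    change f _ = _
    rw [this]
    refine (hs _ _).trans ?_
    rw [AlgHom.commutes, map_one, mul_one]
  · intro x
    refine (hs _ _).trans ?_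
    rw [map_one, mul_one]
  · intro i
    refine (hs _ _).trans ?_
    rw [map_one, one_mul, hF]

end MetaRoots

end

/-! ### The localization isomorphism between W ⋉ ℂ(P^m) and the localized Hecke algebra. -/

section

variable {ι E : Type*} [NormedAddCommGroup E] [InnerProductSpace ℝ E]
variable {Φ : RootPairing ι ℝ E E}

section Braid

variable {K F A : Type*} [Field K] [Field F] [Algebra K F] [Ring A] [Algebra K A]
variable {J : F →ₐ[K] A} {s : F →ₐ[K] F} {S T : A} {q : K} {x c : F}

/-- The cross relation of a Demazure-Lusztig element. -/
lemma Implements.dlOp_cross (h : Implements J s S) (hs : s x = x⁻¹) (h0 : x ≠ 0)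
    (h1 : 1 - x ≠ 0) (f : F) : dlOp J S q x * J f - J (s f) * dlOp J S q x =
      (q - 1) • J ((f - s f) / (1 - x)) := by
  have e : algebraMap K F q - (1 - algebraMap K F q * x) / (1 - x) =
      algebraMap K F (q - 1) / (1 - x) := by
    rw [map_sub, map_one]; field_simp; ring
  have e1 : (q - 1) • J ((f - s f) / (1 - x)) =
      J ((algebraMap K F q - (1 - algebraMap K F q * x) / (1 - x)) * (f - s f)) := by
    rw [e, ← map_smul, Algebra.smul_def, div_mul_eq_mul_div, mul_div_assoc]
  rw [h.dlOp_eq hs h0 h1, e1, ← AlgHom.commutes J, ← map_sub]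
  generalize algebraMap K F q - (1 - algebraMap K F q * x) / (1 - x) = d
  rw [add_mul, mul_assoc, h.comm, mul_add, ← map_mul, ← map_mul, ← mul_assoc, ← mul_assoc,
    ← map_mul, ← map_mul, mul_comm (s f) d, mul_comm (s f), mul_sub, map_sub]
  abel

/-- A Demazure-Lusztig element `T` yields an implementation `c⁻¹ (T - q + c)` of `s`. -/
lemma implements_of_cross (hc : c ≠ 0) (hss : ∀ f, s (s f) = f)
    (hsc : s c = 1 + algebraMap K F q - c)
    (hcross : ∀ f, (T - algebraMap K A q + J c) * J f = J (s f) * (T - algebraMap K A q + J c))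
    (hquad : T * T = (q - 1) • T + q • 1) :
    Implements J s (J c⁻¹ * (T - algebraMap K A q + J c)) := by
  set U := T - algebraMap K A q + J c with hU
  have hsc0 : s c ≠ 0 := by
    intro h
    apply hc
    rw [← hss c, h, map_zero]
  have hT : T = U + J (algebraMap K F q - c) := by
    rw [hU, map_sub, AlgHom.commutes]; abel
  clear_value U
  -- Substituting T = U + q - c into the quadratic relation, the terms linear in U cancel because c
  -- + s c = 1 + q.
  have hUU : U * U = J (c * s c) := by
    have e1 : T * T = U * U + J (algebraMap K F q - s c) * U + J (algebraMap K F q - c) * U +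
        J ((algebraMap K F q - c) * (algebraMap K F q - c)) := by
      conv_lhs => rw [hT]
      rw [add_mul, mul_add U, mul_add (J _), hcross, map_sub s, AlgHom.commutes, map_mul]
      abel
    have e2 : (q - 1) • T + q • 1 = J (algebraMap K F (q - 1)) * U +
        J (algebraMap K F (q - 1) * (algebraMap K F q - c) + algebraMap K F q) := by
      conv_lhs => rw [hT]
      rw [Algebra.smul_def, Algebra.smul_def, mul_one, map_add J, map_mul J, AlgHom.commutes,
        AlgHom.commutes, mul_add, add_assoc]
    rw [hquad, e2] at e1
    have e3 : J (algebraMap K F q - s c) * U + J (algebraMap K F q - c) * U =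
        J (algebraMap K F (q - 1)) * U := by
      rw [← add_mul, ← map_add, hsc]; congr 2; rw [map_sub, map_one]; ring
    have e4 : U * U = J (algebraMap K F (q - 1) * (algebraMap K F q - c) + algebraMap K F q) -
        J ((algebraMap K F q - c) * (algebraMap K F q - c)) := by
      rw [add_assoc, add_assoc, ← add_assoc (J _ * U), e3] at e1
      have := sub_eq_zero.2 e1
      rw [← sub_eq_zero, ← neg_eq_zero, ← this]; abel
    rw [e4, ← map_sub, hsc]; congr 1; rw [map_sub, map_one]; ring
  constructor
  · intro f
    rw [mul_assoc, hcross, ← mul_assoc, ← map_mul, mul_comm, map_mul, mul_assoc]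
  · rw [mul_assoc, ← mul_assoc U, hcross, mul_assoc, hUU, ← map_mul, ← map_mul, map_inv₀]
    rw [show c⁻¹ * ((s c)⁻¹ * (c * s c)) = 1 by field_simp, map_one]

/-- The constructions S ↦ T and T ↦ S are inverse to each other: this recovers T from the involution
built from it. -/
lemma dlOp_of_cross (hc : (1 - algebraMap K F q * x) / (1 - x) ≠ 0) (hs : s x = x⁻¹) (h0 : x ≠ 0)
    (h1 : 1 - x ≠ 0) (h : Implements J s (J ((1 - algebraMap K F q * x) / (1 - x))⁻¹ *
      (T - algebraMap K A q + J ((1 - algebraMap K F q * x) / (1 - x))))) :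
    dlOp J (J ((1 - algebraMap K F q * x) / (1 - x))⁻¹ *
      (T - algebraMap K A q + J ((1 - algebraMap K F q * x) / (1 - x)))) q x = T := by
  rw [h.dlOp_eq hs h0 h1, ← mul_assoc, ← map_mul, mul_inv_cancel₀ hc, map_one, one_mul]
  abel

end Braid

section HeckeIso

variable [IsEuclidean Φ] [Φ.IsCrystallographic] (D : MetaplecticStructure Φ)
variable [Finite ι] [Φ.IsRootSystem] [Φ.IsReduced] {b : Φ.Base} (k : Multiplicity Φ)

/-- For even m_ij both products contain each scalar equally often, and m_ij = 3 forces equal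
parameters. Hence rescaling the generators does not disturb the braid relations. -/
lemma altProd_val_comm {i j : b.support} (h : i ≠ j) (u : ℂˣ → ℂ) :
    altProd (u (k.val i)) (u (k.val j)) (orderOf (sRefl Φ i * sRefl Φ j)) =
      altProd (u (k.val j)) (u (k.val i)) (orderOf (sRefl Φ i * sRefl Φ j)) := by
  have hv := val_eq_of_orderOf k h
  rcases orderOf_cases h with ⟨-, -, h3⟩ | ⟨-, -, h3⟩ | ⟨-, -, h3⟩ | ⟨-, -, h3⟩ |
    ⟨-, -, h3⟩ | ⟨-, -, h3⟩
  · rw [h3]; simp only [altProd]; ring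
  · rw [hv h3]
  all_goals rw [h3]; simp only [altProd]; ring

/-- The generators `T_i` of the Hecke algebra inside `W ⋉ ℂ(P^m)`. -/
def semiT (i : b.support) : D.Semidirect :=
  (k.val i : ℂ)⁻¹ • dlElt D k (semiFHom D) (fun i : b.support => D.semiW (sRefl Φ i)) i

lemma semi_implements' (i : b.support) : Implements (semiFHom D)
    (weylHom D.MetaWeightLat (sRefl Φ i)) ((fun i : b.support => D.semiW (sRefl Φ i)) i) :=
  semi_implements D _ (sRefl_mul_self _)

lemma algebraMap_divDiff (i : ι) (p : GrpAlg D.MetaWeightLat) :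
    algebraMap _ (RatFun D.MetaWeightLat) (D.divDiff i p) = (algebraMap _ _ p -
      sRefl Φ i • algebraMap _ _ p) / (1 - mono (D.metaRootW i)) := by
  have h1 := congrArg (algebraMap _ (RatFun D.MetaWeightLat)) (D.mul_divDiff i p)
  rw [map_mul, map_sub, map_one, map_sub, ← weyl_smul_algebraMap] at h1
  rw [eq_div_iff (one_sub_mono_ne_zero (metaRootW_ne_zero D i)), mul_comm]
  exact h1

/-- The map `H̃^m(k) → W ⋉ ℂ(P^m)`. -/
theorem exists_hecke_to_semidirect : ∃ f : D.AffHecke b k →ₐ[ℂ] D.Semidirect,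
    (∀ i : b.support, f (D.heckeT k i) = semiT D k i) ∧
    ∀ p, f (D.heckeX b k p) = D.semiF (algebraMap _ _ p) := by
  let F : D.PreHecke b →ₐ[ℂ] D.Semidirect := FreeAlgebra.lift ℂ
    (Sum.elim (semiT D k) fun ν => D.semiF (mono ν))
  have hT : ∀ i : b.support, F (D.preT i) = semiT D k i := fun i => by
    simp [F, MetaplecticStructure.preT]
  have hX : ∀ ν, F (D.preX b ν) = D.semiF (mono ν) := fun i => by
    simp [F, MetaplecticStructure.preX]
  have hP : ∀ p, F (D.prePoly b p) = D.semiF (algebraMap _ _ p) := by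
    intro p
    have h1 : D.semiF (algebraMap _ _ p) = (semiFHom D).comp
        (IsScalarTower.toAlgHom ℂ (GrpAlg D.MetaWeightLat) (RatFun D.MetaWeightLat)) p := rfl
    rw [h1, MetaplecticStructure.prePoly, Finsupp.sum, map_sum]
    conv_rhs => rw [← AddMonoidAlgebra.sum_coeff_single p]
    rw [Finsupp.sum, map_sum]
    refine Finset.sum_congr rfl fun ν _ => ?_
    have : (AddMonoidAlgebra.single ν (p.coeff ν) : GrpAlg D.MetaWeightLat) =
        p.coeff ν • monoP ν := by simp [monoP]
    rw [this, map_smul, map_smul, hX]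
    rfl
  have hrel : ∀ ⦃x y⦄, D.HeckeRel b k x y → F x = F y := by
    intro x y h
    induction h with
    | quadratic i =>
      have hq := dlElt_quad D k (semi_implements' D (b := b)) i
      have h0 : (k.val i : ℂ) ≠ 0 := (k.val i).ne_zero
      rw [map_mul, map_sub, map_add, hT, AlgHom.commutes, AlgHom.commutes, map_zero, semiT]
      generalize dlElt D k (semiFHom D) (fun i : b.support => D.semiW (sRefl Φ i)) i = T at hq ⊢
      rw [sub_mul, mul_add, mul_add, smul_mul_smul_comm, hq, ← map_mul, mul_inv_cancel₀ h0,
        Algebra.algebraMap_eq_smul_one, Algebra.algebraMap_eq_smul_one,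
        Algebra.algebraMap_eq_smul_one]
      simp only [smul_mul_assoc, mul_smul_comm, one_mul, mul_one, smul_smul, smul_add]
      match_scalars <;> field_simp <;> ring
    | braid i j h =>
      -- The braid relation of the reflections holds in the semidirect product and passes to the
      -- Demazure–Lusztig elements.
      have hb := (braidDefect_dlElt D k (semi_implements' D) h).braid_iff.2 (by
        have hw := sRefl_braid (Φ := Φ) (i := i) (j := j)
        let f : Φ.weylGroup →* D.Semidirect := ⟨⟨D.semiW, semiW_one D⟩, semiW_mul D⟩
        have hf : ∀ (x y : Φ.weylGroup) (m : ℕ), f (altProd x y m) =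
            altProd (D.semiW x) (D.semiW y) m := by
          intro x y m
          induction m generalizing x y with
          | zero => exact map_one f
          | succ m ih => rw [altProd, map_mul, ih]; rfl
        have := congrArg f hw
        rwa [hf, hf] at this)
      have hF : ∀ (x y : D.PreHecke b) (m : ℕ), F (altProd x y m) = altProd (F x) (F y) m := by
        intro x y m
        induction m generalizing x y with
        | zero => exact map_one F
        | succ m ih => rw [altProd, map_mul, ih]; rfl
      rw [hF, hF, hT, hT, semiT, semiT, altProd_smul, altProd_smul, hb,
        altProd_val_comm k h fun z => (z : ℂ)⁻¹]
    | x_zero => rw [hX, mono_zero, map_one]; rfl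
    | x_add μ ν => rw [map_mul, hX, hX, hX, mono_add, semiF_mul]
    | cross i ν =>
      have h0 : (k.val i : ℂ) ≠ 0 := (k.val i).ne_zero
      have hx1 := one_sub_mono_ne_zero (metaRootW_ne_zero D i)
      have hc := (semi_implements' D i).dlOp_cross (q := (k.val i : ℂ) ^ 2)
        (sRefl_smul_mono_self D i) (mono_ne_zero _) hx1 (mono ν)
      rw [map_sub, map_mul, map_mul, map_smul, hT, hX, hX, hP, algebraMap_divDiff, semiT,
        smul_mul_assoc,
        mul_smul_comm, ← smul_sub, ← weyl_smul_mono]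
      refine (congrArg _ hc).trans ?_
      rw [smul_smul]
      congr 1
      field_simp
  refine ⟨RingQuot.liftAlgHom ℂ ⟨F, hrel⟩, ?_, ?_⟩
  · intro i
    exact (RingQuot.liftAlgHom_mkAlgHom_apply ℂ F hrel _).trans (hT i)
  · intro p
    rw [← MetaplecticStructure.mk_prePoly]
    exact (RingQuot.liftAlgHom_mkAlgHom_apply ℂ F hrel _).trans (hP p)

/-- Two ring maps from `ℂ(L)` which agree on `ℂ[L]` are equal. -/
lemma ratFun_hom_ext {L : AddSubgroup E} {R : Type*} [Ring R] {f f' : RatFun L →+* R}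
    (h : ∀ p : GrpAlg L, f (algebraMap _ _ p) = f' (algebraMap _ _ p)) : f = f' :=
  IsLocalization.ringHom_ext (nonZeroDivisors (GrpAlg L)) (RingHom.ext h)

lemma ratToLoc_algebraMap (p : GrpAlg D.MetaWeightLat) :
    D.ratToLoc b k (algebraMap _ _ p) = OreLocalization.numeratorRingHom (D.heckeX b k p) :=
  OreLocalization.universalHom_commutes _ _ _

/-- The map `H̃^m_loc(k) → W ⋉ ℂ(P^m)`. -/
theorem exists_locHecke_to_semidirect : ∃ f : D.LocHecke b k →+* D.Semidirect,
    (∀ i : b.support, f (D.locT k i) = semiT D k i) ∧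
    ∀ p, f (D.ratToLoc b k p) = D.semiF p := by
  obtain ⟨f, hfT, hfX⟩ := exists_hecke_to_semidirect D (b := b) k
  have hu : ∀ x : D.heckeDenoms b k, IsUnit
      ((f.toRingHom.toMonoidHom.comp (D.heckeDenoms b k).subtype) x) := by
    rintro ⟨_, p, hp, rfl⟩
    change IsUnit (f (D.heckeX b k p))
    rw [hfX]
    have h0 : algebraMap _ (RatFun D.MetaWeightLat) p ≠ 0 :=
      IsFractionRing.to_map_ne_zero_of_mem_nonZeroDivisors hp
    exact (IsUnit.mk0 _ h0).map (semiFHom D)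
  let G := OreLocalization.universalHom f.toRingHom (IsUnit.liftRight _ hu) (fun _ => rfl)
  have hG : ∀ x, G (OreLocalization.numeratorRingHom x) = f x := fun x =>
    OreLocalization.universalHom_commutes _ _ _
  refine ⟨G, fun i => (hG _).trans (hfT i), ?_⟩
  intro p
  have : G.comp (D.ratToLoc b k).toRingHom = (semiFHom D).toRingHom := by
    refine ratFun_hom_ext fun p => ?_
    change G (D.ratToLoc b k (algebraMap _ _ p)) = D.semiF _
    rw [ratToLoc_algebraMap, hG, hfX]
  exact congrArg (fun g => g p) this

lemma cFun_ne_zero (i : ι) : D.cFun k i ≠ 0 :=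
  div_ne_zero (one_sub_mul_mono_ne_zero _ (metaRootW_ne_zero D i))
    (one_sub_mono_ne_zero (metaRootW_ne_zero D i))

lemma sRefl_smul_cFun (i : ι) : sRefl Φ i • D.cFun k i =
    1 + algebraMap ℂ _ ((k.val i : ℂ) ^ 2) - D.cFun k i := by
  have h0 := mono_ne_zero (D.metaRootW i)
  have h1 := one_sub_mono_ne_zero (metaRootW_ne_zero D i)
  have h1' : mono (D.metaRootW i) - 1 ≠ 0 := by rwa [← neg_ne_zero, neg_sub]
  rw [← weylHom_apply, MetaplecticStructure.cFun, map_div₀, map_sub, map_sub, map_mul, map_one,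
    AlgHom.commutes, weylHom_apply, sRefl_smul_mono_self]
  field_simp
  ring

/-- `k_i T_i` in `H̃^m_loc(k)`. -/
def locT' (i : b.support) : D.LocHecke b k := (k.val i : ℂ) • (D.locT k i : D.LocHecke b k)

lemma locT'_quad (i : b.support) : locT' D k i * locT' D k i =
    ((k.val i : ℂ) ^ 2 - 1) • locT' D k i + ((k.val i : ℂ) ^ 2) • 1 := by
  have h0 : (k.val i : ℂ) ≠ 0 := (k.val i).ne_zero
  have h1 : (D.locT k i : D.LocHecke b k) * (D.locT k i -
      algebraMap ℂ _ ((k.val i : ℂ) - (k.val i : ℂ)⁻¹)) = 1 := by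
    have := (D.locT k i).mul_inv
    refine Eq.trans ?_ this
    congr 1
    exact (map_sub OreLocalization.numeratorRingHom _ _).symm
  rw [mul_sub, Algebra.algebraMap_eq_smul_one, mul_smul_comm, mul_one, sub_eq_iff_eq_add] at h1
  rw [locT', smul_mul_smul_comm, h1]
  match_scalars <;> field_simp

lemma locT'_cross (i : b.support) (f : RatFun D.MetaWeightLat) :
    (locT' D k i - algebraMap ℂ _ ((k.val i : ℂ) ^ 2) + D.ratToLoc b k (D.cFun k i)) *
      D.ratToLoc b k f = D.ratToLoc b k (weylHom D.MetaWeightLat (sRefl Φ i) f) *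
      (locT' D k i - algebraMap ℂ _ ((k.val i : ℂ) ^ 2) + D.ratToLoc b k (D.cFun k i)) := by
  -- U plays the role of c_i s_i, so it has to intertwine f with s_i f. For polynomials this is the
  -- Bernstein cross relation rewritten.
  set U := locT' D k i - algebraMap ℂ _ ((k.val i : ℂ) ^ 2) + D.ratToLoc b k (D.cFun k i) with hU
  have hpoly : ∀ p : GrpAlg D.MetaWeightLat, U * D.ratToLoc b k (algebraMap _ _ p) =
      D.ratToLoc b k (weylHom D.MetaWeightLat (sRefl Φ i) (algebraMap _ _ p)) * U := by
    intro p
    have h0 : (k.val i : ℂ) ≠ 0 := (k.val i).ne_zero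
    have hx1 := one_sub_mono_ne_zero (metaRootW_ne_zero D i)
    have h1 := congrArg (OreLocalization.numeratorRingHom (S := D.heckeDenoms b k))
      (D.hecke_cross b k i p)
    have h3 : ∀ (c : ℂ) (x : D.AffHecke b k), (OreLocalization.numeratorRingHom (c • x) :
        D.LocHecke b k) = c • OreLocalization.numeratorRingHom x := by
      intro c x
      rw [Algebra.smul_def, map_mul, Algebra.smul_def]; rfl
    rw [map_sub, map_mul, map_mul, h3, ← ratToLoc_algebraMap, ← ratToLoc_algebraMap,
      ← ratToLoc_algebraMap, algebraMap_divDiff] at h1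
    change (D.locT k i : D.LocHecke b k) * _ - _ * (D.locT k i : D.LocHecke b k) = _ at h1
    have h4 : locT' D k i * D.ratToLoc b k (algebraMap _ _ p) -
        D.ratToLoc b k (sRefl Φ (i : ι) • algebraMap _ _ p) * locT' D k i =
        ((k.val i : ℂ) ^ 2 - 1) • D.ratToLoc b k ((algebraMap _ _ p -
          sRefl Φ (i : ι) • algebraMap _ _ p) / (1 - mono (D.metaRootW i))) := by
      rw [locT', smul_mul_assoc, mul_smul_comm, ← smul_sub, weyl_smul_algebraMap, h1, smul_smul]
      congr 1
      · field_simp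
      · rw [weyl_smul_algebraMap]
    rw [weylHom_apply]
    generalize (algebraMap _ (RatFun D.MetaWeightLat)) p = f at h4 ⊢
    have h5 : algebraMap ℂ _ ((k.val i : ℂ) ^ 2) - D.cFun k i =
        algebraMap ℂ _ ((k.val i : ℂ) ^ 2 - 1) / (1 - mono (D.metaRootW i)) := by
      rw [MetaplecticStructure.cFun, map_sub _ _ (1 : ℂ), map_one]; field_simp; ring
    have h6 : U = locT' D k i - D.ratToLoc b k
        (algebraMap ℂ _ ((k.val i : ℂ) ^ 2) - D.cFun k i) := by
      rw [hU, map_sub, AlgHom.commutes]; abel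
    have h7 : ((k.val i : ℂ) ^ 2 - 1) • D.ratToLoc b k ((f -
          sRefl Φ (i : ι) • f) / (1 - mono (D.metaRootW i))) =
        D.ratToLoc b k ((algebraMap ℂ _ ((k.val i : ℂ) ^ 2) - D.cFun k i) *
          (f - sRefl Φ (i : ι) • f)) := by
      rw [h5, ← map_smul, Algebra.smul_def, div_mul_eq_mul_div, mul_div_assoc]
    rw [h7] at h4
    rw [h6, sub_mul, mul_sub, ← map_mul, ← map_mul, ← sub_eq_zero]
    rw [← sub_eq_zero, mul_sub, map_sub, mul_comm _ (sRefl Φ (i : ι) • f)] at h4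
    rw [← h4]
    abel
  obtain ⟨p, q, hq, rfl⟩ := IsFractionRing.div_surjective (A := GrpAlg D.MetaWeightLat) f
  have hq0 : algebraMap _ (RatFun D.MetaWeightLat) q ≠ 0 :=
    IsFractionRing.to_map_ne_zero_of_mem_nonZeroDivisors hq
  have hsq0 : weylHom D.MetaWeightLat (sRefl Φ i) (algebraMap _ _ q) ≠ 0 := by
    rwa [Ne, map_eq_zero]
  -- An intertwining relation for q can be inverted, and thus extends from polynomials to all
  -- fractions.
  have hinv : U * D.ratToLoc b k (algebraMap _ _ q)⁻¹ =
      D.ratToLoc b k (weylHom D.MetaWeightLat (sRefl Φ i) (algebraMap _ _ q)⁻¹) * U := by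
    have h1 := hpoly q
    have h2 : D.ratToLoc b k (weylHom D.MetaWeightLat (sRefl Φ i) (algebraMap _ _ q)⁻¹) *
        D.ratToLoc b k (weylHom D.MetaWeightLat (sRefl Φ i) (algebraMap _ _ q)) = 1 := by
      rw [← map_mul, ← map_mul, inv_mul_cancel₀ hq0, map_one, map_one]
    have h3 : D.ratToLoc b k (algebraMap _ _ q) * D.ratToLoc b k (algebraMap _ _ q)⁻¹ = 1 := by
      rw [← map_mul, mul_inv_cancel₀ hq0, map_one]
    calc _ = D.ratToLoc b k (weylHom D.MetaWeightLat (sRefl Φ i) (algebraMap _ _ q)⁻¹) *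
          (D.ratToLoc b k (weylHom D.MetaWeightLat (sRefl Φ i) (algebraMap _ _ q)) * U) *
          D.ratToLoc b k (algebraMap _ _ q)⁻¹ := by
            rw [← mul_assoc, h2, one_mul]
      _ = _ := by rw [← h1, mul_assoc, mul_assoc, h3, mul_one]
  rw [div_eq_mul_inv, map_mul, ← mul_assoc, hpoly, mul_assoc, hinv, map_mul, map_mul, mul_assoc]

/-- The elements `φ(s_i)` of `H̃^m_loc(k)`. -/
def locS (i : b.support) : D.LocHecke b k := D.ratToLoc b k (D.cFun k i)⁻¹ *
  (locT' D k i - algebraMap ℂ _ ((k.val i : ℂ) ^ 2) + D.ratToLoc b k (D.cFun k i))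

lemma locS_eq (i : b.support) : locS D k i =
    D.ratToLoc b k (algebraMap ℂ _ (k.val i : ℂ) / D.cFun k i) * D.locT k i + 1 -
      D.ratToLoc b k (algebraMap ℂ _ ((k.val i : ℂ) ^ 2) / D.cFun k i) := by
  have h := cFun_ne_zero D k i
  rw [locS, mul_add, mul_sub, ← map_mul, inv_mul_cancel₀ h, map_one, div_eq_mul_inv,
    div_eq_mul_inv, mul_comm _ (D.cFun k i)⁻¹, mul_comm _ (D.cFun k i)⁻¹, map_mul, map_mul,
    AlgHom.commutes, AlgHom.commutes, locT', Algebra.smul_def, mul_assoc]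
  abel

lemma locS_implements (i : b.support) : Implements (D.ratToLoc b k)
    (weylHom D.MetaWeightLat (sRefl Φ i)) (locS D k i) := by
  refine implements_of_cross (cFun_ne_zero D k i) ?_ (sRefl_smul_cFun D k i) (locT'_cross D k i)
    (locT'_quad D k i)
  intro f
  rw [weylHom_apply, weylHom_apply, ← mul_smul, sRefl_mul_self, one_smul]

lemma dlElt_locS (i : b.support) : dlElt D k (D.ratToLoc b k) (locS D k) i = locT' D k i :=
  dlOp_of_cross (cFun_ne_zero D k i) (sRefl_smul_mono_self D i) (mono_ne_zero _)
    (one_sub_mono_ne_zero (metaRootW_ne_zero D i)) (locS_implements D k i)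

lemma locT_braid {i j : b.support} (h : i ≠ j) :
    altProd (D.locT k i : D.LocHecke b k) (D.locT k j) (orderOf (sRefl Φ i * sRefl Φ j)) =
      altProd (D.locT k j : D.LocHecke b k) (D.locT k i) (orderOf (sRefl Φ i * sRefl Φ j)) := by
  have hF : ∀ (x y : D.PreHecke b) (m : ℕ), (OreLocalization.numeratorRingHom
      (D.heckeMk b k (altProd x y m)) : D.LocHecke b k) =
      altProd (OreLocalization.numeratorRingHom (D.heckeMk b k x))
        (OreLocalization.numeratorRingHom (D.heckeMk b k y)) m := by
    intro x y m
    induction m generalizing x y with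
    | zero => rw [altProd, map_one, map_one]; rfl
    | succ m ih => rw [altProd, map_mul, map_mul, ih]; rfl
  have := congrArg (OreLocalization.numeratorRingHom (S := D.heckeDenoms b k))
    (D.heckeMk_rel (MetaplecticStructure.HeckeRel.braid (k := k) i j h))
  rw [hF, hF] at this
  exact this

/-- The localization isomorphism exists. -/
theorem exists_localizationIso : ∃ φ : D.Semidirect ≃ₐ[ℂ] D.LocHecke b k,
    D.IsLocalizationIso b k φ := by
  obtain ⟨φ, hF, hS⟩ := exists_semidirect_lift D (locS_implements D (b := b) k) (by
    intro i j h
    -- The equivalence is used in the other direction: the braid relations are known for the T_i and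
    -- are deduced for the candidates φ(s_i).
    refine (braidDefect_dlElt D k (locS_implements D k) h).braid_iff.1 ?_
    rw [dlElt_locS, dlElt_locS, locT', locT', altProd_smul, altProd_smul, locT_braid D k h,
      altProd_val_comm k h fun z => (z : ℂ)])
  obtain ⟨ψ, hψT, hψF⟩ := exists_locHecke_to_semidirect D (b := b) k
  have hψc : ∀ c : ℂ, ψ (algebraMap ℂ _ c) = algebraMap ℂ _ c := by
    intro c
    rw [← AlgHom.commutes (D.ratToLoc b k), hψF]
    exact AlgHom.commutes (semiFHom D) c
  have h1 : ∀ x, ψ (φ x) = x := by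
    let ψ' : D.LocHecke b k →ₐ[ℂ] D.Semidirect := { ψ with commutes' := hψc }
    have : ψ'.comp φ = AlgHom.id ℂ _ := by
      refine semidirect_hom_ext D b (fun x => ?_) fun i => ?_
      · change ψ (φ _) = _
        rw [hF, hψF]; rfl
      · change ψ (φ _) = D.semiW (sRefl Φ i)
        have hT' : ψ (locT' D k i) = dlElt D k (semiFHom D)
            (fun i : b.support => D.semiW (sRefl Φ i)) i := by
          rw [locT', Algebra.smul_def, map_mul, hψc, hψT, semiT, ← Algebra.smul_def, smul_smul,
            mul_inv_cancel₀ (k.val i).ne_zero, one_smul]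
        rw [hS, locS, map_mul, map_add, map_sub, hT', hψF, hψF, hψc,
          dlElt_eq D k (semi_implements' D)]
        change semiFHom D _ * (_ - semiFHom D _ + semiFHom D _ * _ - _ + semiFHom D _) = _
        have : ∀ a c d : D.Semidirect, a - c + d - a + c = d := by intro a c d; abel
        rw [this, ← mul_assoc, ← map_mul, inv_mul_cancel₀ (cFun_ne_zero D k i), map_one, one_mul]
    exact fun x => congrArg (fun f => f x) this
  have h2 : ∀ x, φ (ψ x) = x := by
    -- It is enough to compare the two ring maps on numerators, that is on the generators of the
    -- Hecke algebra, since the extension to the Ore localization is unique.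
    have : φ.toRingHom.comp ψ = RingHom.id _ := by
      have hs : ∀ s : D.heckeDenoms b k, (OreLocalization.numeratorRingHom (s : D.AffHecke b k) :
          D.LocHecke b k) = (OreLocalization.numeratorUnit s : (D.LocHecke b k)ˣ) := fun _ => rfl
      have key : ∀ x : D.AffHecke b k, φ (ψ (OreLocalization.numeratorRingHom x)) =
          OreLocalization.numeratorRingHom x := by
        intro x
        induction x using D.hecke_induction b k with
        | hT i =>
          change φ (ψ (D.locT k i)) = D.locT k i
          have h3 : φ (dlElt D k (semiFHom D) (fun i : b.support => D.semiW (sRefl Φ i)) i) =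
              dlElt D k (D.ratToLoc b k) (locS D k) i := by
            rw [dlElt_eq D k (semi_implements' D), dlElt_eq D k (locS_implements D k), map_add,
              map_sub, map_mul, hS, AlgHom.commutes]
            change _ - φ (D.semiF _) + φ (D.semiF _) * _ = _
            rw [hF]
          rw [hψT, semiT, map_smul, h3, dlElt_locS, locT', smul_smul,
            inv_mul_cancel₀ (k.val i).ne_zero, one_smul]
        | hX p => rw [← ratToLoc_algebraMap, hψF, hF]
        | hadd x y hx hy => rw [map_add, map_add, map_add, hx, hy]
        | hmul x y hx hy => rw [map_mul, map_mul, map_mul, hx, hy]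
      rw [OreLocalization.universalHom_unique OreLocalization.numeratorRingHom
        (MetaplecticStructure.locUnits D b k) (fun _ => rfl) (φ.toRingHom.comp ψ) key]
      exact (OreLocalization.universalHom_unique OreLocalization.numeratorRingHom
        (MetaplecticStructure.locUnits D b k) (fun _ => rfl) (RingHom.id _) fun _ => rfl).symm
    exact fun x => congrArg (fun f => f x) this
  let e : D.Semidirect ≃ₐ[ℂ] D.LocHecke b k :=
    AlgEquiv.ofBijective φ ⟨Function.LeftInverse.injective h1, Function.RightInverse.surjective h2⟩
  exact ⟨e, hF, fun i => (hS i).trans (locS_eq D k i)⟩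

theorem existsUnique_localizationIso : ∃! φ : D.Semidirect ≃ₐ[ℂ] D.LocHecke b k,
    D.IsLocalizationIso b k φ := by
  obtain ⟨φ, hφ⟩ := exists_localizationIso D (b := b) k
  refine ⟨φ, hφ, fun φ' hφ' => ?_⟩
  have : (φ' : D.Semidirect →ₐ[ℂ] D.LocHecke b k) = φ := by
    refine semidirect_hom_ext D b (fun x => ?_) fun i => ?_
    · exact (hφ'.map_fun x).trans (hφ.map_fun x).symm
    · exact (hφ'.map_refl i).trans (hφ.map_refl i).symm
  ext x
  exact congrArg (fun f => f x) this

end HeckeIso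

end

/-! ### The field ℂ(P) over ℂ(P^m), and its projections onto residue classes of (λ, α^∨). -/

section

variable {ι E : Type*} [NormedAddCommGroup E] [InnerProductSpace ℝ E]
variable {Φ : RootPairing ι ℝ E E}

lemma fracLift_algebraMap {L L' : AddSubgroup E} {g : GrpAlg L →ₐ[ℂ] RatFun L'}
    (hg : Function.Injective g) (p : GrpAlg L) :
    (IsFractionRing.liftAlgHom hg : RatFun L →ₐ[ℂ] RatFun L') (algebraMap _ _ p) = g p :=
  IsFractionRing.lift_algebraMap (g := g.toRingHom) hg p

lemma algebraMap_smul_grpAlg {L : AddSubgroup E} (c : ℂ) (p : GrpAlg L) :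
    algebraMap _ (RatFun L) (c • p) = c • algebraMap _ (RatFun L) p :=
  map_smul (IsScalarTower.toAlgHom ℂ (GrpAlg L) (RatFun L)) c p

section Incl

variable [IsEuclidean Φ]

lemma wpair_eq {x : WeightLat Φ} {i : ι} {z : ℤ} (h : Φ.toLinearMap (x : E) (Φ.coroot i) = z) :
    wpair Φ x i = z := by
  have := wpair_cast Φ x i
  rw [inner_coroot, h] at this
  exact_mod_cast this

lemma wpair_spec (x : WeightLat Φ) (i : ι) :
    Φ.toLinearMap (x : E) (Φ.coroot i) = wpair Φ x i := by
  rw [wpair_cast, inner_coroot]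

lemma wpair_add (x y : WeightLat Φ) (i : ι) : wpair Φ (x + y) i = wpair Φ x i + wpair Φ y i :=
  wpair_eq (by rw [AddSubgroup.coe_add, map_add, LinearMap.add_apply, wpair_spec, wpair_spec]
               push_cast; rfl)

lemma wpair_zero (i : ι) : wpair Φ 0 i = 0 := wpair_eq (by simp)

lemma wpair_neg (x : WeightLat Φ) (i : ι) : wpair Φ (-x) i = - wpair Φ x i := by
  have := wpair_add x (-x) i
  rw [add_neg_cancel, wpair_zero] at this
  omega

lemma wpair_sub (x y : WeightLat Φ) (i : ι) : wpair Φ (x - y) i = wpair Φ x i - wpair Φ y i := by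
  rw [sub_eq_add_neg, wpair_add, wpair_neg, sub_eq_add_neg]

lemma wpair_zsmul (z : ℤ) (x : WeightLat Φ) (i : ι) : wpair Φ (z • x) i = z * wpair Φ x i :=
  wpair_eq (by
    rw [AddSubgroup.coe_zsmul, ← Int.cast_smul_eq_zsmul ℝ, map_smul, LinearMap.smul_apply,
      wpair_spec, smul_eq_mul]
    push_cast; rfl)

variable [Φ.IsCrystallographic] (D : MetaplecticStructure Φ)

lemma incl_mono (x : D.MetaWeightLat) : D.incl (mono x) = mono (D.toWeight x) := by
  refine (fracLift_algebraMap (g := (IsScalarTower.toAlgHom ℂ (GrpAlg (WeightLat Φ))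
    (RatFun (WeightLat Φ))).comp (AddMonoidAlgebra.mapDomainAlgHom ℂ ℂ D.toWeight)) _ _).trans ?_
  change algebraMap _ _ (AddMonoidAlgebra.mapDomainAlgHom ℂ ℂ D.toWeight (monoP x)) = _
  rw [monoP, AddMonoidAlgebra.mapDomainAlgHom_apply, AddMonoidAlgebra.mapDomain_single]
  rfl

lemma grpAlg_hom_ext {L : AddSubgroup E} {R : Type*} [Ring R] [Algebra ℂ R]
    {f f' : GrpAlg L →ₐ[ℂ] R} (h : ∀ x : L, f (monoP x) = f' (monoP x)) : f = f' := by
  refine AlgHom.ext fun p => ?_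
  induction p using AddMonoidAlgebra.induction_linear with
  | zero => rw [map_zero, map_zero]
  | add p q hp hq => rw [map_add, map_add, hp, hq]
  | single x c =>
    have : (AddMonoidAlgebra.single x c : GrpAlg L) = c • monoP x := by simp [monoP]
    rw [this, map_smul, map_smul, h]

/-- Algebra maps from `ℂ(L)` are determined by their values on monomials. -/
lemma ratFun_algHom_ext {L : AddSubgroup E} {R : Type*} [Ring R] [Algebra ℂ R]
    {f f' : RatFun L →ₐ[ℂ] R} (h : ∀ x : L, f (mono x) = f' (mono x)) : f = f' := by
  have : (f : RatFun L →+* R) = f' := by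
    refine ratFun_hom_ext fun p => ?_
    have : (f.comp (IsScalarTower.toAlgHom ℂ (GrpAlg L) (RatFun L))) =
        f'.comp (IsScalarTower.toAlgHom ℂ (GrpAlg L) (RatFun L)) :=
      grpAlg_hom_ext fun x => h x
    exact congrArg (fun g => g p) this
  exact AlgHom.ext fun x => congrArg (fun g => g x) this

lemma weyl_smul_toWeight (w : Φ.weylGroup) (x : D.MetaWeightLat) :
    w • D.toWeight x = D.toWeight (w • x) := rfl

lemma weyl_smul_incl (w : Φ.weylGroup) (f : RatFun D.MetaWeightLat) :
    w • D.incl f = D.incl (w • f) := by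
  have : (weylHom (WeightLat Φ) w).comp D.incl = D.incl.comp (weylHom D.MetaWeightLat w) := by
    refine ratFun_algHom_ext fun x => ?_
    simp only [AlgHom.comp_apply, weylHom_apply, incl_mono, weyl_smul_mono, weyl_smul_toWeight]
  exact congrArg (fun g => g f) this

lemma wpair_weyl (w : Φ.weylGroup) (x : WeightLat Φ) (i : ι) :
    wpair Φ (w • x) (w • i) = wpair Φ x i := by
  have h : (wpair Φ (w • x) (w • i) : ℝ) = wpair Φ x i := by
    rw [wpair_cast, wpair_cast, ← weyl_smul_root, coe_weyl_smul]
    have hn : ‖w • Φ.root i‖ ^ 2 = ‖Φ.root i‖ ^ 2 := by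
      rw [← real_inner_self_eq_norm_sq, ← real_inner_self_eq_norm_sq, inner_weyl]
    rw [hn, inner_smul_right, inner_smul_right, inner_weyl]
  exact_mod_cast h

lemma wpair_toWeight (x : D.MetaWeightLat) (i : ι) :
    wpair Φ (D.toWeight x) i = D.m i * mpair D x i :=
  wpair_eq (by rw [Int.cast_mul]; exact mpair_spec D x i)

lemma metaRootP_eq (i : ι) : D.metaRootP i = (D.m i : ℤ) • rootW Φ i := by
  apply Subtype.ext
  rw [AddSubgroup.coe_zsmul, ← Int.cast_smul_eq_zsmul ℝ]
  rfl

lemma metaRootP_ne_zero (i : ι) : D.metaRootP i ≠ 0 := fun h =>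
  metaRoot_ne_zero D i (congrArg Subtype.val h)

lemma incl_mono_metaRootW (i : ι) : D.incl (mono (D.metaRootW i)) = mono (D.metaRootP i) :=
  incl_mono D _

lemma mono_metaRootP (i : ι) : mono (D.metaRootP i) = mono (rootW Φ i) ^ (D.m i : ℤ) := by
  rw [metaRootP_eq, mono_zsmul]

variable [Finite ι] [Φ.IsRootSystem] [Φ.IsReduced]

lemma wpair_rootW (i j : ι) : wpair Φ (rootW Φ i) j = Φ.pairingIn ℤ i j :=
  wpair_eq (toLinearMap_root_coroot i j)

lemma wpair_rootW_self (i : ι) : wpair Φ (rootW Φ i) i = 2 := by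
  rw [wpair_rootW, RootPairing.pairingIn_same]

lemma wpair_sRefl_self (x : WeightLat Φ) (i : ι) : wpair Φ (sRefl Φ i • x) i = - wpair Φ x i := by
  rw [refl_smul_weight, wpair_sub, wpair_zsmul, wpair_rootW_self]; ring

end Incl

section Theta

variable [IsEuclidean Φ]

/-- The automorphism `x^λ ↦ z^{(λ, α^∨)} x^λ` of `ℂ[P]`. -/
def thetaPoly (i : ι) (z : ℂˣ) : GrpAlg (WeightLat Φ) →ₐ[ℂ] GrpAlg (WeightLat Φ) :=
  AddMonoidAlgebra.lift ℂ _ _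
    { toFun := fun x => ((z ^ wpair Φ x.toAdd i : ℂˣ) : ℂ) • monoP x.toAdd
      map_one' := by
        rw [toAdd_one, wpair_zero, zpow_zero, Units.val_one, one_smul]; rfl
      map_mul' := fun x y => by
        rw [toAdd_mul, wpair_add, monoP_add, zpow_add, smul_mul_smul_comm, Units.val_mul] }

lemma thetaPoly_monoP (i : ι) (z : ℂˣ) (x : WeightLat Φ) :
    thetaPoly i z (monoP x) = ((z ^ wpair Φ x i : ℂˣ) : ℂ) • monoP x := by
  exact (AddMonoidAlgebra.lift_single _ _ _).trans (one_smul _ _)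

lemma thetaPoly_injective (i : ι) (z : ℂˣ) : Function.Injective (thetaPoly (Φ := Φ) i z) := by
  have : (thetaPoly (Φ := Φ) i z⁻¹).comp (thetaPoly i z) = AlgHom.id ℂ _ := by
    refine grpAlg_hom_ext fun x => ?_
    change thetaPoly i z⁻¹ (thetaPoly i z (monoP x)) = monoP x
    rw [thetaPoly_monoP, map_smul, thetaPoly_monoP, smul_smul, ← Units.val_mul, inv_zpow,
      mul_inv_cancel, Units.val_one, one_smul]
  exact Function.LeftInverse.injective (g := thetaPoly i z⁻¹) fun x =>
    congrArg (fun f => f x) this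

/-- The automorphism `x^λ ↦ z^{(λ, α^∨)} x^λ` of `ℂ(P)`. -/
def theta (i : ι) (z : ℂˣ) : RatFun (WeightLat Φ) →ₐ[ℂ] RatFun (WeightLat Φ) :=
  IsFractionRing.liftAlgHom (A := GrpAlg (WeightLat Φ))
    (g := (IsScalarTower.toAlgHom ℂ (GrpAlg (WeightLat Φ)) (RatFun (WeightLat Φ))).comp
      (thetaPoly i z))
    ((IsFractionRing.injective (GrpAlg (WeightLat Φ)) (RatFun (WeightLat Φ))).comp
      (thetaPoly_injective i z))

lemma theta_mono (i : ι) (z : ℂˣ) (x : WeightLat Φ) :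
    theta i z (mono x) = ((z ^ wpair Φ x i : ℂˣ) : ℂ) • mono x := by
  refine (fracLift_algebraMap (g := (IsScalarTower.toAlgHom ℂ (GrpAlg (WeightLat Φ))
    (RatFun (WeightLat Φ))).comp (thetaPoly i z)) _ _).trans ?_
  change algebraMap _ _ (thetaPoly i z (monoP x)) = _
  rw [thetaPoly_monoP, algebraMap_smul_grpAlg]
  rfl

variable [Φ.IsCrystallographic] (D : MetaplecticStructure Φ)

/-- For ν ∈ P^m the number (ν, α^∨) is a multiple of m(α), so an m(α)-th root of unity acts
trivially on x^ν. This makes the projections below linear over ℂ(P^m). -/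
lemma theta_incl (i : ι) {z : ℂˣ} (hz : z ^ D.m i = 1) (f : RatFun D.MetaWeightLat) :
    theta i z (D.incl f) = D.incl f := by
  have : (theta i z).comp D.incl = D.incl := by
    refine ratFun_algHom_ext fun x => ?_
    rw [AlgHom.comp_apply, incl_mono, theta_mono, wpair_toWeight, zpow_mul, zpow_natCast, hz,
      one_zpow, Units.val_one, one_smul]
  exact congrArg (fun g => g f) this

/-- A primitive `m(α)`-th root of unity. -/
def zetaU (i : ι) : ℂˣ := Units.mk0 (Complex.exp (2 * Real.pi * Complex.I / D.m i))
  (Complex.exp_ne_zero _)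

lemma zetaU_primitive (i : ι) : IsPrimitiveRoot (zetaU D i) (D.m i) := by
  rw [← IsPrimitiveRoot.coe_units_iff]
  exact Complex.isPrimitiveRoot_exp _ (D.m_pos i).ne'

/-- The projection of `ℂ(P)` on the components of the weights `λ` with `(λ, α^∨) ≡ j mod m(α)`. -/
def proj (i : ι) (j : ℕ) : D.CP →ₗ[ℂ] D.CP :=
  (D.m i : ℂ)⁻¹ • ∑ l ∈ Finset.range (D.m i),
    ((((zetaU D i) ^ (-(j : ℤ))) ^ l : ℂˣ) : ℂ) • (theta i (zetaU D i ^ l)).toLinearMap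

lemma proj_incl_mul (i : ι) (j : ℕ) (f : RatFun D.MetaWeightLat) (v : D.CP) :
    proj D i j (D.incl f * v) = D.incl f * proj D i j v := by
  have h : ∀ l : ℕ, (zetaU D i ^ l) ^ D.m i = 1 := by
    intro l
    rw [← pow_mul, mul_comm, pow_mul, (zetaU_primitive D i).pow_eq_one, one_pow]
  simp only [proj, LinearMap.smul_apply, LinearMap.sum_apply, AlgHom.toLinearMap_apply, map_mul,
    theta_incl D i (h _), mul_smul_comm, Finset.mul_sum]

/-- Orthogonality of the characters of ℤ/m(α). -/
lemma proj_mono (i : ι) (j : ℕ) (x : WeightLat Φ) :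
    proj D i j (mono x) = if (D.m i : ℤ) ∣ wpair Φ x i - j then mono x else 0 := by
  have h1 : ∀ l : ℕ, ((((zetaU D i) ^ (-(j : ℤ))) ^ l : ℂˣ) : ℂ) •
      ((((zetaU D i) ^ l) ^ wpair Φ x i : ℂˣ) : ℂ) • (mono x : D.CP) =
      (((zetaU D i ^ (wpair Φ x i - j) : ℂˣ) : ℂ) ^ l) • mono x := by
    intro l
    rw [smul_smul, ← Units.val_mul, ← Units.val_pow_eq_pow_val]
    congr 2
    rw [← zpow_natCast, ← zpow_natCast, ← zpow_natCast, ← zpow_mul, ← zpow_mul, ← zpow_mul,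
      ← zpow_add]
    congr 1
    ring
  have hm : (D.m i : ℂ) ≠ 0 := by exact_mod_cast (D.m_pos i).ne'
  simp only [proj, LinearMap.smul_apply, LinearMap.sum_apply, AlgHom.toLinearMap_apply, theta_mono,
    h1, ← Finset.sum_smul]
  split_ifs with hd
  · rw [((zetaU_primitive D i).zpow_eq_one_iff_dvd _).2 hd]
    simp [smul_smul, hm]
  · have hne : zetaU D i ^ (wpair Φ x i - j) ≠ 1 := fun h =>
      hd (((zetaU_primitive D i).zpow_eq_one_iff_dvd _).1 h)
    have h2 : ((zetaU D i ^ (wpair Φ x i - j) : ℂˣ) : ℂ) ≠ 1 := by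
      rwa [Ne, Units.val_eq_one]
    rw [geom_sum_eq h2, ← Units.val_pow_eq_pow_val, ← zpow_natCast, ← zpow_mul, mul_comm, zpow_mul,
      zpow_natCast, (zetaU_primitive D i).pow_eq_one, one_zpow]
    simp

end Theta

end

/-! ### The operators σ(s_i) on ℂ(P). -/

section

variable {ι E : Type*} [NormedAddCommGroup E] [InnerProductSpace ℝ E]
variable {Φ : RootPairing ι ℝ E E}

section Span

variable [IsEuclidean Φ] [Φ.IsCrystallographic] (D : MetaplecticStructure Φ)

lemma m_dvd_n (i : ι) : D.m i ∣ D.n :=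
  ⟨Int.gcd D.n (D.Qroot i), (Nat.div_mul_cancel
    (Int.natCast_dvd_natCast.1 (Int.gcd_dvd_left _ _))).symm⟩

lemma n_nsmul_mem (x : WeightLat Φ) : D.n • (x : E) ∈ D.MetaWeightLat := by
  refine D.mem_metaWeightLat.2 fun i => ?_
  obtain ⟨c, hc⟩ := m_dvd_n D i
  refine ⟨c * wpair Φ x i, ?_⟩
  rw [← Nat.cast_smul_eq_nsmul ℝ, map_smul, LinearMap.smul_apply, wpair_spec, hc, smul_eq_mul]
  push_cast
  ring

/-- The subfield of `ℂ(P)` generated by the monomials `x^ν`, `ν ∈ Λ ∩ P^m`. -/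
def metaSub (Λ : AddSubgroup E) : IntermediateField ℂ D.CP :=
  IntermediateField.adjoin ℂ (monomials Φ (Λ ⊓ D.MetaWeightLat))

lemma monomials_mono {Λ Λ' : AddSubgroup E} (h : Λ ≤ Λ') : monomials Φ Λ ⊆ monomials Φ Λ' :=
  Set.image_mono fun _ hx => h hx

lemma mono_mem_monomials {Λ : AddSubgroup E} {x : WeightLat Φ} (hx : (x : E) ∈ Λ) :
    mono x ∈ monomials Φ Λ := ⟨x, hx, rfl⟩

lemma metaSub_le (Λ : AddSubgroup E) : metaSub D Λ ≤ ratSub Φ Λ :=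
  IntermediateField.adjoin.mono _ _ _ (monomials_mono inf_le_left)

lemma metaSub_le_range (Λ : AddSubgroup E) : metaSub D Λ ≤ D.incl.fieldRange := by
  rw [metaSub, IntermediateField.adjoin_le_iff]
  rintro _ ⟨x, hx, rfl⟩
  exact ⟨mono ⟨x, hx.2⟩, incl_mono D _⟩

/-- `ℂ(Λ)` is spanned by the monomials over the subfield of `P^m`-monomials. -/
lemma ratSub_le_span (Λ : AddSubgroup E) {v : D.CP} (hv : v ∈ ratSub Φ Λ) :
    v ∈ Submodule.span (metaSub D Λ) (monomials Φ Λ) := by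
  -- The n-th power of a monomial of Λ lies in the subfield, since nP ⊆ P^m. By algebraicity the
  -- field adjunction is a ring adjunction, and as monomials are closed under multiplication it is
  -- just a span.
  have halg : ∀ x ∈ monomials Φ Λ, IsAlgebraic (metaSub D Λ) x := by
    rintro _ ⟨x, hx, rfl⟩
    have h1 : mono (D.n • x) ∈ metaSub D Λ := by
      refine IntermediateField.subset_adjoin _ _ ⟨D.n • x, ⟨?_, ?_⟩, rfl⟩
      · exact Λ.nsmul_mem hx _
      · exact n_nsmul_mem D x
    refine IsAlgebraic.of_pow D.n_pos ?_
    rw [← mono_nsmul]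
    exact isAlgebraic_algebraMap (⟨_, h1⟩ : metaSub D Λ)
  have h1 : (IntermediateField.adjoin (metaSub D Λ) (monomials Φ Λ)).restrictScalars ℂ =
      ratSub Φ Λ := by
    rw [metaSub, IntermediateField.adjoin_adjoin_left, Set.union_eq_self_of_subset_left
      (monomials_mono inf_le_left)]
    rfl
  have h2 : v ∈ (IntermediateField.adjoin (metaSub D Λ) (monomials Φ Λ)).toSubalgebra := by
    rw [← h1] at hv; exact hv
  rw [IntermediateField.adjoin_toSubalgebra_of_isAlgebraic halg, ← Subalgebra.mem_toSubmodule,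
    Algebra.adjoin_eq_span] at h2
  have h3 : (Submonoid.closure (monomials Φ Λ) : Set D.CP) ⊆ monomials Φ Λ := by
    intro y hy
    induction hy using Submonoid.closure_induction with
    | mem x hx => exact hx
    | one => exact ⟨0, Λ.zero_mem, mono_zero⟩
    | mul x y _ _ hx hy =>
      obtain ⟨a, ha, rfl⟩ := hx
      obtain ⟨c, hc, rfl⟩ := hy
      exact ⟨a + c, Λ.add_mem ha hc, mono_add _ _⟩
  exact Submodule.span_mono h3 h2

lemma ratSub_weightLat : ratSub Φ (WeightLat Φ) = ⊤ := by
  rw [eq_top_iff]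
  intro v _
  have hp : ∀ p : GrpAlg (WeightLat Φ), algebraMap _ (RatFun (WeightLat Φ)) p ∈
      ratSub Φ (WeightLat Φ) := by
    intro p
    induction p using AddMonoidAlgebra.induction_linear with
    | zero => rw [map_zero]; exact zero_mem _
    | add p q hp hq => rw [map_add]; exact add_mem hp hq
    | single x c =>
      have : (AddMonoidAlgebra.single x c : GrpAlg (WeightLat Φ)) = c • monoP x := by simp [monoP]
      rw [this, algebraMap_smul_grpAlg]
      exact IntermediateField.smul_mem _
        (IntermediateField.subset_adjoin _ _ (mono_mem_monomials x.2))
  obtain ⟨p, q, hq, rfl⟩ := IsFractionRing.div_surjective (A := GrpAlg (WeightLat Φ)) v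
  exact div_mem (hp p) (hp q)

/-- Induction principle: `ℂ(Λ)` is spanned by the elements `f x^λ`. -/
lemma ratSub_induction (Λ : AddSubgroup E) {p : D.CP → Prop} (h0 : p 0)
    (hadd : ∀ u v, p u → p v → p (u + v))
    (h : ∀ (f) (x : WeightLat Φ), D.incl f ∈ metaSub D Λ → (x : E) ∈ Λ → p (D.incl f * mono x))
    {v : D.CP} (hv : v ∈ ratSub Φ Λ) : p v := by
  -- The predicate is only additive; proving it for all multiples a v lets the scalar step of the
  -- span induction go through.
  suffices hs : ∀ a ∈ metaSub D Λ, p (a * v) by simpa using hs 1 (one_mem _)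
  have hv' := ratSub_le_span D Λ hv
  clear hv
  induction hv' using Submodule.span_induction with
  | zero => intro a _; rwa [mul_zero]
  | add x y _ _ hx hy => intro a ha; rw [mul_add]; exact hadd _ _ (hx a ha) (hy a ha)
  | mem x hx =>
    intro a ha
    obtain ⟨y, hy, rfl⟩ := hx
    obtain ⟨f, rfl⟩ := metaSub_le_range D Λ ha
    exact h f y ha hy
  | smul c x _ hx =>
    intro a ha
    rw [Algebra.smul_def, ← mul_assoc]
    exact hx _ (mul_mem ha c.2)

/-- Induction principle: `ℂ(P)` is spanned by the elements `f x^λ`. -/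
lemma cp_induction {p : D.CP → Prop} (h0 : p 0) (hadd : ∀ u v, p u → p v → p (u + v))
    (h : ∀ f x, p (D.incl f * mono x)) (v : D.CP) : p v :=
  ratSub_induction D (WeightLat Φ) h0 hadd (fun f x _ _ => h f x) (by
    rw [ratSub_weightLat]; trivial)

end Span

/-- With X = x^{α^m}, a = x^α and p = x^{rα}, r being the remainder of -(λ, α^∨), this is the
identity σ(s_i)² x^λ = x^λ in the case that m(α) does not divide 1 - (λ, α^∨). The hypothesis `hG`
is q g_j g_{-j} = 1. -/
lemma cocycle_generic {F : Type*} [Field F] {q G G' X a p y : F} (hX : X ≠ 0) (ha : a ≠ 0)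
    (hp : p ≠ 0) (h1 : 1 - q * X ≠ 0) (h2 : 1 - q * X⁻¹ ≠ 0) (hG : q * (G * G') = 1) :
    (1 - q) / (1 - q * X⁻¹) * (((1 - q) * p⁻¹ + q * G * (1 - X⁻¹) * a) / (1 - q * X) * (p * y)) +
      q * G * (1 - X) / (1 - q * X⁻¹) *
        (((1 - q) * (p * a ^ 2 / X) + q * G' * (1 - X⁻¹) * a) / (1 - q * X) * (a⁻¹ * y)) = y := by
  have h2' : X - q ≠ 0 := by
    intro h; apply h2; field_simp; rw [h, mul_zero]
  field_simp
  linear_combination (-(q * X ^ 2 * y) + 2 * (q * X * y) - q * y) * hG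

/-- The case that m(α) divides 1 - (λ, α^∨), where both parameters g are -1 and p = X/a. The second
remainder wraps around, so a/X stands where the generic identity would have a. -/
lemma cocycle_special {F : Type*} [Field F] {q X a y : F} (hX : X ≠ 0) (ha : a ≠ 0)
    (h1 : 1 - q * X ≠ 0) (h2 : 1 - q * X⁻¹ ≠ 0) :
    (1 - q) / (1 - q * X⁻¹) * (((1 - q) * (X / a)⁻¹ + q * -1 * (1 - X⁻¹) * a) / (1 - q * X) *
      (X / a * y)) + q * -1 * (1 - X) / (1 - q * X⁻¹) *
        (((1 - q) * (a / X) + q * -1 * (1 - X⁻¹) * a) / (1 - q * X) * (a⁻¹ * y)) = y := by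
  have h2' : X - q ≠ 0 := by
    intro h; apply h2; field_simp; rw [h, mul_zero]
  field_simp
  ring

section Rep

variable [IsEuclidean Φ] [Φ.IsCrystallographic] (D : MetaplecticStructure Φ)
variable {k : Multiplicity Φ} (g : D.RepParameter k)

/-- The factor `C` in `σ(s_i)(f x^λ) = C · s_i (f x^λ)`, which depends only on `t = (λ, α_i^∨)`. -/
def cocyc (i : ι) (t : ℤ) : D.CP :=
  (algebraMap ℂ D.CP (1 - (k.val i : ℂ) ^ 2) * mono (-((-t) % D.m i) • rootW Φ i) +
    algebraMap ℂ D.CP ((k.val i : ℂ) ^ 2 * (g.g (D.Qroot i * (1 - t)) (D.size i) : ℂ)) *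
      (1 - mono (-D.metaRootP i)) * mono (rootW Φ i)) /
  (1 - algebraMap ℂ D.CP ((k.val i : ℂ) ^ 2) * mono (D.metaRootP i))

lemma Broot_eq (x : WeightLat Φ) (i : ι) : D.Broot x i = D.Qroot i * wpair Φ x i := by
  have := D.Broot_cast x i
  rw [D.B_root] at this
  exact_mod_cast this

lemma g_periodic (j l : ℤ) (y : RootSize) (h : (D.n : ℤ) ∣ j - l) : g.g j y = g.g l y := by
  rw [g.periodic j, g.periodic l, (Int.modEq_iff_dvd.2 h : l ≡ j [ZMOD D.n]).eq]

/-- Changing t by a multiple of m(α) changes the index of g by a multiple of m(α)Q(α), which n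
divides. -/
lemma cocyc_emod (i : ι) (t : ℤ) : cocyc D g i (t % D.m i) = cocyc D g i t := by
  have h1 : (-(t % (D.m i : ℤ))) % D.m i = (-t) % D.m i := by
    refine Int.ModEq.neg ?_
    exact Int.mod_modEq _ _
  have h2 : g.g (D.Qroot i * (1 - t % D.m i)) (D.size i) =
      g.g (D.Qroot i * (1 - t)) (D.size i) := by
    refine g_periodic D g _ _ _ ?_
    have : D.Qroot i * (1 - t % D.m i) - D.Qroot i * (1 - t) =
        D.m i * D.Qroot i * (t / D.m i) := by
      linear_combination (-D.Qroot i) * (Int.emod_add_mul_ediv t (D.m i))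
    rw [this]
    exact Dvd.dvd.mul_right (D.n_dvd_m_mul i) _
  rw [cocyc, cocyc, h1, h2]

/-- The point is that q(-λ) = (-t - r)/m(α), with t = (λ, α^∨) and r the remainder of -t, so that
x^{q(-λ)α^m} x^λ = x^{-rα} x^{s_i λ}. Both terms of the formula then contain s_i(f x^λ). -/
lemma sigmaFormula_eq (i : ι) (f : RatFun D.MetaWeightLat) (x : WeightLat Φ) :
    D.sigmaFormula g i f x = cocyc D g i (wpair Φ x i) * sRefl Φ i • (D.incl f * mono x) := by
  have e1 : mono (D.qPair (-x) i • D.metaRootP i) * mono x =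
      mono (-((-wpair Φ x i) % D.m i) • rootW Φ i) * mono (sRefl Φ i • x) := by
    rw [← mono_add, ← mono_add, refl_smul_weight, metaRootP_eq, smul_smul]
    have : D.qPair (-x) i * D.m i = -wpair Φ x i - (-wpair Φ x i) % D.m i := by
      rw [MetaplecticStructure.qPair, wpair_neg, Int.ediv_mul_cancel]
      exact Int.dvd_self_sub_emod
    rw [this]
    congr 1
    module
  have e2 : D.Qroot i - D.Broot x i = D.Qroot i * (1 - wpair Φ x i) := by rw [Broot_eq]; ring
  rw [MetaplecticStructure.sigmaFormula, cocyc, smul_mul', weyl_smul_incl, weyl_smul_mono, e2,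
    mono_add, map_sub _ (1 : ℂ), map_one]
  linear_combination (1 - algebraMap ℂ D.CP ((k.val i : ℂ) ^ 2)) /
    (1 - algebraMap ℂ D.CP ((k.val i : ℂ) ^ 2) * mono (D.metaRootP i)) *
    D.incl (sRefl Φ i • f) * e1

/-- The operator `σ(s_i)` on `ℂ(P)`. -/
def metaS (i : ι) : D.CP →ₗ[ℂ] D.CP :=
  ∑ j ∈ Finset.range (D.m i), LinearMap.mulLeft ℂ (cocyc D g i j) ∘ₗ
    (weylHom (WeightLat Φ) (sRefl Φ i)).toLinearMap ∘ₗ proj D i j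

lemma metaS_incl_mul (i : ι) (f : RatFun D.MetaWeightLat) (v : D.CP) :
    metaS D g i (D.incl f * v) = D.incl (sRefl Φ i • f) * metaS D g i v := by
  simp only [metaS, LinearMap.sum_apply, LinearMap.comp_apply, proj_incl_mul,
    LinearMap.mulLeft_apply, AlgHom.toLinearMap_apply, map_mul, Finset.mul_sum]
  refine Finset.sum_congr rfl fun j _ => ?_
  rw [weylHom_apply, weyl_smul_incl]
  ring

/-- Only the residue class of (λ, α^∨) contributes. Defining the operator through the projections
avoids a choice of basis: the products f x^λ are linearly dependent, so the formula on them alone is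
not yet a definition. -/
lemma metaS_mono (i : ι) (x : WeightLat Φ) :
    metaS D g i (mono x) = cocyc D g i (wpair Φ x i) * mono (sRefl Φ i • x) := by
  have hm : (0 : ℤ) < D.m i := by exact_mod_cast D.m_pos i
  have h0 := Int.emod_nonneg (wpair Φ x i) hm.ne'
  have h1 := Int.emod_lt_of_pos (wpair Φ x i) hm
  obtain ⟨l, hl⟩ := Int.eq_ofNat_of_zero_le h0
  simp only [metaS, LinearMap.sum_apply, LinearMap.comp_apply, proj_mono,
    LinearMap.mulLeft_apply, AlgHom.toLinearMap_apply]
  rw [Finset.sum_eq_single l]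
  · rw [if_pos, weylHom_apply, weyl_smul_mono, ← hl, cocyc_emod]
    rw [← hl]
    exact Int.dvd_self_sub_emod
  · intro j hj hjl
    rw [if_neg, map_zero, mul_zero]
    intro hd
    apply hjl
    have h2 : (j : ℤ) % D.m i = wpair Φ x i % D.m i := (Int.modEq_iff_dvd.2 hd).eq
    rw [Int.emod_eq_of_lt (by omega) (by exact_mod_cast Finset.mem_range.1 hj)] at h2
    omega
  · intro h
    exact absurd (Finset.mem_range.2 (by omega)) h

lemma metaS_apply (i : ι) (f : RatFun D.MetaWeightLat) (x : WeightLat Φ) :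
    metaS D g i (D.incl f * mono x) = D.sigmaFormula g i f x := by
  rw [metaS_incl_mul, metaS_mono, sigmaFormula_eq, smul_mul', weyl_smul_incl, weyl_smul_mono]
  ring

lemma dvd_of_n_dvd_iff (i : ι) (c : ℤ) : (D.n : ℤ) ∣ D.Qroot i * c ↔ (D.m i : ℤ) ∣ c := by
  refine ⟨D.dvd_of_n_dvd, ?_⟩
  rintro ⟨d, rfl⟩
  rw [← mul_assoc, mul_comm (D.Qroot i)]
  exact Dvd.dvd.mul_right (D.n_dvd_m_mul i) _

lemma g_mul_neg (i : ι) (j : ℤ) (h : ¬ (D.n : ℤ) ∣ j) :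
    (k.val i : ℂ) ^ 2 * ((g.g j (D.size i) : ℂ) * (g.g (-j) (D.size i) : ℂ)) = 1 := by
  have h1 := g.mul_eq j i h
  rw [g_periodic D g (D.n - j) (-j) _ ⟨1, by ring⟩] at h1
  rw [← Units.val_mul, h1, ← Units.val_pow_eq_pow_val, ← Units.val_mul, mul_inv_cancel,
    Units.val_one]

variable [Finite ι] [Φ.IsRootSystem] [Φ.IsReduced]

/-- The first application gives monomials with pairings -2r - t and 2 - t. The former is congruent
to t modulo m(α), so the second application reuses the same cocycle there, and the whole becomes one
rational identity in x^α and x^{α^m}. -/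
lemma metaS_sq_mono (i : ι) (x : WeightLat Φ) : metaS D g i (metaS D g i (mono x)) = mono x := by
  set q : ℂ := (k.val i : ℂ) ^ 2 with hq
  set t := wpair Φ x i with ht
  set r := (-t) % D.m i with hr
  set G : ℂ := (g.g (D.Qroot i * (1 - t)) (D.size i) : ℂ) with hG
  set Xm : RatFun D.MetaWeightLat := mono (D.metaRootW i) with hXm
  set qm := algebraMap ℂ (RatFun D.MetaWeightLat) q with hqm
  have hm : (0 : ℤ) < D.m i := by exact_mod_cast D.m_pos i
  have hX : D.incl Xm = mono (D.metaRootP i) := incl_mono_metaRootW D i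
  have hqi : D.incl qm = algebraMap ℂ D.CP q := D.incl.commutes q
  have hsX : sRefl Φ i • Xm = Xm⁻¹ := sRefl_smul_mono_self D i
  have hsq : sRefl Φ i • qm = qm := (weylHom D.MetaWeightLat (sRefl Φ i)).commutes q
  have e1 : metaS D g i (mono x) =
      D.incl ((1 - qm) / (1 - qm * Xm)) * mono (-r • rootW Φ i + sRefl Φ i • x) +
      D.incl (qm * algebraMap ℂ _ G * (1 - Xm⁻¹) / (1 - qm * Xm)) *
        mono (rootW Φ i + sRefl Φ i • x) := by
    rw [metaS_mono, cocyc, ← ht, ← hr, ← hG, ← hq]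
    simp only [mono_add, map_div₀, map_sub, map_mul, map_one, map_inv₀, hX, hqi, AlgHom.commutes,
      mono_neg]
    ring
  have hs : ∀ f : RatFun D.MetaWeightLat, sRefl Φ i • f = weylHom D.MetaWeightLat (sRefl Φ i) f :=
    fun _ => rfl
  have f1 : sRefl Φ i • ((1 - qm) / (1 - qm * Xm)) = (1 - qm) / (1 - qm * Xm⁻¹) := by
    rw [hs] at hsX hsq ⊢
    rw [map_div₀, map_sub, map_sub, map_mul, map_one, hsX, hsq]
  have f2 : sRefl Φ i • (qm * algebraMap ℂ _ G * (1 - Xm⁻¹) / (1 - qm * Xm)) =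
      qm * algebraMap ℂ _ G * (1 - Xm) / (1 - qm * Xm⁻¹) := by
    rw [hs] at hsX hsq ⊢
    rw [map_div₀, map_sub, map_mul, map_mul, map_mul, map_sub, map_one, map_inv₀, hsX, hsq,
      inv_inv, AlgHom.commutes]
  have hroot : sRefl Φ i • rootW Φ i = - rootW Φ i := by
    rw [refl_smul_weight, wpair_rootW_self]; module
  have hxx : sRefl Φ i • sRefl Φ i • x = x := by rw [← mul_smul, sRefl_mul_self, one_smul]
  have w1 : wpair Φ (-r • rootW Φ i + sRefl Φ i • x) i = -(2 * r) - t := by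
    rw [wpair_add, wpair_zsmul, wpair_rootW_self, wpair_sRefl_self]; ring
  have w2 : wpair Φ (rootW Φ i + sRefl Φ i • x) i = 2 - t := by
    rw [wpair_add, wpair_rootW_self, wpair_sRefl_self]; ring
  have c1 : cocyc D g i (-(2 * r) - t) = cocyc D g i t := by
    rw [← cocyc_emod, ← cocyc_emod D g i t]
    congr 1
    refine Int.ModEq.symm (Int.modEq_iff_dvd.2 ?_)
    have h1 : (D.m i : ℤ) ∣ -t - r := Int.dvd_self_sub_emod
    have : -(2 * r) - t - t = 2 * (-t - r) := by ring
    rw [this]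
    exact Dvd.dvd.mul_left h1 _
  have a1 : sRefl Φ i • (-r • rootW Φ i + sRefl Φ i • x) = r • rootW Φ i + x := by
    rw [smul_add, hxx, smul_comm, hroot]; module
  have a2 : sRefl Φ i • (rootW Φ i + sRefl Φ i • x) = - rootW Φ i + x := by
    rw [smul_add, hxx, hroot]
  rw [e1, map_add, metaS_incl_mul, metaS_incl_mul, metaS_mono, metaS_mono, w1, w2, c1, a1, a2, f1,
    f2, cocyc, cocyc]
  have hX0 : mono (D.metaRootP i) ≠ 0 := mono_ne_zero _
  have ha0 : mono (rootW Φ i) ≠ 0 := mono_ne_zero _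
  have n1 : 1 - algebraMap ℂ D.CP q * mono (D.metaRootP i) ≠ 0 :=
    one_sub_mul_mono_ne_zero q (metaRootP_ne_zero D i)
  have n2 : 1 - algebraMap ℂ D.CP q * (mono (D.metaRootP i))⁻¹ ≠ 0 := by
    rw [← mono_neg]
    exact one_sub_mul_mono_ne_zero q (neg_ne_zero.2 (metaRootP_ne_zero D i))
  simp only [map_div₀, map_sub, map_mul, map_one, map_inv₀, hX, hqi, AlgHom.commutes, ← hq, ← hG,
    ← hr, mono_neg, mono_add, neg_smul, mono_zsmul]
  rw [show D.Qroot i * (1 - (2 - t)) = - (D.Qroot i * (1 - t)) by ring]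
  set G' : ℂ := (g.g (-(D.Qroot i * (1 - t))) (D.size i) : ℂ) with hG'
  -- Equivalently n divides the index of g, which separates g = -1 from q g_j g_{-j} = 1.
  by_cases hd : (D.m i : ℤ) ∣ 1 - t
  · have hnd := (dvd_of_n_dvd_iff D i (1 - t)).2 hd
    have g1 : G = -1 := by rw [hG, g.eq_neg_one _ _ hnd]; simp
    have g2 : G' = -1 := by rw [hG', g.eq_neg_one _ _ ((dvd_neg).2 hnd)]; simp
    have hr1 : r = D.m i - 1 := by
      rw [hr]
      obtain ⟨d, hd⟩ := hd
      rw [show -t = (D.m i - 1) + D.m i * (d - 1) by linear_combination hd,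
        Int.add_mul_emod_self_left, Int.emod_eq_of_lt (by omega) (by omega)]
    have hr2 : (-(2 - t)) % D.m i = D.m i - 1 := by
      obtain ⟨d, hd⟩ := hd
      rw [show -(2 - t) = (D.m i - 1) + D.m i * (- d - 1) by linear_combination -hd,
        Int.add_mul_emod_self_left, Int.emod_eq_of_lt (by omega) (by omega)]
    rw [hr1, hr2, g1, g2, zpow_sub₀ ha0, ← mono_metaRootP, zpow_one, inv_div]
    have := cocycle_special (q := algebraMap ℂ D.CP q) (y := mono x) hX0 ha0 n1 n2
    rw [inv_div] at this
    simpa only [map_neg, map_one] using this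
  · have hnd : ¬ (D.n : ℤ) ∣ D.Qroot i * (1 - t) := fun h => hd (D.dvd_of_n_dvd h)
    have hgg : q * (G * G') = 1 := g_mul_neg D g i _ hnd
    have hr2 : -((-(2 - t)) % (D.m i : ℤ)) = r + 2 - D.m i := by
      have hr0 := Int.emod_nonneg (-t) hm.ne'
      have hr1 := Int.emod_lt_of_pos (-t) hm
      have h3 := Int.mul_ediv_add_emod (-t) (D.m i)
      rw [← hr] at hr0 hr1 h3
      -- r = m(α) - 1 is exactly the excluded case; otherwise m(α) - 2 - r is nonnegative and is the
      -- remainder of t - 2.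
      have hne : r ≠ D.m i - 1 := by
        intro h
        apply hd
        exact ⟨(-t) / D.m i + 1, by rw [h] at h3; linear_combination -h3⟩
      rw [show -(2 - t) = (D.m i - 2 - r) + D.m i * (- ((-t) / D.m i) - 1) by
        linear_combination h3, Int.add_mul_emod_self_left,
        Int.emod_eq_of_lt (by omega) (by omega)]
      ring
    have hp2 : (mono (rootW Φ i) ^ ((-(2 - t)) % (D.m i : ℤ)))⁻¹ =
        mono (rootW Φ i) ^ r * mono (rootW Φ i) ^ 2 / mono (D.metaRootP i) := by
      rw [← zpow_neg, hr2, zpow_sub₀ ha0, zpow_add₀ ha0, ← mono_metaRootP]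
      rfl
    rw [hp2]
    have hG2 : algebraMap ℂ D.CP q * (algebraMap ℂ D.CP G * algebraMap ℂ D.CP G') = 1 := by
      rw [← map_mul, ← map_mul, hgg, map_one]
    exact cocycle_generic hX0 ha0 (zpow_ne_zero _ ha0) n1 n2 hG2

lemma incl_sRefl_sRefl (i : ι) (f : RatFun D.MetaWeightLat) :
    sRefl Φ i • sRefl Φ i • f = f := by rw [← mul_smul, sRefl_mul_self, one_smul]

/-- `ℂ(P^m)` acts on `ℂ(P)` by multiplication. -/
def multHom : RatFun D.MetaWeightLat →ₐ[ℂ] Module.End ℂ D.CP :=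
  (Algebra.lmul ℂ D.CP).comp D.incl

lemma multHom_apply (f : RatFun D.MetaWeightLat) (v : D.CP) :
    multHom D f v = D.incl f * v := rfl

lemma metaS_implements (i : ι) :
    Implements (multHom D) (weylHom D.MetaWeightLat (sRefl Φ i)) (metaS D g i) where
  comm f := by
    refine LinearMap.ext fun v => ?_
    exact metaS_incl_mul D g i f v
  sq := by
    refine LinearMap.ext fun v => ?_
    change metaS D g i (metaS D g i v) = v
    induction v using cp_induction D with
    | h0 => rw [map_zero, map_zero]
    | hadd u v hu hv => rw [map_add, map_add, hu, hv]
    | h f x => rw [metaS_incl_mul, metaS_incl_mul, metaS_sq_mono, incl_sRefl_sRefl]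

end Rep

end

/-! ### Braid words acting along chains of weights, and representatives of P modulo P^m. -/

section

section Chain

variable {K V X : Type*} [Field K] [AddCommGroup V] [Module K V]

/-- The operator `T` maps `e(ν)` to a multiple of `e(s ν)` for `ν` in a domain with `t(ν) ≥ 0`. -/
def StepsDown (T : Module.End K V) (e : X → V) (dom : X → Prop) (s : X → X) (t t' : X → ℤ)
    (f : ℤ → K) (a : ℤ) : Prop :=
  ∀ ν p r, dom ν → t ν = p → t' ν = r → 0 ≤ p →
    T (e ν) = f p • e (s ν) ∧ dom (s ν) ∧ t (s ν) = -p ∧ t' (s ν) = r - p * a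

variable {T₁ T₂ : Module.End K V} {e : X → V} {dom : X → Prop} {s₁ s₂ : X → X} {t₁ t₂ : X → ℤ}
  {f₁ f₂ : ℤ → K} {a₁ a₂ : ℤ}

/-- Both words carry ν to the same element and collect the same scalars in opposite orders. This
holds for every m below: the pairings met along one reduced word of the longest element are those
met along the other, reversed. -/
lemma StepsDown.braid_two (h₁ : StepsDown T₁ e dom s₁ t₁ t₂ f₁ 0)
    (h₂ : StepsDown T₂ e dom s₂ t₂ t₁ f₂ 0) {ν : X} (hd : dom ν) (h1 : 0 ≤ t₁ ν) (h2 : 0 ≤ t₂ ν)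
    (hs : s₁ (s₂ ν) = s₂ (s₁ ν)) : altProd T₁ T₂ 2 (e ν) = altProd T₂ T₁ 2 (e ν) := by
  obtain ⟨p, hp⟩ : ∃ p, t₁ ν = p := ⟨_, rfl⟩
  obtain ⟨r, hr⟩ : ∃ r, t₂ ν = r := ⟨_, rfl⟩
  rw [hp] at h1
  rw [hr] at h2
  obtain ⟨A1, A2, A3, A4⟩ := h₁ ν p r hd hp hr h1
  obtain ⟨B1, -, -, -⟩ := h₂ (s₁ ν) r (-p) A2 (by omega) (by omega) (by omega)
  obtain ⟨C1, C2, C3, C4⟩ := h₂ ν r p hd hr hp h2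
  obtain ⟨D1, -, -, -⟩ := h₁ (s₂ ν) p (-r) C2 (by omega) (by omega) (by omega)
  simp only [altProd, Module.End.mul_apply, Module.End.one_apply, A1, B1, C1, D1, map_smul,
    smul_smul, hs]
  congr 1; ring

lemma StepsDown.braid_three (h₁ : StepsDown T₁ e dom s₁ t₁ t₂ f₁ (-1))
    (h₂ : StepsDown T₂ e dom s₂ t₂ t₁ f₁ (-1)) {ν : X} (hd : dom ν) (h1 : 0 ≤ t₁ ν)
    (h2 : 0 ≤ t₂ ν) (hs : s₁ (s₂ (s₁ ν)) = s₂ (s₁ (s₂ ν))) :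
    altProd T₁ T₂ 3 (e ν) = altProd T₂ T₁ 3 (e ν) := by
  obtain ⟨p, hp⟩ : ∃ p, t₁ ν = p := ⟨_, rfl⟩
  obtain ⟨r, hr⟩ : ∃ r, t₂ ν = r := ⟨_, rfl⟩
  rw [hp] at h1
  rw [hr] at h2
  obtain ⟨A1, A2, A3, A4⟩ := h₁ ν p r hd hp hr h1
  obtain ⟨B1, B2, B3, B4⟩ := h₂ _ (p + r) (-p) A2 (by omega) (by omega) (by omega)
  obtain ⟨E1, -, -, -⟩ := h₁ _ r (-(p + r)) B2 (by omega) (by omega) (by omega)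
  obtain ⟨C1, C2, C3, C4⟩ := h₂ ν r p hd hr hp h2
  obtain ⟨D1, D2, D3, D4⟩ := h₁ _ (p + r) (-r) C2 (by omega) (by omega) (by omega)
  obtain ⟨F1, -, -, -⟩ := h₂ _ p (-(p + r)) D2 (by omega) (by omega) (by omega)
  simp only [altProd, Module.End.mul_apply, Module.End.one_apply, A1, B1, C1, D1, E1, F1, map_smul,
    smul_smul, hs]
  congr 1; ring

lemma StepsDown.braid_four (h₁ : StepsDown T₁ e dom s₁ t₁ t₂ f₁ (-1))
    (h₂ : StepsDown T₂ e dom s₂ t₂ t₁ f₂ (-2)) {ν : X} (hd : dom ν) (h1 : 0 ≤ t₁ ν)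
    (h2 : 0 ≤ t₂ ν) (hs : s₁ (s₂ (s₁ (s₂ ν))) = s₂ (s₁ (s₂ (s₁ ν)))) :
    altProd T₁ T₂ 4 (e ν) = altProd T₂ T₁ 4 (e ν) := by
  obtain ⟨p, hp⟩ : ∃ p, t₁ ν = p := ⟨_, rfl⟩
  obtain ⟨r, hr⟩ : ∃ r, t₂ ν = r := ⟨_, rfl⟩
  rw [hp] at h1
  rw [hr] at h2
  obtain ⟨A1, A2, A3, A4⟩ := h₁ ν p r hd hp hr h1
  obtain ⟨B1, B2, B3, B4⟩ := h₂ _ (p + r) (-p) A2 (by omega) (by omega) (by omega)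
  obtain ⟨E1, E2, E3, E4⟩ := h₁ _ (p + 2 * r) (-(p + r)) B2 (by omega) (by omega) (by omega)
  obtain ⟨G1, -, -, -⟩ := h₂ _ r (-(p + 2 * r)) E2 (by omega) (by omega) (by omega)
  obtain ⟨C1, C2, C3, C4⟩ := h₂ ν r p hd hr hp h2
  obtain ⟨D1, D2, D3, D4⟩ := h₁ _ (p + 2 * r) (-r) C2 (by omega) (by omega) (by omega)
  obtain ⟨F1, F2, F3, F4⟩ := h₂ _ (p + r) (-(p + 2 * r)) D2 (by omega) (by omega) (by omega)
  obtain ⟨H1, -, -, -⟩ := h₁ _ p (-(p + r)) F2 (by omega) (by omega) (by omega)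
  simp only [altProd, Module.End.mul_apply, Module.End.one_apply, A1, B1, C1, D1, E1, F1, G1, H1,
    map_smul, smul_smul, hs]
  congr 1; ring

/-- c₀, …, c₅ are the successive pairings met along the word. In the application they are the
pairings of the weight with the six positive coroots, so dominance makes them nonnegative. -/
lemma StepsDown.altProd_six (h₁ : StepsDown T₁ e dom s₁ t₁ t₂ f₁ a₁)
    (h₂ : StepsDown T₂ e dom s₂ t₂ t₁ f₂ a₂) {ν : X} (hd : dom ν) {c₀ c₁ c₂ c₃ c₄ c₅ : ℤ}
    (h0 : t₁ ν = c₀) (h1 : t₂ ν = c₁ + c₀ * a₁) (h2 : c₂ = -c₀ - c₁ * a₂)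
    (h3 : c₃ = -c₁ - c₂ * a₁) (h4 : c₄ = -c₂ - c₃ * a₂) (h5 : c₅ = -c₃ - c₄ * a₁)
    (hp : 0 ≤ c₀ ∧ 0 ≤ c₁ ∧ 0 ≤ c₂ ∧ 0 ≤ c₃ ∧ 0 ≤ c₄ ∧ 0 ≤ c₅) :
    altProd T₂ T₁ 6 (e ν) = (f₁ c₀ * (f₂ c₁ * (f₁ c₂ * (f₂ c₃ * (f₁ c₄ * f₂ c₅))))) •
      e (s₂ (s₁ (s₂ (s₁ (s₂ (s₁ ν)))))) := by
  obtain ⟨p0, p1, p2, p3, p4, p5⟩ := hp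
  obtain ⟨A1, A2, A3, A4⟩ := h₁ ν _ _ hd h0 h1 p0
  rw [add_sub_cancel_right] at A4
  obtain ⟨B1, B2, B3, B4⟩ := h₂ _ _ _ A2 A4 A3 p1
  rw [← h2] at B4
  obtain ⟨C1, C2, C3, C4⟩ := h₁ _ _ _ B2 B4 B3 p2
  rw [← h3] at C4
  obtain ⟨D1, D2, D3, D4⟩ := h₂ _ _ _ C2 C4 C3 p3
  rw [← h4] at D4
  obtain ⟨E1, E2, E3, E4⟩ := h₁ _ _ _ D2 D4 D3 p4
  rw [← h5] at E4
  obtain ⟨F1, -, -, -⟩ := h₂ _ _ _ E2 E4 E3 p5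
  change T₂ (T₁ (T₂ (T₁ (T₂ (T₁ (e ν)))))) = _
  rw [A1, map_smul, map_smul, map_smul, map_smul, map_smul, B1, map_smul, map_smul, map_smul,
    map_smul, C1, map_smul, map_smul, map_smul, D1, map_smul, map_smul, E1, map_smul, F1]
  rw [mul_smul, mul_smul, mul_smul, mul_smul, mul_smul]

lemma StepsDown.braid_six (h₁ : StepsDown T₁ e dom s₁ t₁ t₂ f₁ (-1))
    (h₂ : StepsDown T₂ e dom s₂ t₂ t₁ f₂ (-3)) {ν : X} (hd : dom ν) (h1 : 0 ≤ t₁ ν)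
    (h2 : 0 ≤ t₂ ν)
    (hs : s₁ (s₂ (s₁ (s₂ (s₁ (s₂ ν))))) = s₂ (s₁ (s₂ (s₁ (s₂ (s₁ ν)))))) :
    altProd T₁ T₂ 6 (e ν) = altProd T₂ T₁ 6 (e ν) := by
  obtain ⟨p, hp⟩ : ∃ p, t₁ ν = p := ⟨_, rfl⟩
  obtain ⟨r, hr⟩ : ∃ r, t₂ ν = r := ⟨_, rfl⟩
  rw [hp] at h1
  rw [hr] at h2
  rw [h₁.altProd_six h₂ hd (c₀ := p) (c₁ := p + r) (c₂ := 2 * p + 3 * r) (c₃ := p + 2 * r)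
      (c₄ := p + 3 * r) (c₅ := r) hp (by omega) (by omega) (by omega) (by omega) (by omega)
      (by omega),
    h₂.altProd_six h₁ hd (c₀ := r) (c₁ := p + 3 * r) (c₂ := p + 2 * r) (c₃ := 2 * p + 3 * r)
      (c₄ := p + r) (c₅ := p) hr (by omega) (by omega) (by omega) (by omega) (by omega)
      (by omega), hs]
  congr 1
  ring

variable {A : Type*} [Ring A] [Algebra K A]

/-- The braid defect `L` of two elements with quadratic relations satisfies `L T₁ = U L` for some
`U`. -/
lemma braid_sub_mul {T₁ T₂ : A} {q₁ q₂ : K} (hq₁ : T₁ * T₁ = (q₁ - 1) • T₁ + q₁ • 1)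
    (hq₂ : T₂ * T₂ = (q₂ - 1) • T₂ + q₂ • 1) {m : ℕ}
    (hm : m = 2 ∨ (m = 3 ∧ q₁ = q₂) ∨ m = 4 ∨ m = 6) :
    ∃ U : A, (altProd T₁ T₂ m - altProd T₂ T₁ m) * T₁ =
      U * (altProd T₁ T₂ m - altProd T₂ T₁ m) := by
  have h1 : ∀ x, T₁ * (T₁ * x) = (q₁ - 1) • (T₁ * x) + q₁ • x := fun x => by
    rw [← mul_assoc, hq₁, add_mul, smul_mul_assoc, smul_mul_assoc, one_mul]
  have h2 : ∀ x, T₂ * (T₂ * x) = (q₂ - 1) • (T₂ * x) + q₂ • x := fun x => by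
    rw [← mul_assoc, hq₂, add_mul, smul_mul_assoc, smul_mul_assoc, one_mul]
  rcases hm with rfl | ⟨rfl, rfl⟩ | rfl | rfl
  -- By the quadratic relation, (q₁ - 1 - T₁) T₁ = -q₁, so U plays the role of -q₁T₁⁻¹. For odd m
  -- the longest word exchanges the two generators, which is why T₂ and equal parameters appear
  -- there.
  · refine ⟨algebraMap K A (q₁ - 1) - T₁, ?_⟩
    rw [sub_mul (algebraMap K A _), ← Algebra.smul_def]
    simp only [altProd, mul_one, sub_mul, mul_sub, mul_assoc, mul_add, mul_smul_comm, hq₁, h1]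
    module
  · refine ⟨algebraMap K A (q₁ - 1) - T₂, ?_⟩
    rw [sub_mul (algebraMap K A _), ← Algebra.smul_def]
    simp only [altProd, mul_one, sub_mul, mul_sub, mul_assoc, mul_add, mul_smul_comm, hq₁, h2]
    module
  · refine ⟨algebraMap K A (q₁ - 1) - T₁, ?_⟩
    rw [sub_mul (algebraMap K A _), ← Algebra.smul_def]
    simp only [altProd, mul_one, sub_mul, mul_sub, mul_assoc, mul_add, mul_smul_comm, hq₁, h1]
    module
  · refine ⟨algebraMap K A (q₁ - 1) - T₁, ?_⟩
    rw [sub_mul (algebraMap K A _), ← Algebra.smul_def]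
    simp only [altProd, mul_one, sub_mul, mul_sub, mul_assoc, mul_add, mul_smul_comm, hq₁, h1]
    module

lemma braid_sub_mul' {T₁ T₂ : A} {q₁ q₂ : K} (hq₁ : T₁ * T₁ = (q₁ - 1) • T₁ + q₁ • 1)
    (hq₂ : T₂ * T₂ = (q₂ - 1) • T₂ + q₂ • 1) {m : ℕ}
    (hm : m = 2 ∨ (m = 3 ∧ q₂ = q₁) ∨ m = 4 ∨ m = 6) :
    ∃ U : A, (altProd T₁ T₂ m - altProd T₂ T₁ m) * T₂ =
      U * (altProd T₁ T₂ m - altProd T₂ T₁ m) := by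
  obtain ⟨U, hU⟩ := braid_sub_mul hq₂ hq₁ hm
  refine ⟨U, ?_⟩
  rw [← neg_sub, neg_mul, hU, mul_neg]

end Chain

variable {ι E : Type*} [NormedAddCommGroup E] [InnerProductSpace ℝ E]
variable {Φ : RootPairing ι ℝ E E}

section Domain

variable [IsEuclidean Φ] [Φ.IsCrystallographic] (D : MetaplecticStructure Φ)

/-- The weights `μ` with `|(μ, α^∨)| ≤ m(α)` for all roots `α`. -/
def InDomain (x : WeightLat Φ) : Prop := ∀ j, |wpair Φ x j| ≤ D.m j

lemma InDomain.weyl {x : WeightLat Φ} (h : InDomain D x) (w : Φ.weylGroup) :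
    InDomain D (w • x) := by
  intro j
  have := h (w⁻¹ • j)
  rwa [← wpair_weyl w, smul_inv_smul, D.m_weyl] at this

variable [Finite ι] [Φ.IsRootSystem] [Φ.IsReduced]

lemma wpair_sRefl (x : WeightLat Φ) (i j : ι) :
    wpair Φ (sRefl Φ i • x) j = wpair Φ x j - wpair Φ x i * Φ.pairingIn ℤ i j := by
  rw [refl_smul_weight, wpair_sub, wpair_zsmul, wpair_rootW]

/-- Every coset of `P^m` in `P` meets the domain. -/
lemma exists_inDomain (x : WeightLat Φ) : ∃ ν : D.MetaWeightLat, InDomain D (x + D.toWeight ν) := by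
  classical
  let := Fintype.ofFinite ι
  let N : WeightLat Φ → ℤ := fun y => ∑ l, wpair Φ y l ^ 2
  have hN : ∀ y, 0 ≤ N y := fun y => Finset.sum_nonneg fun l _ => sq_nonneg _
  -- The representative of the coset is chosen to minimise N, a sum of squares over all coroots.
  obtain ⟨ν, -, hν⟩ := WellFounded.has_min
    (measure fun ν : D.MetaWeightLat => (N (x + D.toWeight ν)).toNat).wf Set.univ ⟨0, trivial⟩
  refine ⟨ν, fun j => ?_⟩
  by_contra hj
  set y := x + D.toWeight ν with hy
  set t := wpair Φ y j with ht
  have hm : (0 : ℤ) < D.m j := by exact_mod_cast D.m_pos j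
  obtain ⟨ε, hε, hεt⟩ : ∃ ε : ℤ, ε ^ 2 = 1 ∧ D.m j < ε * t := by
    rcases abs_cases t with h | h
    · exact ⟨1, by norm_num, by omega⟩
    · exact ⟨-1, by norm_num, by omega⟩
  set S := ∑ l, Φ.pairingIn ℤ j l ^ 2 with hS
  have hS0 : 0 < S := by
    refine Finset.sum_pos' (fun l _ => sq_nonneg _) ⟨j, Finset.mem_univ _, ?_⟩
    rw [RootPairing.pairingIn_same]; norm_num
  -- Reindexing by s_j shows that the form attached to N is invariant under s_j; invariance
  -- determines its value on (y, α_j) as half of t times its value on (α_j, α_j).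
  have hmix : 2 * ∑ l, wpair Φ y l * Φ.pairingIn ℤ j l = t * S := by
    have h1 : ∑ l, wpair Φ (sRefl Φ j • y) l * wpair Φ (sRefl Φ j • rootW Φ j) l =
        ∑ l, wpair Φ y l * wpair Φ (rootW Φ j) l := by
      refine (Fintype.sum_equiv (MulAction.toPerm (sRefl Φ j)) _ _ fun l => ?_).symm
      rw [MulAction.toPerm_apply, wpair_weyl, wpair_weyl]
    have h2 : ∀ l, wpair Φ (sRefl Φ j • y) l * wpair Φ (sRefl Φ j • rootW Φ j) l =
        t * Φ.pairingIn ℤ j l ^ 2 - wpair Φ y l * Φ.pairingIn ℤ j l := by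
      intro l
      rw [wpair_sRefl, wpair_sRefl, wpair_rootW, wpair_rootW, RootPairing.pairingIn_same, ← ht]
      ring
    simp only [h2, wpair_rootW, Finset.sum_sub_distrib, ← Finset.mul_sum] at h1
    linarith
  apply hν (ν - ε • D.metaRootW j) trivial
  change (N (x + D.toWeight (ν - ε • D.metaRootW j))).toNat < (N y).toNat
  -- Moving by ε α_j^m lowers N by m(α_j) S (ε t - m(α_j)), which is positive by the choice of ε.
  have hlt : N (x + D.toWeight (ν - ε • D.metaRootW j)) < N y := by
    have h1 : ∀ l, wpair Φ (x + D.toWeight (ν - ε • D.metaRootW j)) l ^ 2 = wpair Φ y l ^ 2 -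
        (ε * D.m j) * (2 * (wpair Φ y l * Φ.pairingIn ℤ j l)) +
        (D.m j : ℤ) ^ 2 * Φ.pairingIn ℤ j l ^ 2 := by
      intro l
      have h2 : x + D.toWeight (ν - ε • D.metaRootW j) = y - (ε * D.m j) • rootW Φ j := by
        rw [map_sub, map_zsmul, hy, mul_smul, ← metaRootP_eq, add_sub_assoc]
        rfl
      rw [h2, wpair_sub, wpair_zsmul, wpair_rootW]
      linear_combination (D.m j : ℤ) ^ 2 * Φ.pairingIn ℤ j l ^ 2 * hε
    change ∑ l, _ < ∑ l, _
    simp only [h1, Finset.sum_add_distrib, Finset.sum_sub_distrib, ← Finset.mul_sum]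
    rw [hmix, ← hS]
    have : 0 < (D.m j : ℤ) * S * (ε * t - D.m j) := by
      have : 0 < ε * t - D.m j := by omega
      positivity
    linarith
  have := hN (x + D.toWeight (ν - ε • D.metaRootW j))
  omega

end Domain

section Shift

variable [IsEuclidean Φ] [Φ.IsCrystallographic] (D : MetaplecticStructure Φ)
variable [Finite ι] [Φ.IsRootSystem] [Φ.IsReduced] (b : Φ.Base)

lemma sRefl_smul_rho (i : b.support) : sRefl Φ i • D.rho b = D.rho b - D.metaRootW i :=
  Subtype.ext (D.refl_smul_rhoVec b i.2)

lemma wpair_rho (i : b.support) : wpair Φ (D.toWeight (D.rho b)) i = D.m i := by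
  have h1 := congrArg D.toWeight (sRefl_smul_rho D b i)
  rw [← weyl_smul_toWeight, refl_smul_weight, map_sub, sub_right_inj] at h1
  have h2 : D.toWeight (D.metaRootW i) = (D.m i : ℤ) • rootW Φ i := metaRootP_eq D i
  rw [h2] at h1
  have h3 := congrArg (fun x => wpair Φ x i) h1
  simp only [wpair_zsmul, wpair_rootW_self] at h3
  omega

/-- The structure with `n = 1`, for which `ρ^m = ρ`. -/
def unitStructure : MetaplecticStructure Φ := { D with n := 1, n_pos := one_pos }

/-- The weight `ρ - ρ^m`. -/
def shiftW : WeightLat Φ :=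
  (unitStructure D).toWeight ((unitStructure D).rho b) - D.toWeight (D.rho b)

lemma wpair_shiftW (i : b.support) : wpair Φ (shiftW D b) i = 1 - D.m i := by
  have : (unitStructure D).m i = 1 := by
    change 1 / Int.gcd ((1 : ℕ) : ℤ) _ = 1
    simp
  rw [shiftW, wpair_sub, wpair_rho, wpair_rho, this]
  rfl

end Shift

end

/-! ### Braid relations for the operators σ(s_i). -/

section

variable {ι E : Type*} [NormedAddCommGroup E] [InnerProductSpace ℝ E]
variable {Φ : RootPairing ι ℝ E E}

section MetaBraid

variable [IsEuclidean Φ] [Φ.IsCrystallographic] (D : MetaplecticStructure Φ)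
variable {k : Multiplicity Φ} (g : D.RepParameter k)
variable [Finite ι] [Φ.IsRootSystem] [Φ.IsReduced] {b : Φ.Base}

/-- The Demazure-Lusztig operators `k_i τ(T_i)` on `ℂ(P)`. -/
def metaT (i : b.support) : Module.End ℂ D.CP :=
  dlElt D k (multHom D) (fun i : b.support => metaS D g i) i

lemma metaT_apply (i : b.support) (v : D.CP) : metaT D g i v =
    (algebraMap ℂ D.CP ((k.val i : ℂ) ^ 2) - D.incl (D.cFun k i)) * v +
      D.incl (D.cFun k i) * metaS D g i v := by
  rw [metaT, dlElt_eq D k (fun i : b.support => metaS_implements D g i)]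
  change ((k.val i : ℂ) ^ 2) • v - D.incl (D.cFun k i) * v + D.incl (D.cFun k i) * metaS D g i v = _
  rw [Algebra.smul_def, sub_mul]

lemma incl_cFun (i : ι) : D.incl (D.cFun k i) =
    (1 - algebraMap ℂ D.CP ((k.val i : ℂ) ^ 2) * mono (D.metaRootP i)) /
      (1 - mono (D.metaRootP i)) := by
  rw [MetaplecticStructure.cFun, map_div₀, map_sub, map_sub, map_mul, map_one, AlgHom.commutes,
    incl_mono_metaRootW]

/-- The action of the Demazure-Lusztig operators on monomials. -/
lemma metaT_mono (i : b.support) (x : WeightLat Φ) : metaT D g i (mono x) =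
    algebraMap ℂ D.CP (1 - (k.val i : ℂ) ^ 2) *
      ((mono (x - (wpair Φ x i + (-wpair Φ x i) % D.m i) • rootW Φ i) - mono x) /
        (1 - mono (D.metaRootP i))) -
    algebraMap ℂ D.CP ((k.val i : ℂ) ^ 2 *
      (g.g (D.Qroot i * (1 - wpair Φ x i)) (D.size i) : ℂ)) *
      mono (-D.metaRootP i + rootW Φ i + sRefl Φ (i : ι) • x) := by
  have h1 := one_sub_mono_ne_zero (metaRootP_ne_zero D (i : ι))
  have h2 := one_sub_mul_mono_ne_zero ((k.val i : ℂ) ^ 2) (metaRootP_ne_zero D (i : ι))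
  have h0 := mono_ne_zero (D.metaRootP i)
  have e : mono (x - (wpair Φ x i + (-wpair Φ x i) % D.m i) • rootW Φ i) =
      mono (-((-wpair Φ x i) % D.m i) • rootW Φ (i : ι)) * mono (sRefl Φ (i : ι) • x) := by
    rw [← mono_add, refl_smul_weight]
    congr 1
    module
  rw [metaT_apply, metaS_mono, incl_cFun, cocyc, e, mono_add, mono_add, mono_neg,
    map_sub _ (1 : ℂ), map_one]
  generalize mono (D.metaRootP i) = X at *
  field_simp
  ring

/-- The scalar by which `T_i` maps the monomial of a dominant weight to the reflected one. -/
def stepFactor (i : ι) (t : ℤ) : ℂ :=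
  if t = D.m i then 1 else
    -((k.val i : ℂ) ^ 2 * (g.g (D.Qroot i * (D.m i - t)) (D.size i) : ℂ))

lemma stepFactor_ne_zero (i : ι) (t : ℤ) : stepFactor D g i t ≠ 0 := by
  rw [stepFactor]
  split_ifs
  · exact one_ne_zero
  · exact neg_ne_zero.2 (mul_ne_zero (pow_ne_zero _ (k.val i).ne_zero) (Units.ne_zero _))

/-- The shifted monomials. -/
def shiftMono (b : Φ.Base) (x : WeightLat Φ) : D.CP := mono (x + shiftW D b)

/-- The shift turns the pairing t into t + 1 - m(α), and sends the second monomial of `metaT_mono`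
to the shifted monomial of s_i x. For t < m(α) the remainder cancels the pairing and the divided
difference vanishes. For t = m(α) the divided difference contributes 1 - q and the parameter g = -1
contributes q at the same monomial, hence the factor 1. -/
lemma metaT_shiftMono (i : b.support) (x : WeightLat Φ) (h0 : 0 ≤ wpair Φ x i)
    (h1 : wpair Φ x i ≤ D.m i) : metaT D g i (shiftMono D b x) =
      stepFactor D g i (wpair Φ x i) • shiftMono D b (sRefl Φ (i : ι) • x) := by
  set t := wpair Φ x i with ht
  have hm : (0 : ℤ) < D.m i := by exact_mod_cast D.m_pos i
  have hw : wpair Φ (x + shiftW D b) i = t + 1 - D.m i := by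
    rw [wpair_add, wpair_shiftW]; ring
  have hs : -D.metaRootP i + rootW Φ i + sRefl Φ (i : ι) • (x + shiftW D b) =
      sRefl Φ (i : ι) • x + shiftW D b := by
    rw [smul_add, refl_smul_weight Φ (shiftW D b), wpair_shiftW, metaRootP_eq]
    generalize sRefl Φ (i : ι) • x = y
    module
  rw [shiftMono, shiftMono, metaT_mono, hw, hs, stepFactor, Algebra.smul_def,
    show 1 - (t + 1 - D.m i) = D.m i - t by ring]
  split_ifs with htm
  · have h2 : (-(t + 1 - (D.m i : ℤ))) % D.m i = D.m i - 1 := by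
      rw [htm, show -((D.m i : ℤ) + 1 - D.m i) = (D.m i - 1) + D.m i * (-1) by ring,
        Int.add_mul_emod_self_left, Int.emod_eq_of_lt (by omega) (by omega)]
    have hg : g.g (D.Qroot i * (D.m i - t)) (D.size i) = -1 :=
      g.eq_neg_one _ _ (by rw [htm, sub_self, mul_zero]; exact dvd_zero _)
    have e1 : x + shiftW D b - (t + 1 - (D.m i : ℤ) + (D.m i - 1)) • rootW Φ (i : ι) =
        sRefl Φ (i : ι) • x + shiftW D b := by
      rw [refl_smul_weight, ← ht]; module
    have e2 : mono (x + shiftW D b) = mono (D.metaRootP i) *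
        mono (sRefl Φ (i : ι) • x + shiftW D b) := by
      rw [← mono_add, metaRootP_eq, refl_smul_weight, ← ht, htm]
      congr 1; module
    have h3 := one_sub_mono_ne_zero (metaRootP_ne_zero D (i : ι))
    rw [h2, e1, e2, hg, map_one]
    simp only [map_sub, map_mul, map_one, Units.val_neg, Units.val_one, map_neg]
    field_simp
    ring
  · have h2 : (-(t + 1 - (D.m i : ℤ))) % D.m i = -(t + 1 - D.m i) :=
      Int.emod_eq_of_lt (by omega) (by omega)
    rw [h2, add_neg_cancel, zero_smul, sub_zero, sub_self, zero_div, mul_zero, zero_sub, map_neg]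
    ring

lemma stepsDown (i j : b.support) : StepsDown (metaT D g i) (shiftMono D b) (InDomain D)
    (fun x => sRefl Φ (i : ι) • x) (fun x => wpair Φ x i) (fun x => wpair Φ x j)
    (stepFactor D g i) (Φ.pairingIn ℤ i j) := by
  rintro x p r hx rfl rfl h0
  exact ⟨metaT_shiftMono D g i x h0 (abs_le.1 (hx i)).2, hx.weyl D _, wpair_sRefl_self x i,
    wpair_sRefl x i j⟩

/-- Order three makes the two simple roots conjugate under W, so k, Q, m and size agree on them. -/
lemma stepFactor_eq {i j : b.support} (h : i ≠ j) (ho : orderOf (sRefl Φ i * sRefl Φ j) = 3) :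
    stepFactor D g (i : ι) = stepFactor D g j := by
  have hc := exists_weyl_smul_eq h ho
  have h1 := val_eq_of_orderOf k h ho
  have h2 : D.Qroot i = D.Qroot j := by rw [← hc, D.Qroot_weyl]
  have h3 : D.m i = D.m j := by rw [← hc, D.m_weyl]
  have h4 : D.size i = D.size j := by
    have hn : ‖D.metaRoot i‖ = ‖D.metaRoot j‖ := by
      rw [← hc, ← D.weyl_smul_metaRoot]
      have : ‖(sRefl Φ j * sRefl Φ i) • D.metaRoot j‖ ^ 2 = ‖D.metaRoot j‖ ^ 2 := by
        rw [← real_inner_self_eq_norm_sq, ← real_inner_self_eq_norm_sq, inner_weyl]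
      exact (sq_eq_sq₀ (norm_nonneg _) (norm_nonneg _)).1 this
    rw [MetaplecticStructure.size, MetaplecticStructure.size, hn]
  funext t
  rw [stepFactor, stepFactor, h1, h2, h3, h4]

lemma braid_word_smul {i j : b.support} {m : ℕ} (ho : orderOf (sRefl Φ i * sRefl Φ j) = m)
    (x : WeightLat Φ) : altProd (sRefl Φ i) (sRefl Φ j) m • x =
      altProd (sRefl Φ j) (sRefl Φ i) m • x := by
  subst ho
  rw [sRefl_braid]

/-- The braid relation on the shifted monomials of dominant weights. -/
lemma metaT_braid_dominant {i j : b.support} (h : i ≠ j) {x : WeightLat Φ} (hx : InDomain D x)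
    (hi : 0 ≤ wpair Φ x i) (hj : 0 ≤ wpair Φ x j) :
    altProd (metaT D g i) (metaT D g j) (orderOf (sRefl Φ i * sRefl Φ j)) (shiftMono D b x) =
      altProd (metaT D g j) (metaT D g i) (orderOf (sRefl Φ i * sRefl Φ j)) (shiftMono D b x) := by
  have s₁ := stepsDown D g i j
  have s₂ := stepsDown D g j i
  have hw : ∀ m, orderOf (sRefl Φ i * sRefl Φ j) = m → _ := fun m hm =>
    braid_word_smul (i := i) (j := j) hm x
  rcases orderOf_cases h with ⟨h1, h2, h3⟩ | ⟨h1, h2, h3⟩ | ⟨h1, h2, h3⟩ | ⟨h1, h2, h3⟩ |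
    ⟨h1, h2, h3⟩ | ⟨h1, h2, h3⟩
  all_goals
    rw [h1] at s₁
    rw [h2] at s₂
    have hw' := hw _ h3
    simp only [altProd, mul_smul, one_smul] at hw'
  · rw [h3]; exact s₁.braid_two s₂ hx hi hj hw'
  · rw [h3]
    rw [← stepFactor_eq D g h h3] at s₂
    exact s₁.braid_three s₂ hx hi hj hw'
  · rw [h3]; exact s₁.braid_four s₂ hx hi hj hw'
  · rw [h3]; exact (s₂.braid_four s₁ hx hj hi hw'.symm).symm
  · rw [h3]; exact s₁.braid_six s₂ hx hi hj hw'
  · rw [h3]; exact (s₂.braid_six s₁ hx hj hi hw'.symm).symm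

lemma orderOf_mem_of_ne {i j : b.support} (h : i ≠ j) :
    let m := orderOf (sRefl Φ i * sRefl Φ j)
    m = 2 ∨ (m = 3 ∧ (k.val i : ℂ) ^ 2 = (k.val j : ℂ) ^ 2) ∨ m = 4 ∨ m = 6 := by
  intro m
  rcases orderOf_cases h with ⟨-, -, h3⟩ | ⟨-, -, h3⟩ | ⟨-, -, h3⟩ | ⟨-, -, h3⟩ |
    ⟨-, -, h3⟩ | ⟨-, -, h3⟩
  · exact Or.inl h3
  · exact Or.inr (Or.inl ⟨h3, by rw [val_eq_of_orderOf k h h3]⟩)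
  · exact Or.inr (Or.inr (Or.inl h3))
  · exact Or.inr (Or.inr (Or.inl h3))
  · exact Or.inr (Or.inr (Or.inr h3))
  · exact Or.inr (Or.inr (Or.inr h3))

lemma orderOf_mul_comm' (i j : b.support) :
    orderOf (sRefl Φ j * sRefl Φ i) = orderOf (sRefl Φ i * sRefl Φ j) := by
  rw [← orderOf_inv, mul_inv_rev, sRefl_inv, sRefl_inv]

/-- If `x` is not dominant for `i`, then its shifted monomial is in the image of `T_i`. -/
lemma exists_metaT_eq (i : b.support) {x : WeightLat Φ} (hx : InDomain D x)
    (hi : wpair Φ x i < 0) : ∃ c : ℂ, shiftMono D b x =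
      c • metaT D g i (shiftMono D b (sRefl Φ (i : ι) • x)) := by
  have h1 := wpair_sRefl_self x (i : ι)
  have h2 := (abs_le.1 (hx i)).1
  have h3 := metaT_shiftMono D g i (sRefl Φ (i : ι) • x) (by omega) (by omega)
  rw [← mul_smul, sRefl_mul_self, one_smul] at h3
  exact ⟨_, by rw [h3, inv_smul_smul₀ (stepFactor_ne_zero D g _ _)]⟩

lemma metaT_quad (i : b.support) : metaT D g i * metaT D g i =
    ((k.val i : ℂ) ^ 2 - 1) • metaT D g i + ((k.val i : ℂ) ^ 2) • 1 :=
  dlElt_quad D k (fun i : b.support => metaS_implements D g i) i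

lemma metaT_braid_shiftMono {i j : b.support} (h : i ≠ j) {x : WeightLat Φ} (hx : InDomain D x) :
    (altProd (metaT D g i) (metaT D g j) (orderOf (sRefl Φ i * sRefl Φ j)) -
      altProd (metaT D g j) (metaT D g i) (orderOf (sRefl Φ i * sRefl Φ j))) (shiftMono D b x) =
      0 := by
  set m := orderOf (sRefl Φ i * sRefl Φ j) with hm
  set L := altProd (metaT D g i) (metaT D g j) m - altProd (metaT D g j) (metaT D g i) m with hL
  obtain ⟨U₁, hU₁⟩ := braid_sub_mul (metaT_quad D g i) (metaT_quad D g j) (orderOf_mem_of_ne h)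
  obtain ⟨U₂, hU₂⟩ := braid_sub_mul' (metaT_quad D g i) (metaT_quad D g j)
    (by simpa only [orderOf_mul_comm'] using orderOf_mem_of_ne (k := k) h.symm)
  rw [← hm, ← hL] at hU₁ hU₂
  -- A vector e(y) with y negative against α_l is a multiple of T_l e(s_l y), so L T_l = U L
  -- transfers vanishing from s_l y to y.
  have hstep : ∀ (l : b.support) (U : Module.End ℂ D.CP), L * metaT D g l = U * L →
      ∀ y : WeightLat Φ, InDomain D y → wpair Φ y l < 0 →
      L (shiftMono D b (sRefl Φ (l : ι) • y)) = 0 → L (shiftMono D b y) = 0 := by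
    intro l U hU y hy hneg h0
    obtain ⟨c, hc⟩ := exists_metaT_eq D g l hy hneg
    have : L (metaT D g l (shiftMono D b (sRefl Φ (l : ι) • y))) =
        U (L (shiftMono D b (sRefl Φ (l : ι) • y))) :=
      congrArg (fun T : Module.End ℂ D.CP => T (shiftMono D b (sRefl Φ (l : ι) • y))) hU
    rw [hc, map_smul, this, h0, map_zero, smul_zero]
  by_contra hne
  let S : Set Φ.weylGroup := {w | L (shiftMono D b (w • x)) ≠ 0}
  -- Take the highest weight in the W-orbit not killed by L. A negative pairing with α_i or α_j
  -- would let the reflection raise the height, so L would kill the reflected vector and then this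
  -- one. Hence the weight is dominant for i and j, where vanishing is already known.
  obtain ⟨w, hwS, hmax⟩ := Set.exists_max_image S (fun w => heightLin b ((w • x : WeightLat Φ) : E))
    (Set.toFinite S) ⟨1, by simpa [S] using hne⟩
  have hgrow : ∀ l : b.support, wpair Φ (w • x) l < 0 →
      L (shiftMono D b (sRefl Φ (l : ι) • w • x)) = 0 := by
    intro l hl
    by_contra hc
    have h1 := hmax (sRefl Φ (l : ι) * w) (by
      change L (shiftMono D b ((sRefl Φ (l : ι) * w) • x)) ≠ 0
      rwa [mul_smul])
    rw [mul_smul, refl_smul_weight, AddSubgroup.coe_sub, AddSubgroup.coe_zsmul,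
      ← Int.cast_smul_eq_zsmul ℝ, map_sub, LinearMap.map_smul] at h1
    have h2 : heightLin b ((rootW Φ (l : ι) : WeightLat Φ) : E) = 1 := by
      change heightLin b (Φ.root l) = 1
      rw [heightLin_root, RootPairing.Base.height_one_of_mem_support l.2, Int.cast_one]
    rw [h2, smul_eq_mul, mul_one] at h1
    have h3 : ((wpair Φ (w • x) l : ℤ) : ℝ) < 0 := by exact_mod_cast hl
    linarith
  have hd := hx.weyl D w
  by_cases h1 : wpair Φ (w • x) i < 0
  · exact hwS (hstep i U₁ hU₁ _ hd h1 (hgrow i h1))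
  by_cases h2 : wpair Φ (w • x) j < 0
  · exact hwS (hstep j U₂ hU₂ _ hd h2 (hgrow j h2))
  apply hwS
  rw [hL, LinearMap.sub_apply, metaT_braid_dominant D g h hd (not_lt.1 h1) (not_lt.1 h2), sub_self]

lemma altProd_metaS_incl_mul (i j : ι) (m : ℕ) (f : RatFun D.MetaWeightLat) (v : D.CP) :
    altProd (metaS D g i : Module.End ℂ D.CP) (metaS D g j) m (D.incl f * v) =
      D.incl (altProd (sRefl Φ i) (sRefl Φ j) m • f) *
        altProd (metaS D g i : Module.End ℂ D.CP) (metaS D g j) m v := by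
  induction m generalizing i j f v with
  | zero => simp [altProd]
  | succ m ih => rw [altProd, altProd, Module.End.mul_apply, Module.End.mul_apply, ih,
      metaS_incl_mul, mul_smul]

/-- The operators `σ(s_i)` satisfy the braid relations. -/
theorem metaS_braid {i j : b.support} (h : i ≠ j) :
    altProd (metaS D g i : Module.End ℂ D.CP) (metaS D g j) (orderOf (sRefl Φ i * sRefl Φ j)) =
      altProd (metaS D g j : Module.End ℂ D.CP) (metaS D g i)
        (orderOf (sRefl Φ i * sRefl Φ j)) := by
  obtain ⟨N, hN0, hN⟩ := braidDefect_dlElt D k (fun i : b.support => metaS_implements D g i) h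
  set m := orderOf (sRefl Φ i * sRefl Φ j) with hm
  -- Both words in the σ(s_i) are semilinear over the same Weyl group element, so their difference
  -- is semilinear as well.
  have hlin : ∀ (f : RatFun D.MetaWeightLat) (v : D.CP),
      (altProd (metaS D g i : Module.End ℂ D.CP) (metaS D g j) m -
        altProd (metaS D g j : Module.End ℂ D.CP) (metaS D g i) m) (D.incl f * v) =
      D.incl (altProd (sRefl Φ i) (sRefl Φ j) m • f) *
        (altProd (metaS D g i : Module.End ℂ D.CP) (metaS D g j) m -
        altProd (metaS D g j : Module.End ℂ D.CP) (metaS D g i) m) v := by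
    intro f v
    rw [LinearMap.sub_apply, LinearMap.sub_apply, altProd_metaS_incl_mul, altProd_metaS_incl_mul,
      mul_sub, hm, sRefl_braid]
  -- By semilinearity the factor N of the braid defect comes out as a twist of N, still nonzero, and
  -- can be cancelled.
  have hzero : ∀ x, InDomain D x → (altProd (metaS D g i : Module.End ℂ D.CP) (metaS D g j) m -
        altProd (metaS D g j : Module.End ℂ D.CP) (metaS D g i) m) (shiftMono D b x) = 0 := by
    intro x hx
    have h1 := metaT_braid_shiftMono D g h hx
    rw [← hm] at h1
    have h2 := congrArg (fun T : Module.End ℂ D.CP => T (shiftMono D b x)) hN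
    change (altProd (metaT D g i) (metaT D g j) m - altProd (metaT D g j) (metaT D g i) m) _ =
      (altProd (metaS D g i : Module.End ℂ D.CP) (metaS D g j) m -
        altProd (metaS D g j : Module.End ℂ D.CP) (metaS D g i) m)
        (D.incl N * shiftMono D b x) at h2
    rw [h1, hlin] at h2
    refine (mul_eq_zero.1 h2.symm).resolve_left ?_
    rw [map_eq_zero, ← weylHom_apply, map_eq_zero]
    exact hN0
  rw [← sub_eq_zero]
  refine LinearMap.ext fun v => ?_
  rw [LinearMap.zero_apply]
  induction v using cp_induction D with
  | h0 => rw [map_zero]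
  | hadd u v hu hv => rw [map_add, hu, hv, add_zero]
  | h f x =>
    -- Every monomial is x^{-ν}, with ν ∈ P^m, times a shifted monomial from the domain.
    obtain ⟨ν, hν⟩ := exists_inDomain D (x - shiftW D b)
    have hx : mono x = D.incl (mono (-ν)) * shiftMono D b (x - shiftW D b + D.toWeight ν) := by
      rw [incl_mono, shiftMono, ← mono_add, map_neg]
      congr 1
      abel
    rw [hx, hlin, hlin, hzero _ hν, mul_zero, mul_zero]

end MetaBraid

end

/-! ### The representation τ and the metaplectic Demazure–Lusztig operators. -/

section

section AltProd

lemma map_altProd {A B : Type*} [Monoid A] [Monoid B] (f : A →* B) (x y : A) (m : ℕ) :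
    f (altProd x y m) = altProd (f x) (f y) m := by
  induction m generalizing x y with
  | zero => exact map_one f
  | succ m ih => rw [altProd, altProd, map_mul, ih]

lemma altProd_succ' {A : Type*} [Monoid A] (x y : A) (m : ℕ) :
    altProd x y (m + 1) = altProd x y m * if Even m then x else y := by
  induction m generalizing x y with
  | zero => simp [altProd]
  | succ m ih =>
    rw [altProd, ih, altProd, mul_assoc]
    by_cases h : Even m <;> simp [h, Nat.even_add_one]

lemma inv_altProd {G : Type*} [Group G] (x y : G) (m : ℕ) :
    (altProd x y m)⁻¹ = if Even m then altProd y⁻¹ x⁻¹ m else altProd x⁻¹ y⁻¹ m := by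
  induction m with
  | zero => simp [altProd]
  | succ m ih =>
    rw [altProd_succ', mul_inv_rev, ih]
    by_cases h : Even m <;> simp [h, Nat.even_add_one, altProd]

lemma altProd_inv_comm {G : Type*} [Group G] {x y : G} {m : ℕ}
    (h : altProd x y m = altProd y x m) : altProd x⁻¹ y⁻¹ m = altProd y⁻¹ x⁻¹ m := by
  have := congrArg (·⁻¹) h
  simp only [inv_altProd] at this
  split_ifs at this
  · exact this.symm
  · exact this

lemma altProd_conj {A : Type*} [Monoid A] {u u' : A} (h : u' * u = 1) (h' : u * u' = 1) (x y : A)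
    (m : ℕ) : altProd (u * x * u') (u * y * u') m = u * altProd x y m * u' := by
  induction m generalizing x y with
  | zero => simp [altProd, h']
  | succ m ih =>
    rw [altProd, ih, altProd]
    simp only [mul_assoc]
    rw [← mul_assoc u' u, h, one_mul]

variable {K A : Type*} [Field K] [Ring A] [Algebra K A]

/-- The quadratic relation gives c² M⁻¹ = M - (c² - 1), and T' = c M⁻¹. -/
lemma neg_smul_inv_of_quadratic {c : K} (h0 : c ≠ 0) {T T' M : A} (hM : c • T = M)
    (hq : M * M = (c ^ 2 - 1) • M + c ^ 2 • 1) (h : T' * T = 1) :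
    (-c) • T' = (c ^ 2 - 1) • 1 - M := by
  have h1 : T' * M = c • 1 := by rw [← hM, mul_smul_comm, h]
  have h2 := congrArg (c⁻¹ • T' * ·) hq
  simp only [mul_add, mul_smul_comm, ← mul_assoc, smul_mul_assoc, h1, smul_smul,
    inv_mul_cancel₀ h0, one_smul, one_mul, mul_one] at h2
  have h3 : c ^ 2 * c⁻¹ = c := by field_simp
  rw [h3] at h2
  rw [h2, neg_smul]
  abel

lemma neg_smul_conj (c : K) (u T u' : A) : -(c • (u * T * u')) = u * ((-c) • T) * u' := by
  rw [neg_smul, mul_neg, neg_mul, mul_smul_comm, smul_mul_assoc]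

/-- The substitution M ↦ q - 1 - M exchanges the two roots q and -1 of the quadratic relation, and
conjugation preserves it. -/
lemma conj_quadratic {q : K} {u u' M : A} (h1 : u' * u = 1) (h2 : u * u' = 1)
    (hq : M * M = (q - 1) • M + q • 1) :
    u * ((q - 1) • 1 - M) * u' * (u * ((q - 1) • 1 - M) * u') =
      (q - 1) • (u * ((q - 1) • 1 - M) * u') + q • 1 := by
  have hN : ((q - 1) • 1 - M) * ((q - 1) • 1 - M) = (q - 1) • ((q - 1) • 1 - M) + q • 1 := by
    rw [sub_mul, mul_sub, mul_sub, hq, smul_mul_assoc, one_mul, smul_mul_assoc, one_mul,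
      mul_smul_comm, mul_one]
    module
  generalize (q - 1) • 1 - M = N at hN
  calc u * N * u' * (u * N * u') = u * N * (u' * u) * N * u' := by simp only [mul_assoc]
    _ = u * (N * N) * u' := by rw [h1, mul_one, mul_assoc u]
    _ = _ := by rw [hN, mul_add, add_mul, mul_smul_comm, smul_mul_assoc, mul_smul_comm,
      smul_mul_assoc, mul_one, h2]

end AltProd

variable {ι E : Type*} [NormedAddCommGroup E] [InnerProductSpace ℝ E]
variable {Φ : RootPairing ι ℝ E E}

section Lattices

variable [IsEuclidean Φ] [Φ.IsCrystallographic] {Λ : AddSubgroup E}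

lemma mono_mem_polySub {x : WeightLat Φ} (hx : (x : E) ∈ Λ) : mono x ∈ polySub Φ Λ :=
  Submodule.subset_span (mono_mem_monomials hx)

lemma mono_mem_ratSub {x : WeightLat Φ} (hx : (x : E) ∈ Λ) : mono x ∈ ratSub Φ Λ :=
  IntermediateField.subset_adjoin _ _ (mono_mem_monomials hx)

/-- A finite geometric sum, built by telescoping in both directions from z = 0. -/
lemma divided_difference_mem_polySub {x y : WeightLat Φ} (hx : (x : E) ∈ Λ) (hy : (y : E) ∈ Λ)
    (hy0 : y ≠ 0) (z : ℤ) : (mono (x - z • y) - mono x) / (1 - mono y) ∈ polySub Φ Λ := by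
  have h0 := one_sub_mono_ne_zero hy0
  have hmem : ∀ z : ℤ, ((x - z • y : WeightLat Φ) : E) ∈ Λ := fun z =>
    Λ.sub_mem hx (Λ.zsmul_mem hy z)
  have hstep : ∀ z : ℤ, (mono (x - (z + 1) • y) - mono x) / (1 - mono y) =
      (mono (x - z • y) - mono x) / (1 - mono y) + mono (x - (z + 1) • y) := by
    intro z
    have : mono (x - z • y) = mono (x - (z + 1) • y) * mono y := by
      rw [← mono_add]; congr 1; module
    rw [this]
    field_simp
    ring
  induction z using Int.induction_on with
  | zero => simp
  | succ n ih => rw [hstep]; exact add_mem ih (mono_mem_polySub (hmem _))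
  | pred n ih =>
    have := hstep (-(n : ℤ) - 1)
    rw [sub_add_cancel] at this
    rw [eq_sub_iff_add_eq.2 this.symm]
    exact sub_mem ih (mono_mem_polySub (hmem _))

lemma rootLat_le_weightLat : RootLat Φ ≤ WeightLat Φ :=
  (AddSubgroup.closure_le _).2 (by rintro _ ⟨i, rfl⟩; exact root_mem_weightLat i)

lemma root_mem_of_le (hQ : RootLat Φ ≤ Λ) (i : ι) : ((rootW Φ i : WeightLat Φ) : E) ∈ Λ :=
  hQ (AddSubgroup.subset_closure ⟨i, rfl⟩)

lemma sRefl_smul_mem (hQ : RootLat Φ ≤ Λ) (i : ι) {x : WeightLat Φ} (hx : (x : E) ∈ Λ) :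
    ((sRefl Φ i • x : WeightLat Φ) : E) ∈ Λ := by
  rw [refl_smul_weight]
  exact Λ.sub_mem hx (Λ.zsmul_mem (root_mem_of_le hQ i) _)

lemma sRefl_smul_mem_ratSub (hQ : RootLat Φ ≤ Λ) (i : ι) {v : RatFun (WeightLat Φ)}
    (hv : v ∈ ratSub Φ Λ) : sRefl Φ i • v ∈ ratSub Φ Λ := by
  have : ratSub Φ Λ ≤ (ratSub Φ Λ).comap (weylHom (WeightLat Φ) (sRefl Φ i)) := by
    conv_lhs => rw [ratSub]
    rw [IntermediateField.adjoin_le_iff]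
    rintro _ ⟨x, hx, rfl⟩
    change weylHom (WeightLat Φ) (sRefl Φ i) (mono x) ∈ ratSub Φ Λ
    rw [weylHom_apply, weyl_smul_mono]
    exact mono_mem_ratSub (sRefl_smul_mem hQ i hx)
  exact this hv

end Lattices

section MetaplecticRep

variable [IsEuclidean Φ] [Φ.IsCrystallographic] {D : MetaplecticStructure Φ}
variable {k : Multiplicity Φ} {g : D.RepParameter k}
variable [Finite ι] [Φ.IsRootSystem] [Φ.IsReduced] {b : Φ.Base}
variable {σ : D.Semidirect →ₐ[ℂ] Module.End ℂ D.CP}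

lemma IsMetaplecticRep.semiF_apply (hσ : D.IsMetaplecticRep g b σ) (h : RatFun D.MetaWeightLat)
    (v : D.CP) : σ (D.semiF h) v = D.incl h * v := by
  induction v using cp_induction D with
  | h0 => rw [map_zero, mul_zero]
  | hadd u v hu hv => rw [map_add, hu, hv, mul_add]
  | h f x => rw [hσ.fun_apply, mul_assoc]

lemma IsMetaplecticRep.semiW_eq (hσ : D.IsMetaplecticRep g b σ) (i : b.support) :
    σ (D.semiW (sRefl Φ i)) = metaS D g i := by
  refine LinearMap.ext fun v => ?_
  induction v using cp_induction D with
  | h0 => rw [map_zero, map_zero]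
  | hadd u v hu hv => rw [map_add, map_add, hu, hv]
  | h f x => rw [hσ.refl_apply, metaS_apply]

variable (D b g) in
theorem existsUnique_metaplecticRep :
    ∃! σ : D.Semidirect →ₐ[ℂ] Module.End ℂ D.CP, D.IsMetaplecticRep g b σ := by
  obtain ⟨σ, h1, h2⟩ := exists_semidirect_lift D (J := multHom D)
    (S := fun i : b.support => metaS D g i) (fun i => metaS_implements D g i)
    (fun i j h => metaS_braid D g h)
  refine ⟨σ, ⟨fun i f x => ?_, fun h f x => ?_⟩, fun σ' hσ' => ?_⟩
  · rw [h2, metaS_apply]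
  · rw [h1, multHom_apply, mul_assoc]
  · refine semidirect_hom_ext D b (fun h => ?_) fun i => ?_
    · rw [h1]
      exact LinearMap.ext fun v => IsMetaplecticRep.semiF_apply hσ' h v
    · rw [h2, IsMetaplecticRep.semiW_eq hσ']

/-- The Chinta-Gunnells formula for the metaplectic representation with equal parameters. -/
lemma sigmaFormula_eq_chintaGunnells {κ : ℂˣ} {γ : ℤ → ℂ} (hκ : ∀ i, k.val i = κ)
    (hγ : ∀ j y, (g.g j y : ℂ) = γ j) (i : ι) (f : RatFun D.MetaWeightLat) (x : WeightLat Φ) :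
    D.sigmaFormula g i f x = D.chintaGunnells ((κ : ℂ) ^ 2) γ i f x := by
  have h2 := one_sub_mul_mono_ne_zero ((κ : ℂ) ^ 2) (metaRootP_ne_zero D i)
  have h3 := mono_ne_zero (D.metaRootP i)
  have hr : (-(D.Broot x i / D.Qroot i)) % (D.m i : ℤ) = (-wpair Φ x i) % D.m i := by
    rw [Broot_eq]
    -- Division by zero yields 0 here, but then gcd(n, 0) = n gives m(α) = 1, and all remainders
    -- modulo 1 agree.
    by_cases hQ : D.Qroot i = 0
    · have hm : D.m i = 1 := by
        rw [MetaplecticStructure.m, hQ, Int.gcd_zero_right, Int.natAbs_natCast,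
          Nat.div_self D.n_pos]
      rw [hm, Nat.cast_one, Int.emod_one, Int.emod_one]
    · rw [Int.mul_ediv_cancel_left _ hQ]
  have e1 : D.Qroot i * (1 - wpair Φ x i) = D.Qroot i - D.Broot x i := by rw [Broot_eq]; ring
  have e2 : mono ((1 - (D.m i : ℤ)) • rootW Φ i) = mono (rootW Φ i) / mono (D.metaRootP i) := by
    rw [← mono_sub, metaRootP_eq]; congr 1; module
  rw [sigmaFormula_eq, smul_mul', weyl_smul_incl, weyl_smul_mono, cocyc, e1,
    MetaplecticStructure.chintaGunnells, hr, e2, ← metaRootP_eq, hκ, hγ, mono_neg,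
    map_sub (algebraMap ℂ D.CP) 1, map_one]
  field_simp
  ring

section Operators

variable {τ : D.LocHecke b k →ₐ[ℂ] Module.End ℂ D.CP}

-- The defining formula of φ(s_i), solved for T_i; this is possible because c_i is nonzero.
variable (g) in
lemma tau_locT {φ : D.Semidirect ≃ₐ[ℂ] D.LocHecke b k} (hφ : D.IsLocalizationIso b k φ)
    (hS : ∀ i : b.support, τ (φ (D.semiW (sRefl Φ i))) = metaS D g i)
    (hJ : ∀ h v, τ (D.ratToLoc b k h) v = D.incl h * v) (i : b.support) :
    (k.val i : ℂ) • τ (D.locT k i : D.LocHecke b k) = metaT D g i := by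
  refine LinearMap.ext fun v => ?_
  have hc : D.incl (D.cFun k i) ≠ 0 := by
    rw [Ne, map_eq_zero]
    exact cFun_ne_zero D k i
  have h1 := congrArg (fun T : Module.End ℂ D.CP => T v) (hS i)
  simp only [hφ.map_refl, map_sub, map_add, map_mul, map_one, LinearMap.sub_apply,
    LinearMap.add_apply, Module.End.mul_apply, Module.End.one_apply, hJ, map_div₀,
    AlgHom.commutes] at h1
  rw [metaT_apply, ← h1, LinearMap.smul_apply, Algebra.smul_def]
  field_simp
  ring

lemma tau_locT_apply (hT : ∀ i : b.support, (k.val i : ℂ) • τ (D.locT k i : D.LocHecke b k) =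
    metaT D g i) (i : b.support) (v : D.CP) : τ (D.locT k i : D.LocHecke b k) v =
      (k.val i : ℂ) • v + (k.val i : ℂ)⁻¹ • (D.incl (D.cFun k i) * (metaS D g i v - v)) := by
  have h0 : (k.val i : ℂ) ≠ 0 := (k.val i).ne_zero
  have h1 : τ (D.locT k i : D.LocHecke b k) = (k.val i : ℂ)⁻¹ • metaT D g i := by
    rw [← hT, inv_smul_smul₀ h0]
  have h2 : (k.val i : ℂ) • v = (k.val i : ℂ)⁻¹ • (((k.val i : ℂ) ^ 2) • v) := by
    rw [smul_smul]; congr 1; field_simp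
  rw [h1, LinearMap.smul_apply, metaT_apply, h2, ← smul_add, Algebra.smul_def ((k.val i : ℂ) ^ 2)]
  congr 1
  ring

/-- The operators `-k_i τ(T_i⁻¹)`. -/
lemma tau_locT_inv (hT : ∀ i : b.support, (k.val i : ℂ) • τ (D.locT k i : D.LocHecke b k) =
    metaT D g i) (i : b.support) :
    (-(k.val i : ℂ)) • τ (↑(D.locT k i)⁻¹ : D.LocHecke b k) =
      ((k.val i : ℂ) ^ 2 - 1) • 1 - metaT D g i :=
  neg_smul_inv_of_quadratic (k.val i).ne_zero (hT i) (metaT_quad D g i)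
    (by rw [← map_mul, Units.inv_mul, map_one])

lemma demazureLusztig_eq (τ : D.LocHecke b k →ₐ[ℂ] Module.End ℂ D.CP) (i : b.support) :
    D.demazureLusztig τ i = τ (D.ratToLoc b k (mono (D.rho b))) *
      ((-(k.val i : ℂ)) • τ (↑(D.locT k i)⁻¹ : D.LocHecke b k)) *
        τ (D.ratToLoc b k (mono (-D.rho b))) := by
  rw [MetaplecticStructure.demazureLusztig, map_mul, map_mul]
  exact neg_smul_conj _ _ _ _

/-- The metaplectic Demazure-Lusztig operators in terms of the operators `k_i τ(T_i)`. -/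
lemma demazureLusztig_apply (hT : ∀ i : b.support,
    (k.val i : ℂ) • τ (D.locT k i : D.LocHecke b k) = metaT D g i)
    (hJ : ∀ h v, τ (D.ratToLoc b k h) v = D.incl h * v) (i : b.support) (v : D.CP) :
    D.demazureLusztig τ i v = -(mono (D.metaRootP i) * metaT D g i v) := by
  have h1 := one_sub_mono_ne_zero (metaRootP_ne_zero D (i : ι))
  have h0 : D.incl (mono (D.rho b)) ≠ 0 := by rw [incl_mono]; exact mono_ne_zero _
  -- From s_i ρ^m = ρ^m - α_i^m: conjugation by x^{ρ^m} leaves multiplications alone and multiplies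
  -- the σ(s_i)-term by x^{α_i^m}.
  have e : D.incl (sRefl Φ (i : ι) • mono (-D.rho b)) =
      (D.incl (mono (D.rho b)))⁻¹ * mono (D.metaRootP i) := by
    rw [weyl_smul_mono, smul_neg, sRefl_smul_rho, neg_sub, sub_eq_neg_add, mono_add, map_mul,
      mono_neg, map_inv₀, incl_mono_metaRootW]
  rw [demazureLusztig_eq, tau_locT_inv hT, Module.End.mul_apply, Module.End.mul_apply, hJ, hJ,
    LinearMap.sub_apply, LinearMap.smul_apply, Module.End.one_apply, metaT_apply, metaT_apply,
    metaS_incl_mul, e, mono_neg, map_inv₀, incl_cFun, Algebra.smul_def, map_sub, map_one]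
  field_simp
  ring

lemma demazureLusztig_apply' (hT : ∀ i : b.support,
    (k.val i : ℂ) • τ (D.locT k i : D.LocHecke b k) = metaT D g i)
    (hJ : ∀ h v, τ (D.ratToLoc b k h) v = D.incl h * v) (i : b.support) (v : D.CP) :
    D.demazureLusztig τ i v =
      (1 - algebraMap ℂ D.CP ((k.val i : ℂ) ^ 2) * mono (D.metaRootP i)) *
        ((v - mono (D.metaRootP i) * metaS D g i v) / (1 - mono (D.metaRootP i))) - v := by
  have h1 := one_sub_mono_ne_zero (metaRootP_ne_zero D (i : ι))
  rw [demazureLusztig_apply hT hJ, metaT_apply, incl_cFun]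
  field_simp
  ring

lemma demazureLusztig_conj (τ : D.LocHecke b k →ₐ[ℂ] Module.End ℂ D.CP) :
    τ (D.ratToLoc b k (mono (-D.rho b))) * τ (D.ratToLoc b k (mono (D.rho b))) = 1 ∧
      τ (D.ratToLoc b k (mono (D.rho b))) * τ (D.ratToLoc b k (mono (-D.rho b))) = 1 := by
  constructor <;> rw [← map_mul, ← map_mul, ← mono_add]
  · rw [neg_add_cancel, mono_zero, map_one, map_one]
  · rw [add_neg_cancel, mono_zero, map_one, map_one]

/-- Inherited from the Hecke algebra: the braid relation of the units T_i is inverted, rescaled by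
-k_i and conjugated by the same x^{ρ^m} for all i. -/
lemma demazureLusztig_braid (τ : D.LocHecke b k →ₐ[ℂ] Module.End ℂ D.CP)
    {i j : b.support} (h : i ≠ j) :
    altProd (D.demazureLusztig τ i) (D.demazureLusztig τ j) (orderOf (sRefl Φ i * sRefl Φ j)) =
      altProd (D.demazureLusztig τ j) (D.demazureLusztig τ i)
        (orderOf (sRefl Φ i * sRefl Φ j)) := by
  obtain ⟨h1, h2⟩ := demazureLusztig_conj τ
  have h3 : altProd (D.locT k i) (D.locT k j) (orderOf (sRefl Φ i * sRefl Φ j)) =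
      altProd (D.locT k j) (D.locT k i) (orderOf (sRefl Φ i * sRefl Φ j)) := by
    apply Units.ext
    have hval : ∀ (x y : (D.LocHecke b k)ˣ) m, ((altProd x y m : (D.LocHecke b k)ˣ) :
      D.LocHecke b k) = altProd (x : D.LocHecke b k) y m := map_altProd (Units.coeHom _)
    rw [hval, hval, locT_braid D k h]
  have h4 := congrArg (fun x : (D.LocHecke b k)ˣ => τ x) (altProd_inv_comm h3)
  have hval : ∀ (x y : (D.LocHecke b k)ˣ) m, τ ((altProd x y m : (D.LocHecke b k)ˣ) :
      D.LocHecke b k) = altProd (τ x) (τ y) m :=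
    map_altProd ((τ : D.LocHecke b k →* Module.End ℂ D.CP).comp (Units.coeHom _))
  simp only [hval] at h4
  rw [demazureLusztig_eq, demazureLusztig_eq, altProd_conj h1 h2, altProd_conj h1 h2]
  refine congrArg (fun x => _ * x * _) ?_
  exact (altProd_smul _ _ _ _ _).trans ((congrArg₂ (· • ·)
    (altProd_val_comm k h fun c => -(c : ℂ)) h4).trans (altProd_smul _ _ _ _ _).symm)

lemma demazureLusztig_quad (hT : ∀ i : b.support,
    (k.val i : ℂ) • τ (D.locT k i : D.LocHecke b k) = metaT D g i) (i : b.support) :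
    D.demazureLusztig τ i * D.demazureLusztig τ i =
      ((k.val i : ℂ) ^ 2 - 1) • D.demazureLusztig τ i + ((k.val i : ℂ) ^ 2) • 1 := by
  obtain ⟨h1, h2⟩ := demazureLusztig_conj τ
  rw [demazureLusztig_eq, tau_locT_inv hT]
  exact conj_quadratic h1 h2 (metaT_quad D g i)

/-- On x^λ the operator is a combination of a divided difference along α_i^m and the monomial x^{α_i
+ s_i λ}; all exponents lie in λ + Q. -/
lemma demazureLusztig_mem_polySub (hT : ∀ i : b.support,
    (k.val i : ℂ) • τ (D.locT k i : D.LocHecke b k) = metaT D g i)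
    (hJ : ∀ h v, τ (D.ratToLoc b k h) v = D.incl h * v) {Λ : AddSubgroup E} (hQ : RootLat Φ ≤ Λ)
    (i : b.support) {v : D.CP} (hv : v ∈ polySub Φ Λ) :
    D.demazureLusztig τ i v ∈ polySub Φ Λ := by
  induction hv using Submodule.span_induction with
  | zero => rw [map_zero]; exact zero_mem _
  | add u v _ _ hu hv => rw [map_add]; exact add_mem hu hv
  | smul c v _ hv => rw [map_smul]; exact Submodule.smul_mem _ _ hv
  | mem v hv =>
    obtain ⟨x, hx, rfl⟩ := hv
    have hx : (x : E) ∈ Λ := hx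
    have hr : ((D.metaRootP i : WeightLat Φ) : E) ∈ Λ := by
      rw [metaRootP_eq]
      exact Λ.zsmul_mem (root_mem_of_le hQ i) _
    -- The pairing plus the remainder of its negative is a multiple of m(α_i), so the two exponents
    -- differ by a multiple of α_i^m.
    obtain ⟨z, hz⟩ : (D.m i : ℤ) ∣ wpair Φ x i + (-wpair Φ x i) % D.m i := by
      have := (Int.dvd_self_sub_emod (x := -wpair Φ x i) (m := D.m i)).neg_right
      rwa [neg_sub, sub_neg_eq_add, add_comm] at this
    have e1 : mono (D.metaRootP i) * mono (x - (wpair Φ x i + (-wpair Φ x i) % D.m i) •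
        rootW Φ (i : ι)) = mono (x + D.metaRootP i - z • D.metaRootP i) := by
      rw [← mono_add, hz, metaRootP_eq]
      congr 1
      module
    have e2 : mono (D.metaRootP i) * mono (-D.metaRootP i + rootW Φ i + sRefl Φ (i : ι) • x) =
        mono (rootW Φ i + sRefl Φ (i : ι) • x) := by
      rw [← mono_add]
      congr 1
      abel
    have e3 : mono (D.metaRootP i) * mono x = mono (x + D.metaRootP i) := by
      rw [mul_comm, ← mono_add]
    have e4 : ∀ X a p q r c d : D.CP, -(X * (a * ((p - q) / r) - c * d)) =
        -(a * ((X * p - X * q) / r) - c * (X * d)) := by intros; ring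
    rw [demazureLusztig_apply hT hJ, metaT_mono, e4, e2, e1, e3, ← Algebra.smul_def,
      ← Algebra.smul_def]
    refine neg_mem (sub_mem (Submodule.smul_mem _ _ ?_) (Submodule.smul_mem _ _ ?_))
    · exact divided_difference_mem_polySub (Λ.add_mem hx hr) hr (metaRootP_ne_zero D _) z
    · exact mono_mem_polySub (Λ.add_mem (root_mem_of_le hQ i) (sRefl_smul_mem hQ i hx))

/-- On the spanning elements f x^λ the value is an explicit expression in f, s_i f and monomials of
Λ. All of these lie in the field ℂ(Λ), which is s_i-stable because Λ contains Q. -/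
lemma demazureLusztig_mem_ratSub (hT : ∀ i : b.support,
    (k.val i : ℂ) • τ (D.locT k i : D.LocHecke b k) = metaT D g i)
    (hJ : ∀ h v, τ (D.ratToLoc b k h) v = D.incl h * v) {Λ : AddSubgroup E} (hQ : RootLat Φ ≤ Λ)
    (i : b.support) {v : D.CP} (hv : v ∈ ratSub Φ Λ) :
    D.demazureLusztig τ i v ∈ ratSub Φ Λ := by
  have hα : mono (rootW Φ (i : ι)) ∈ ratSub Φ Λ := mono_mem_ratSub (root_mem_of_le hQ i)
  have hX : mono (D.metaRootP i) ∈ ratSub Φ Λ := by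
    rw [mono_metaRootP]
    exact zpow_mem hα _
  have hC : ∀ c : ℂ, algebraMap ℂ D.CP c ∈ ratSub Φ Λ := fun c =>
    IntermediateField.algebraMap_mem _ c
  refine ratSub_induction D Λ (p := fun v => D.demazureLusztig τ i v ∈ ratSub Φ Λ) ?_ ?_ ?_ hv
  · rw [map_zero]; exact zero_mem _
  · intro u v hu hv
    rw [map_add]; exact add_mem hu hv
  · intro f x hf hx
    have hf' := metaSub_le D Λ hf
    rw [demazureLusztig_apply' hT hJ, metaS_incl_mul, metaS_mono, cocyc, ← weyl_smul_incl, mono_neg,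
      mono_zsmul]
    have h1 := sRefl_smul_mem_ratSub hQ (i : ι) hf'
    have h2 : mono x ∈ ratSub Φ Λ := mono_mem_ratSub hx
    have h3 : mono (sRefl Φ (i : ι) • x) ∈ ratSub Φ Λ := mono_mem_ratSub (sRefl_smul_mem hQ i hx)
    have ho := one_mem (ratSub Φ Λ)
    have h4 := zpow_mem hα (-((-wpair Φ x i) % (D.m i : ℤ)))
    have hd := sub_mem ho (mul_mem (hC ((k.val i : ℂ) ^ 2)) hX)
    refine sub_mem (mul_mem hd (div_mem (sub_mem (mul_mem hf' h2) (mul_mem hX (mul_mem h1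
      (mul_mem (div_mem (add_mem (mul_mem (hC _) h4) (mul_mem (mul_mem (hC _)
        (sub_mem ho (inv_mem hX))) hα)) hd) h3)))) (sub_mem ho hX))) (mul_mem hf' h2)

end Operators

end MetaplecticRep

end

end Metaplectic

end

theorem mainTheorem5 {ι E : Type*} [Finite ι] [NormedAddCommGroup E] [InnerProductSpace ℝ E]
    (Φ : RootPairing ι ℝ E E) [IsEuclidean Φ] [Φ.IsRootSystem] [Φ.IsCrystallographic]
    [Φ.IsReduced] [Φ.IsIrreducible] (b : Φ.Base)
    (D : MetaplecticStructure Φ) (k : Multiplicity Φ) (g : D.RepParameter k) :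
    (∃! φ : D.Semidirect ≃ₐ[ℂ] D.LocHecke b k, D.IsLocalizationIso b k φ) ∧
    (∃! σ : D.Semidirect →ₐ[ℂ] Module.End ℂ D.CP, D.IsMetaplecticRep g b σ) ∧
    ∀ (φ : D.Semidirect ≃ₐ[ℂ] D.LocHecke b k) (σ : D.Semidirect →ₐ[ℂ] Module.End ℂ D.CP),
      D.IsLocalizationIso b k φ → D.IsMetaplecticRep g b σ →
      ∀ τ : D.LocHecke b k →ₐ[ℂ] Module.End ℂ D.CP, τ = σ.comp (φ.symm : _ →ₐ[ℂ] _) →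
      -- the formulas for `τ`
      (∀ (i : b.support) (v : D.CP), τ (D.locT k i : D.LocHecke b k) v =
        (k.val i : ℂ) • v + (k.val i : ℂ)⁻¹ •
          (D.incl (D.cFun k i) * (σ (D.semiW (sRefl Φ i)) v - v))) ∧
      (∀ (h : RatFun D.MetaWeightLat) (v : D.CP), τ (D.ratToLoc b k h) v = D.incl h * v) ∧
      -- the operators `𝒯_i` in terms of `σ`
      (∀ (i : b.support) (v : D.CP), D.demazureLusztig τ i v =
        (1 - algebraMap ℂ D.CP ((k.val i : ℂ) ^ 2) * mono (D.metaRootP i)) *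
          ((v - mono (D.metaRootP i) * σ (D.semiW (sRefl Φ i)) v) / (1 - mono (D.metaRootP i)))
          - v) ∧
      -- for equal parameters `σ` is given by the Chinta-Gunnells formula
      (∀ (κ : ℂˣ) (γ : ℤ → ℂ), (∀ i, k.val i = κ) → (∀ j y, (g.g j y : ℂ) = γ j) →
        ∀ (i : b.support) (f : RatFun D.MetaWeightLat) (x : WeightLat Φ),
          σ (D.semiW (sRefl Φ i)) (D.incl f * mono x) =
            D.chintaGunnells ((κ : ℂ) ^ 2) γ i f x) ∧
      -- the braid and quadratic relations for the `𝒯_i`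
      (∀ i j : b.support, i ≠ j →
        altProd (D.demazureLusztig τ i) (D.demazureLusztig τ j)
            (orderOf (sRefl Φ i * sRefl Φ j)) =
          altProd (D.demazureLusztig τ j) (D.demazureLusztig τ i)
            (orderOf (sRefl Φ i * sRefl Φ j))) ∧
      (∀ i : b.support, D.demazureLusztig τ i * D.demazureLusztig τ i =
        ((k.val i : ℂ) ^ 2 - 1) • D.demazureLusztig τ i + ((k.val i : ℂ) ^ 2) • 1) ∧
      -- the `𝒯_i` preserve `ℂ[P]`, and `ℂ[Λ]` and `ℂ(Λ)` for all lattices `Q ⊆ Λ ⊆ P`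
      (∀ i : b.support, ∀ v ∈ polySub Φ (WeightLat Φ),
        D.demazureLusztig τ i v ∈ polySub Φ (WeightLat Φ)) ∧
      (∀ Λ : AddSubgroup E, RootLat Φ ≤ Λ → Λ ≤ WeightLat Φ → ∀ i : b.support,
        (∀ v ∈ polySub Φ Λ, D.demazureLusztig τ i v ∈ polySub Φ Λ) ∧
        (∀ v ∈ ratSub Φ Λ, D.demazureLusztig τ i v ∈ ratSub Φ Λ)) := by
  refine ⟨existsUnique_localizationIso D k, existsUnique_metaplecticRep D g b, ?_⟩
  rintro φ σ hφ hσ τ rfl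
  -- Everything below needs only these two consequences of τ ∘ φ = σ: the operators of the φ(s_i),
  -- and ℂ(P^m) acting by multiplication.
  have hS : ∀ i : b.support, σ.comp (φ.symm : _ →ₐ[ℂ] _) (φ (D.semiW (sRefl Φ i))) =
      metaS D g i := fun i => by
    rw [← IsMetaplecticRep.semiW_eq hσ]
    exact congrArg σ (φ.symm_apply_apply _)
  have hJ : ∀ h v, σ.comp (φ.symm : _ →ₐ[ℂ] _) (D.ratToLoc b k h) v = D.incl h * v := fun h v => by
    rw [← IsMetaplecticRep.semiF_apply hσ, ← hφ.map_fun]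
    exact congrArg (fun x => σ x v) (φ.symm_apply_apply _)
  have hT := tau_locT g hφ hS hJ
  refine ⟨fun i v => ?_, hJ, fun i v => ?_, fun κ γ hκ hγ i f x => ?_,
    fun i j h => demazureLusztig_braid _ h, fun i => demazureLusztig_quad hT i,
    fun i v hv => demazureLusztig_mem_polySub hT hJ rootLat_le_weightLat i hv,
    fun Λ hQ _ i => ⟨fun v hv => demazureLusztig_mem_polySub hT hJ hQ i hv,
      fun v hv => demazureLusztig_mem_ratSub hT hJ hQ i hv⟩⟩
  · rw [tau_locT_apply hT, IsMetaplecticRep.semiW_eq hσ]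
  · rw [demazureLusztig_apply' hT hJ, IsMetaplecticRep.semiW_eq hσ]
  · rw [hσ.refl_apply, sigmaFormula_eq_chintaGunnells hκ hγ]
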